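/- Let $(Y_p)_{p\text{ prime}}$ be independent random variables, each taking the values $1$ and $-1$ with probability $1/2$, and for every positive integer $n$ put $Y_n=|\mu(n)|\prod_{p\mid n}Y_p$, where $\mu$ is the Möbius function (so $Y_n=0$ unless $n$ is squarefree). Let $k\ge 2$ be a fixed integer, and put $$b(k)=\prod_p\Big(1-\frac1p\Big)^{k(2k-1)}\sum_{i=0}^{k}\binom{2k}{2i}\frac1{p^i},$$ $$\gamma(k)=\frac1{(2\pi i)^{2k}}\int_{(c_{2k})}\cdots\int_{(c_1)}\ \prod_{1\le i<j\le 2k}\frac1{s_i+s_j}\ \prod_{j=1}^{2k}e^{s_j}\,ds_j,$$ where $c_1,\dots,c_{2k}>0$ are arbitrary real numbers and $\int_{(c)}$ denotes integration along the vertical line from $c-i\infty$ to $c+i\infty$. Then the Euler product and the $2k$-fold integral converge absolutely and, as $x\to\infty$, $$\mathbb E\Big[\Big|\sum_{n\le x}Y_n\Big|^{2k}\Big]\sim\gamma(k)\,b(k)\,2^{2k}\,x^{k}(\log x)^{2k^2-3k}.$$ -/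

import Mathlib

open MeasureTheory ProbabilityTheory Filter Asymptotics

noncomputable section

/-- `X` is a random variable taking each of the values `1` and `-1` with probability `1/2`. -/
def IsRademacherVariable {Ω : Type*} [MeasurableSpace Ω] (P : Measure Ω) (X : Ω → ℝ) : Prop :=
  Measurable X ∧ P {ω | X ω = 1} = 1 / 2 ∧ P {ω | X ω = -1} = 1 / 2

/-- The multiplicative extension `Y_n = |μ(n)| ∏_{p ∣ n} Y_p` of a family `(Y_p)` indexed by the
primes; it vanishes unless `n` is squarefree. -/
def rademacherExtension {Ω : Type*} (Y : Nat.Primes → Ω → ℝ) (n : ℕ) (ω : Ω) : ℝ :=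
  |(ArithmeticFunction.moebius n : ℝ)| *
    ∏ p ∈ n.primeFactors.attach, Y ⟨p.1, Nat.prime_of_mem_primeFactors p.2⟩ ω

/-- The local factor at the prime `p` of the Euler product `b(k)`. -/
def eulerFactor (k : ℕ) (p : Nat.Primes) : ℝ :=
  (1 - 1 / (p : ℝ)) ^ (k * (2 * k - 1)) *
    ∑ i ∈ Finset.range (k + 1), ((2 * k).choose (2 * i) : ℝ) / (p : ℝ) ^ i

/-- `b(k) = ∏_p (1 - 1/p)^{k(2k-1)} ∑_{i=0}^{k} C(2k, 2i) p^{-i}`. -/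
def bConst (k : ℕ) : ℝ := ∏' p : Nat.Primes, eulerFactor k p

/-- The point `(c_j + i t_j)_j` on the product of the vertical lines `Re s_j = c_j`. -/
def linePoint {m : ℕ} (c t : Fin m → ℝ) (j : Fin m) : ℂ :=
  (c j : ℂ) + Complex.I * (t j : ℂ)

/-- The integrand `∏_{i<j} 1/(s_i+s_j) ∏_j e^{s_j} ds_j` of `γ(k)`, parametrised by
`s_j = c_j + i t_j`, so that `ds_j = i dt_j`. -/
def gammaIntegrand (k : ℕ) (c t : Fin (2 * k) → ℝ) : ℂ :=
  (∏ i : Fin (2 * k), ∏ j ∈ Finset.Ioi i, 1 / (linePoint c t i + linePoint c t j)) *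
    ∏ j : Fin (2 * k), (Complex.exp (linePoint c t j) * Complex.I)

/-- The `2k`-fold contour integral `γ(k)` over the lines `Re s_j = c_j`. -/
def gammaConst (k : ℕ) (c : Fin (2 * k) → ℝ) : ℂ :=
  1 / (2 * (Real.pi : ℂ) * Complex.I) ^ (2 * k) * ∫ t : Fin (2 * k) → ℝ, gammaIntegrand k c t

end

/-! Put m = 2k. Expanding the power and using E[∏ Y_p^{c_p}] = 1 when all c_p are even and 0
otherwise, the moment equals the number of m-tuples of squarefree integers up to x whose product is
a square (`integral_abs_sum_pow`). Such a tuple is encoded by labelling the edges of the complete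
graph on m vertices with positive integers d_e, n_i being the product of the labels at the vertex i
(`exists_vertexProd_eq`). The labelling is determined by the tuple when ∏ d_e is squarefree, since
then d_{ij} = gcd(n_i, n_j) (`gcd_vertexProd`).

All positive labellings with vertex products at most x are counted, to leading order, by the volume
of the region u_e ≥ 1 cut out by the same inequalities (`hasDensity_labelCount`). In logarithmic
coordinates this volume has Laplace transform ∏ 1/z_i ∏_{i<j} 1/(z_i + z_j - 1). Inverting along z_i
= 1/2 + s_i/log x gives x^{m/2} (log x)^{m(m-1)/2 - m} times an integral which tends to 2^m γ(k),
each 1/z_i tending to 2 (`edgeVolume_exp_eq`, `tendsto_edgeVolume_complex`). Dominated convergence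
rests on the absolute integrability of ∏ 1/(s_i + s_j) for m ≥ 4 (`integrable_prod_edge_bracket`).

The arithmetic factor comes from a sieve by a finite set Q of primes. Forbidding p ∈ Q in all labels
multiplies the density by (1 - 1/p)^{m(m-1)/2}. For labels prime to Q the encoding fails to be a
bijection only through some p² dividing ∏ d_e with p ∉ Q, a relative loss O(∑_{p ∉ Q} 1/p²). Putting
the primes of Q back into the tuples multiplies the density by the sum of p^{-|S|/2} over the even
sets S of coordinates divisible by p. Letting Q exhaust the primes produces b(k)
(`tendsto_tupleCount`). Asymptotic equivalence also needs a nonzero constant; γ(k) > 0 follows from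
a dyadic lower bound for the number of labellings (`HasDensity.labelCount_pos`). -/

/-! ### Edge labellings of the complete graph. -/

/-- The edges of the complete graph on `Fin m`. -/
abbrev Edge (m : ℕ) := {e : Fin m × Fin m // e.1 < e.2}

/-- The two endpoints of an edge. -/
def Edge.verts {m : ℕ} (e : Edge m) : Finset (Fin m) := {e.1.1, e.1.2}

/-- The product of the edge labels `u` over the edges which contain the vertex `i`. -/
def vertexProd {m : ℕ} {R : Type*} [CommMonoid R] (u : Edge m → R) (i : Fin m) : R :=
  ∏ e with i ∈ Edge.verts e, u e

lemma Edge.mem_verts {m : ℕ} {e : Edge m} {i : Fin m} :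
    i ∈ Edge.verts e ↔ i = e.1.1 ∨ i = e.1.2 := by
  simp [Edge.verts]

lemma Edge.ne {m : ℕ} (e : Edge m) : e.1.1 ≠ e.1.2 := e.2.ne

lemma prod_vertex_prod_edge {m : ℕ} {R : Type*} [CommMonoid R] (f : Edge m → Fin m → R) :
    ∏ i, ∏ e with i ∈ Edge.verts e, f e i = ∏ e : Edge m, f e e.1.1 * f e e.1.2 := by
  simp_rw [Finset.prod_filter]
  rw [Finset.prod_comm]
  refine Finset.prod_congr rfl fun e _ => ?_
  rw [← Finset.prod_filter, ← Finset.prod_pair e.ne (f := f e)]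
  refine Finset.prod_congr ?_ fun _ _ => rfl
  ext i
  simp [Edge.verts]

lemma sum_vertex_sum_edge {m : ℕ} {R : Type*} [AddCommMonoid R] (f : Edge m → Fin m → R) :
    ∑ i, ∑ e with i ∈ Edge.verts e, f e i = ∑ e : Edge m, (f e e.1.1 + f e e.1.2) :=
  prod_vertex_prod_edge (R := Multiplicative R) f

lemma prod_edge_eq {m : ℕ} {R : Type*} [CommMonoid R] (f : Fin m → Fin m → R) :
    ∏ e : Edge m, f e.1.1 e.1.2 = ∏ i, ∏ j ∈ Finset.Ioi i, f i j := by
  rw [← Finset.prod_subtype (p := fun e : Fin m × Fin m => e.1 < e.2)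
    (Finset.univ.filter fun e : Fin m × Fin m => e.1 < e.2) (by simp)
    (fun e : Fin m × Fin m => f e.1 e.2), Finset.prod_filter, Fintype.prod_prod_type]
  refine Finset.prod_congr rfl fun i _ => ?_
  rw [← Finset.prod_filter]
  refine Finset.prod_congr ?_ fun _ _ => rfl
  ext j
  simp

lemma prod_edge_eq' {m : ℕ} {R : Type*} [CommMonoid R] (f : Fin m → Fin m → R) :
    ∏ e : Edge m, f e.1.1 e.1.2 = ∏ j, ∏ i ∈ Finset.Iio j, f i j := by
  rw [prod_edge_eq]
  exact Finset.prod_comm' (by simp)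

lemma card_edge (m : ℕ) : Fintype.card (Edge m) = m.choose 2 := by
  have h1 : Fintype.card (Edge m) = ∑ j : Fin m, (j : ℕ) := by
    rw [Fintype.card_subtype, Finset.card_filter, Fintype.sum_prod_type, Finset.sum_comm]
    refine Finset.sum_congr rfl fun j _ => ?_
    rw [← Finset.card_filter, show (Finset.univ.filter fun i : Fin m => i < j) = Finset.Iio j by
      ext; simp, Fin.card_Iio]
  rw [h1, Fin.sum_univ_eq_sum_range (fun i => i), Finset.sum_range_id, Nat.choose_two_right]

/-! ### Absolute convergence of the integral of ∏ 1/(s_i + s_j). -/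

/-- The Japanese bracket to the power `-1/2`. -/
noncomputable def bracket (t : ℝ) : ℝ := (1 + t ^ 2) ^ (-(1 / 4) : ℝ)

lemma bracket_pos (t : ℝ) : 0 < bracket t := Real.rpow_pos_of_pos (by positivity) _

lemma bracket_le_one (t : ℝ) : bracket t ≤ 1 :=
  Real.rpow_le_one_of_one_le_of_nonpos (by nlinarith [sq_nonneg t]) (by norm_num)

lemma integrable_bracket_pow_three : Integrable (fun t : ℝ => bracket t ^ 3) := by
  have h := integrable_rpow_neg_one_add_norm_sq (E := ℝ) (μ := volume) (r := 3 / 2)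
    (by norm_num)
  refine h.congr (Eventually.of_forall fun t => ?_)
  simp only [bracket, Real.norm_eq_abs, sq_abs]
  rw [← Real.rpow_mul_natCast (by positivity)]
  norm_num

lemma norm_inv_le_bracket {a : ℝ} (ha : 0 < a) {s : ℂ} (hs : a ≤ s.re) :
    ‖s⁻¹‖ ≤ (min 1 a)⁻¹ * bracket s.im ^ 2 := by
  have hm : 0 < min 1 a := lt_min one_pos ha
  have h1 : bracket s.im ^ 2 = (Real.sqrt (1 + s.im ^ 2))⁻¹ := by
    rw [bracket, ← Real.rpow_natCast, ← Real.rpow_mul (by positivity), Real.sqrt_eq_rpow,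
      ← Real.rpow_neg (by positivity)]
    norm_num
  rw [h1, norm_inv, ← mul_inv]
  have h2 : 0 < Real.sqrt (1 + s.im ^ 2) := Real.sqrt_pos.2 (by positivity)
  refine inv_anti₀ (by positivity) ?_
  rw [← abs_of_pos (mul_pos hm h2), ← abs_of_nonneg (norm_nonneg s), ← sq_le_sq, mul_pow,
    Real.sq_sqrt (by positivity), Complex.sq_norm, Complex.normSq_apply]
  have h3 : min 1 a ^ 2 ≤ 1 := by nlinarith [min_le_left 1 a]
  have h4 : min 1 a ^ 2 ≤ s.re ^ 2 := by nlinarith [min_le_right 1 a]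
  nlinarith [sq_nonneg s.im]

lemma Integrable.comp_injective_linearMap {m : ℕ} {f : (Fin m → ℝ) → ℝ} (hf : Integrable f)
    {T : (Fin m → ℝ) →ₗ[ℝ] (Fin m → ℝ)} (hT : Function.Injective T) :
    Integrable (fun t => f (T t)) := by
  have hdet : LinearMap.det T ≠ 0 := by
    exact (LinearEquiv.isUnit_det' (LinearEquiv.ofInjectiveEndo T hT)).ne_zero
  have hmap := Measure.map_linearMap_addHaar_eq_smul_addHaar (volume : Measure (Fin m → ℝ)) hdet
  have hTm : Measurable T := (LinearMap.continuous_of_finiteDimensional T).measurable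
  refine (integrable_map_measure (f := T) (g := f) (μ := volume) ?_ hTm.aemeasurable).1 ?_
  · rw [hmap]
    exact hf.aestronglyMeasurable.smul_measure _
  · rw [hmap]
    exact hf.smul_measure ENNReal.ofReal_ne_top

/-- The hypothesis makes t ↦ (t_j + t_{τ j})_j an invertible linear map, so the integral becomes a
product of one-dimensional integrals of (1 + t²)^{-3/4}. -/
lemma integrable_prod_bracket {m : ℕ} (τ : Fin m → Fin m)
    (h : ∀ t : Fin m → ℝ, (∀ j, t j + t (τ j) = 0) → t = 0) :
    Integrable (fun t : Fin m → ℝ => (∏ j, bracket (t j + t (τ j))) ^ 3) := by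
  let T : (Fin m → ℝ) →ₗ[ℝ] (Fin m → ℝ) :=
    LinearMap.pi fun j =>
      (LinearMap.proj j : (Fin m → ℝ) →ₗ[ℝ] ℝ) + LinearMap.proj (τ j)
  have hT : Function.Injective T := by
    rw [← LinearMap.ker_eq_bot, LinearMap.ker_eq_bot']
    exact fun t ht => h t fun j => by simpa [T] using congrFun ht j
  have := Integrable.comp_injective_linearMap
    (Integrable.fintype_prod (ι := Fin m) (f := fun _ (x : ℝ) => bracket x ^ 3)
      (μ := fun _ => volume) fun _ => integrable_bracket_pow_three) hT
  refine this.congr (Eventually.of_forall fun t => ?_)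
  simp [T, Finset.prod_pow]

lemma mul_mul_le_sum_pow_three {x y z : ℝ} (hx : 0 ≤ x) (hy : 0 ≤ y) (hz : 0 ≤ z) :
    x * y * z ≤ x ^ 3 + y ^ 3 + z ^ 3 := by
  have h : 0 ≤ x * y * z := by positivity
  nlinarith [mul_nonneg (add_nonneg (add_nonneg hx hy) hz)
    (add_nonneg (add_nonneg (sq_nonneg (x - y)) (sq_nonneg (y - z))) (sq_nonneg (x - z)))]

lemma Finset.prod_le_prod_of_subset_of_mem_Icc {α : Type*} [DecidableEq α] {s t : Finset α}
    {f : α → ℝ} (hst : t ⊆ s) (h0 : ∀ a, 0 ≤ f a) (h1 : ∀ a, f a ≤ 1) :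
    ∏ a ∈ s, f a ≤ ∏ a ∈ t, f a := by
  rw [← Finset.prod_sdiff hst]
  exact mul_le_of_le_one_left (Finset.prod_nonneg fun a _ => h0 a)
    (Finset.prod_le_one (fun a _ => h0 a) fun a _ => h1 a)

/-- Since b ≤ 1, factors may be dropped. All six edges among the vertices 0, 1, 2, 3 are kept with
their squares; each further vertex keeps its edges to 0, 1, 2, to the first power only. -/
lemma prod_edge_le_of_four {n : ℕ} {b : Fin (n + 4) → Fin (n + 4) → ℝ} (h0 : ∀ i j, 0 < b i j)
    (h1 : ∀ i j, b i j ≤ 1) :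
    ∏ e : Edge (n + 4), b e.1.1 e.1.2 ^ 2 ≤
      (b 0 1 * (b 0 2 * b 1 2) * (b 0 3 * b 1 3 * b 2 3)) ^ 2 *
        ∏ j : Fin n, (b 0 j.succ.succ.succ.succ * b 1 j.succ.succ.succ.succ *
          b 2 j.succ.succ.succ.succ) := by
  have h0' : ∀ i j, 0 ≤ b i j ^ 2 := fun i j => sq_nonneg _
  have h1' : ∀ i j, b i j ^ 2 ≤ 1 := fun i j => pow_le_one₀ (h0 i j).le (h1 i j)
  have h2' : ∀ i j, b i j ^ 2 ≤ b i j := fun i j => by nlinarith [h0 i j, h1 i j]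
  rw [prod_edge_eq' (fun i j => b i j ^ 2), Fin.prod_univ_succ, Fin.prod_univ_succ,
    Fin.prod_univ_succ, Fin.prod_univ_succ]
  have hs0 : ∏ i ∈ Finset.Iio (0 : Fin (n + 4)), b i 0 ^ 2 = 1 :=
    Finset.prod_eq_one fun i hi => absurd (Finset.mem_Iio.1 hi) (Fin.not_lt_zero i)
  have key : ∀ (j : Fin (n + 4)) (s : Finset (Fin (n + 4))), (∀ i ∈ s, i < j) →
      ∏ i ∈ Finset.Iio j, b i j ^ 2 ≤ ∏ i ∈ s, b i j ^ 2 := fun j s hs =>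
    Finset.prod_le_prod_of_subset_of_mem_Icc (fun i hi => Finset.mem_Iio.2 (hs i hi))
      (fun i => h0' i j) (fun i => h1' i j)
  have v1 : ((1 : Fin (n + 4)) : ℕ) = 1 := rfl
  have v2 : ((2 : Fin (n + 4)) : ℕ) = 2 := Nat.mod_eq_of_lt (show 2 < n + 4 by omega)
  have v3 : ((3 : Fin (n + 4)) : ℕ) = 3 := Nat.mod_eq_of_lt (show 3 < n + 4 by omega)
  have h01 : (0 : Fin (n + 4)) ≠ 1 := by simp
  have h02 : (0 : Fin (n + 4)) ≠ 2 := fun h => by have := congrArg Fin.val h; rw [v2] at this; simp at this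
  have h12 : (1 : Fin (n + 4)) ≠ 2 := fun h => by have := congrArg Fin.val h; rw [v2] at this; simp at this
  have k1 : ∏ i ∈ Finset.Iio (1 : Fin (n + 4)), b i 1 ^ 2 ≤ b 0 1 ^ 2 := by
    refine (key 1 {0} ?_).trans_eq (Finset.prod_singleton _ _)
    simp [Fin.lt_def]
  have k2 : ∏ i ∈ Finset.Iio (2 : Fin (n + 4)), b i 2 ^ 2 ≤ (b 0 2 * b 1 2) ^ 2 := by
    refine (key 2 {0, 1} ?_).trans_eq ?_
    · simp only [Finset.mem_insert, Finset.mem_singleton, Fin.lt_def]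
      rintro i (rfl | rfl) <;> rw [v2] <;> simp
    · rw [Finset.prod_pair h01, mul_pow]
  have k3 : ∀ j : Fin (n + 4), 2 < (j : ℕ) →
      ∏ i ∈ Finset.Iio j, b i j ^ 2 ≤ (b 0 j * b 1 j * b 2 j) ^ 2 := by
    intro j hj
    refine (key j {0, 1, 2} ?_).trans_eq ?_
    · simp only [Finset.mem_insert, Finset.mem_singleton, Fin.lt_def]
      rintro i (rfl | rfl | rfl)
      · rw [Fin.val_zero]; omega
      · rw [v1]; omega
      · rw [v2]; omega
    · rw [Finset.prod_insert (by simp [h01, h02]), Finset.prod_pair h12]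
      ring
  have k4 : ∀ j : Fin (n + 4), 2 < (j : ℕ) →
      ∏ i ∈ Finset.Iio j, b i j ^ 2 ≤ b 0 j * b 1 j * b 2 j := by
    intro j hj
    refine (k3 j hj).trans ?_
    rw [mul_pow, mul_pow]
    exact mul_le_mul (mul_le_mul (h2' _ _) (h2' _ _) (h0' _ _) (h0 _ _).le) (h2' _ _) (h0' _ _)
      (mul_nonneg (h0 _ _).le (h0 _ _).le)
  rw [hs0, one_mul]
  have e1 : Fin.succ (0 : Fin (n + 3)) = 1 := rfl
  have e2 : Fin.succ (Fin.succ (0 : Fin (n + 2))) = 2 := rfl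
  have e3 : Fin.succ (Fin.succ (Fin.succ (0 : Fin (n + 1)))) = 3 := rfl
  rw [e1, e2, e3]
  have hprod : ∏ j : Fin n, ∏ i ∈ Finset.Iio j.succ.succ.succ.succ, b i j.succ.succ.succ.succ ^ 2 ≤
      ∏ j : Fin n, (b 0 j.succ.succ.succ.succ * b 1 j.succ.succ.succ.succ *
          b 2 j.succ.succ.succ.succ) :=
    Finset.prod_le_prod (fun j _ => Finset.prod_nonneg fun i _ => h0' _ _)
      fun j _ => k4 _ (by simp)
  calc _ ≤ b 0 1 ^ 2 * ((b 0 2 * b 1 2) ^ 2 * ((b 0 3 * b 1 3 * b 2 3) ^ 2 * _)) :=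
        mul_le_mul k1 (mul_le_mul k2 (mul_le_mul (k3 3 (by omega)) hprod
          (Finset.prod_nonneg fun j _ => Finset.prod_nonneg fun i _ => h0' _ _) (sq_nonneg _))
          (mul_nonneg (Finset.prod_nonneg fun i _ => h0' _ _)
            (Finset.prod_nonneg fun j _ => Finset.prod_nonneg fun i _ => h0' _ _)) (sq_nonneg _))
          (mul_nonneg (Finset.prod_nonneg fun i _ => h0' _ _)
            (mul_nonneg (Finset.prod_nonneg fun i _ => h0' _ _)
            (Finset.prod_nonneg fun j _ => Finset.prod_nonneg fun i _ => h0' _ _))) (sq_nonneg _)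
    _ = _ := by ring

/-- Each edge carries the square of a bracket, and the bound from `prod_edge_le_of_four` splits into
three products ∏_j bracket(t_j + t_{τ j}). The inequality xyz ≤ x³ + y³ + z³ reduces the claim to
the integrability of their cubes. -/
lemma integrable_prod_edge_bracket {m : ℕ} (hm : 4 ≤ m) :
    Integrable (fun t : Fin m → ℝ => ∏ e : Edge m, bracket (t e.1.1 + t e.1.2) ^ 2) := by
  obtain ⟨n, rfl⟩ := Nat.exists_eq_add_of_le' hm
  -- Each τ has a single cycle, a triangle, to which every other vertex is eventually led. An odd
  -- cycle forces t = 0 from t_j + t_{τ j} = 0. Together the three maps use each edge of the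
  -- complete graph on {0, 1, 2, 3} exactly twice, and join every further vertex once to each of 0,
  -- 1, 2.
  let τ₁ : Fin (n + 4) → Fin (n + 4) := Fin.cons 3 (Fin.cons 2 (Fin.cons 3 (Fin.cons 1 fun _ => 0)))
  let τ₂ : Fin (n + 4) → Fin (n + 4) := Fin.cons 1 (Fin.cons 2 (Fin.cons 0 (Fin.cons 2 fun _ => 1)))
  let τ₃ : Fin (n + 4) → Fin (n + 4) := Fin.cons 1 (Fin.cons 3 (Fin.cons 0 (Fin.cons 0 fun _ => 2)))
  have e1 : Fin.succ (0 : Fin (n + 3)) = 1 := rfl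
  have e2 : Fin.succ (Fin.succ (0 : Fin (n + 2))) = 2 := rfl
  have e3 : Fin.succ (Fin.succ (Fin.succ (0 : Fin (n + 1)))) = 3 := rfl
  have expand : ∀ (P : Fin (n + 4) → Prop), (∀ j, P j) ↔ P 0 ∧ P 1 ∧ P 2 ∧ P 3 ∧
      ∀ j : Fin n, P j.succ.succ.succ.succ := by
    intro P
    rw [Fin.forall_fin_succ, Fin.forall_fin_succ, Fin.forall_fin_succ, Fin.forall_fin_succ,
      e1, e2, e3]
  have E : ∀ f : Fin (n + 4) → ℝ, ∏ j, f j =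
      f 0 * (f 1 * (f 2 * (f 3 * ∏ j : Fin n, f j.succ.succ.succ.succ))) := by
    intro f
    rw [Fin.prod_univ_succ, Fin.prod_univ_succ, Fin.prod_univ_succ, Fin.prod_univ_succ, e1, e2, e3]
  have a0 : τ₁ 0 = 3 ∧ τ₁ 1 = 2 ∧ τ₁ 2 = 3 ∧ τ₁ 3 = 1 ∧
      ∀ j : Fin n, τ₁ j.succ.succ.succ.succ = 0 := ⟨rfl, rfl, rfl, rfl, fun _ => rfl⟩
  have b0 : τ₂ 0 = 1 ∧ τ₂ 1 = 2 ∧ τ₂ 2 = 0 ∧ τ₂ 3 = 2 ∧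
      ∀ j : Fin n, τ₂ j.succ.succ.succ.succ = 1 := ⟨rfl, rfl, rfl, rfl, fun _ => rfl⟩
  have c0 : τ₃ 0 = 1 ∧ τ₃ 1 = 3 ∧ τ₃ 2 = 0 ∧ τ₃ 3 = 0 ∧
      ∀ j : Fin n, τ₃ j.succ.succ.succ.succ = 2 := ⟨rfl, rfl, rfl, rfl, fun _ => rfl⟩
  obtain ⟨a0, a1, a2, a3, a4⟩ := a0
  obtain ⟨b0, b1, b2, b3, b4⟩ := b0
  obtain ⟨c0, c1, c2, c3, c4⟩ := c0
  have i1 := integrable_prod_bracket τ₁ (by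
    intro t ht
    rw [expand] at ht
    simp only [a0, a1, a2, a3, a4] at ht
    obtain ⟨h0, h1, h2, h3, h4⟩ := ht
    have z1 : t 1 = 0 := by linarith
    have z0 : t 0 = 0 := by linarith
    refine funext ((expand _).2 ⟨z0, z1, ?_, ?_, fun j => ?_⟩)
    on_goal 3 => have := h4 j
    all_goals simp only [Pi.zero_apply]; linarith)
  have i2 := integrable_prod_bracket τ₂ (by
    intro t ht
    rw [expand] at ht
    simp only [b0, b1, b2, b3, b4] at ht
    obtain ⟨h0, h1, h2, h3, h4⟩ := ht
    have z1 : t 1 = 0 := by linarith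
    refine funext ((expand _).2 ⟨?_, z1, ?_, ?_, fun j => ?_⟩)
    on_goal 4 => have := h4 j
    all_goals simp only [Pi.zero_apply]; linarith)
  have i3 := integrable_prod_bracket τ₃ (by
    intro t ht
    rw [expand] at ht
    simp only [c0, c1, c2, c3, c4] at ht
    obtain ⟨h0, h1, h2, h3, h4⟩ := ht
    have z0 : t 0 = 0 := by linarith
    have z2 : t 2 = 0 := by linarith
    refine funext ((expand _).2 ⟨z0, ?_, z2, ?_, fun j => ?_⟩)
    on_goal 3 => have := h4 j
    all_goals simp only [Pi.zero_apply]; linarith)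
  refine ((i1.add i2).add i3).mono' ?_ (Eventually.of_forall fun t => ?_)
  · refine Measurable.aestronglyMeasurable ?_
    unfold bracket
    fun_prop
  · have hnn : ∀ τ : Fin (n + 4) → Fin (n + 4), 0 ≤ ∏ j, bracket (t j + t (τ j)) := fun τ =>
      Finset.prod_nonneg fun j _ => (bracket_pos _).le
    rw [Real.norm_of_nonneg (Finset.prod_nonneg fun e _ => sq_nonneg _)]
    refine (prod_edge_le_of_four (b := fun i j => bracket (t i + t j)) (fun _ _ => bracket_pos _)
      fun _ _ => bracket_le_one _).trans ?_
    refine le_trans (le_of_eq ?_) (mul_mul_le_sum_pow_three (hnn τ₁) (hnn τ₂) (hnn τ₃))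
    rw [E, E, E]
    simp only [a0, a1, a2, a3, a4, b0, b1, b2, b3, b4, c0, c1, c2, c3, c4, Finset.prod_mul_distrib]
    rw [add_comm (t 3) (t 1), add_comm (t 2) (t 0), add_comm (t 3) (t 2), add_comm (t 3) (t 0)]
    simp only [fun j : Fin n => add_comm (t j.succ.succ.succ.succ)]
    ring

/-! ### The region of real labellings and the continuity of its volume. -/

/-- The real edge labellings `u ≥ 1` whose vertex products are bounded by `Y`. -/
def edgeRegion {m : ℕ} (Y : Fin m → ℝ) : Set (Edge m → ℝ) :=
  {u | (∀ e, 1 ≤ u e) ∧ ∀ i, vertexProd u i ≤ Y i}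

/-- The volume of `edgeRegion Y`. -/
noncomputable def edgeVolume {m : ℕ} (Y : Fin m → ℝ) : ℝ := volume.real (edgeRegion Y)

lemma measurable_vertexProd {m : ℕ} (i : Fin m) :
    Measurable fun u : Edge m → ℝ => vertexProd u i := by
  unfold vertexProd
  fun_prop

lemma measurableSet_edgeRegion {m : ℕ} (Y : Fin m → ℝ) : MeasurableSet (edgeRegion Y) := by
  have : edgeRegion Y = (⋂ e : Edge m, {u | 1 ≤ u e}) ∩ ⋂ i, {u | vertexProd u i ≤ Y i} := by
    ext u
    simp [edgeRegion]
  rw [this]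
  exact (MeasurableSet.iInter fun e => measurableSet_le measurable_const
    (measurable_pi_apply e)).inter
    (MeasurableSet.iInter fun i => measurableSet_le (measurable_vertexProd i) measurable_const)

lemma Finset.one_le_prod_real {α : Type*} {s : Finset α} {f : α → ℝ} (h : ∀ a, 1 ≤ f a) :
    1 ≤ ∏ a ∈ s, f a := by
  simpa using Finset.prod_le_prod (s := s) (f := fun _ => (1 : ℝ)) (fun _ _ => zero_le_one)
    fun a _ => h a

lemma vertexProd_mul {m : ℕ} {R : Type*} [CommMonoid R] (u v : Edge m → R) (i : Fin m) :
    vertexProd (u * v) i = vertexProd u i * vertexProd v i :=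
  Finset.prod_mul_distrib

lemma one_le_vertexProd {m : ℕ} {u : Edge m → ℝ} (hu : ∀ e, 1 ≤ u e) (i : Fin m) :
    1 ≤ vertexProd u i :=
  Finset.one_le_prod_real fun e => hu e

lemma vertexProd_mono {m : ℕ} {u v : Edge m → ℝ} (hu : ∀ e, 0 ≤ u e) (h : ∀ e, u e ≤ v e)
    (i : Fin m) : vertexProd u i ≤ vertexProd v i :=
  Finset.prod_le_prod (fun e _ => hu e) fun e _ => h e

lemma le_vertexProd {m : ℕ} {u : Edge m → ℝ} (hu : ∀ e, 1 ≤ u e) {e : Edge m} {i : Fin m}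
    (hi : i ∈ e.verts) : u e ≤ vertexProd u i := by
  classical
  rw [vertexProd, ← Finset.mul_prod_erase _ u (show e ∈ Finset.univ.filter fun e : Edge m =>
    i ∈ e.verts by simpa using hi)]
  exact le_mul_of_one_le_right (zero_le_one.trans (hu e)) (Finset.one_le_prod_real fun e => hu e)

lemma edgeRegion_subset {m : ℕ} (Y : Fin m → ℝ) :
    edgeRegion Y ⊆ Set.univ.pi fun e : Edge m => Set.Icc 1 (Y e.1.1) :=
  fun _ hu e _ => ⟨hu.1 e, (le_vertexProd hu.1 (Edge.mem_verts.2 (Or.inl rfl))).trans (hu.2 _)⟩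

lemma volume_edgeRegion_lt_top {m : ℕ} (Y : Fin m → ℝ) : volume (edgeRegion Y) < ⊤ := by
  refine (measure_mono (edgeRegion_subset Y)).trans_lt ?_
  rw [volume_pi_pi]
  exact ENNReal.prod_lt_top fun e _ => by simp

lemma exists_edge {m : ℕ} (hm : 2 ≤ m) (i : Fin m) : ∃ e : Edge m, i ∈ e.verts := by
  by_cases h : (i : ℕ) = 0
  · exact ⟨⟨(i, ⟨1, hm⟩), by simp [Fin.lt_def, h]⟩, by simp [Edge.mem_verts]⟩
  · exact ⟨⟨(⟨0, by omega⟩, i), by simp [Fin.lt_def]; omega⟩, by simp [Edge.mem_verts]⟩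

lemma vertexProd_update {m : ℕ} (u : Edge m → ℝ) {e : Edge m} {i : Fin m} (hi : i ∈ e.verts)
    (t : ℝ) : vertexProd (Function.update u e t) i =
      t * ∏ e' ∈ (Finset.univ.filter fun e : Edge m => i ∈ e.verts).erase e, u e' := by
  rw [vertexProd, ← Finset.mul_prod_erase _ _ (show e ∈ Finset.univ.filter fun e : Edge m =>
    i ∈ e.verts by simpa using hi), Function.update_self]
  congr 1
  exact Finset.prod_congr rfl fun e' he' =>
    Function.update_of_ne (Finset.ne_of_mem_erase he') _ _

/-- Along the coordinate of an edge at i the vertex product is linear without constant term, so it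
takes a nonzero value at most once; Fubini then shows that the level set is null. -/
lemma ae_vertexProd_ne {m : ℕ} (hm : 2 ≤ m) (i : Fin m) {a : ℝ} (ha : a ≠ 0) :
    ∀ᵐ u : Edge m → ℝ, vertexProd u i ≠ a := by
  obtain ⟨e, he⟩ := exists_edge hm i
  have hms : MeasurableSet {u : Edge m → ℝ | vertexProd u i = a} :=
    measurable_vertexProd i (measurableSet_singleton a)
  have hf : Measurable (Set.indicator {u : Edge m → ℝ | vertexProd u i = a} (1 : (Edge m → ℝ) → ENNReal)) :=
    measurable_one.indicator hms
  rw [ae_iff]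
  simp only [ne_eq, not_not]
  rw [← lintegral_indicator_one hms, volume_pi, lintegral_eq_lmarginal_univ (fun _ => 0),
    lmarginal_erase' _ hf (Finset.mem_univ e)]
  have h0 : (fun x : Edge m → ℝ => ∫⁻ t, Set.indicator {u : Edge m → ℝ | vertexProd u i = a}
      (1 : (Edge m → ℝ) → ENNReal) (Function.update x e t)) = fun _ => 0 := by
    funext x
    set b := ∏ e' ∈ (Finset.univ.filter fun e : Edge m => i ∈ e.verts).erase e, x e' with hb
    refine le_antisymm ?_ zero_le
    have : ∀ t, Set.indicator {u : Edge m → ℝ | vertexProd u i = a}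
      (1 : (Edge m → ℝ) → ENNReal) (Function.update x e t) ≤ Set.indicator {a / b} 1 t := by
      intro t
      by_cases h : vertexProd (Function.update x e t) i = a
      · have ht : t = a / b := by
          rw [vertexProd_update x he, ← hb] at h
          exact eq_div_of_mul_eq (fun hb0 => ha (by rw [← h, hb0, mul_zero])) h
        rw [Set.indicator_of_mem (show t ∈ ({a / b} : Set ℝ) from ht)]
        exact Set.indicator_le_self' (fun _ _ => zero_le_one) _
      · rw [Set.indicator_of_notMem (show Function.update x e t ∉ _ from h)]
        exact zero_le
    refine (lintegral_mono this).trans_eq ?_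
    rw [lintegral_indicator_one (measurableSet_singleton _)]
    simp
  rw [h0]
  simp [lmarginal]

/-- Pointwise Fourier inversion requires continuity. Membership of u can change near y only if some
vertex product equals exp(y_i), which almost never happens, so dominated convergence applies. -/
lemma continuousAt_edgeVolume_exp {m : ℕ} (hm : 2 ≤ m) (y : Fin m → ℝ) :
    ContinuousAt (fun y : Fin m → ℝ => edgeVolume fun i => Real.exp (y i)) y := by
  have hint : ∀ Y : Fin m → ℝ, edgeVolume Y = ∫ u, (edgeRegion Y).indicator (1 : (Edge m → ℝ) → ℝ) u :=
    fun Y => (integral_indicator_one (measurableSet_edgeRegion Y)).symm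
  simp_rw [hint]
  refine continuousAt_of_dominated (bound := (edgeRegion fun i => Real.exp (y i + 1)).indicator 1)
    (Eventually.of_forall fun z => ?_) ?_ ?_ ?_
  · exact (measurable_one.indicator (measurableSet_edgeRegion _)).aestronglyMeasurable
  · have : ∀ᶠ z : Fin m → ℝ in nhds y, ∀ i, z i < y i + 1 :=
      eventually_all.2 fun i =>
        (continuous_apply i).continuousAt.eventually_lt continuousAt_const (by simp)
    filter_upwards [this] with z hz
    refine Eventually.of_forall fun u => ?_
    rw [Real.norm_of_nonneg (Set.indicator_nonneg (f := (1 : (Edge m → ℝ) → ℝ))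
      (fun _ _ => zero_le_one) _)]
    have hsub : (edgeRegion fun i => Real.exp (z i)) ⊆
        (edgeRegion fun i => Real.exp (y i + 1) : Set (Edge m → ℝ)) :=
      fun u hu => ⟨hu.1, fun i => (hu.2 i).trans (Real.exp_le_exp.2 (hz i).le)⟩
    exact Set.indicator_le_indicator_of_subset hsub (fun _ => zero_le_one) u
  · exact (integrable_indicator_iff (measurableSet_edgeRegion _)).2
      (integrableOn_const (volume_edgeRegion_lt_top _).ne)
  · have : ∀ᵐ u : Edge m → ℝ, ∀ i, vertexProd u i ≠ Real.exp (y i) :=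
      ae_all_iff.2 fun i => ae_vertexProd_ne hm i (Real.exp_ne_zero _)
    filter_upwards [this] with u hu
    have hev : ∀ᶠ z : Fin m → ℝ in nhds y, ∀ i,
        (vertexProd u i ≤ Real.exp (z i) ↔ vertexProd u i ≤ Real.exp (y i)) := by
      refine eventually_all.2 fun i => ?_
      have hc : ContinuousAt (fun z : Fin m → ℝ => Real.exp (z i)) y :=
        (Real.continuous_exp.comp (continuous_apply i)).continuousAt
      rcases lt_or_gt_of_ne (hu i) with h | h
      · filter_upwards [continuousAt_const.eventually_lt hc h] with z hz
        exact ⟨fun _ => h.le, fun _ => hz.le⟩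
      · filter_upwards [hc.eventually_lt continuousAt_const h] with z hz
        exact ⟨fun h' => absurd h' hz.not_ge, fun h' => absurd h' h.not_ge⟩
    refine (continuousAt_const (y := (edgeRegion fun i => Real.exp (y i)).indicator
      (1 : (Edge m → ℝ) → ℝ) u)).congr ?_
    filter_upwards [hev] with z hz
    refine Set.indicator_eq_indicator ?_ rfl
    simp only [edgeRegion, Set.mem_ofPred_eq, hz]

/-! ### The Laplace transform of the volume in logarithmic coordinates. -/

lemma integrable_indicator_exp {z : ℂ} (hz : 0 < z.re) (a : ℝ) :
    Integrable ((Set.Ici a).indicator fun s : ℝ => Complex.exp (-z * s)) := by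
  rw [integrable_indicator_iff measurableSet_Ici, integrableOn_Ici_iff_integrableOn_Ioi]
  exact integrableOn_exp_mul_complex_Ioi (by simpa) a

lemma integral_indicator_exp {z : ℂ} (hz : 0 < z.re) (a : ℝ) :
    ∫ s, (Set.Ici a).indicator (fun s : ℝ => Complex.exp (-z * s)) s =
      z⁻¹ * Complex.exp (-z * a) := by
  rw [integral_indicator measurableSet_Ici, integral_Ici_eq_integral_Ioi,
    integral_exp_mul_complex_Ioi (by simpa)]
  rw [neg_div_neg_eq, div_eq_inv_mul]

lemma integrable_indicator_cpow {z : ℂ} (hz : 1 < z.re) :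
    Integrable ((Set.Ici (1 : ℝ)).indicator fun s : ℝ => (s : ℂ) ^ (-z)) := by
  rw [integrable_indicator_iff measurableSet_Ici, integrableOn_Ici_iff_integrableOn_Ioi]
  exact integrableOn_Ioi_cpow_of_lt (by simpa) one_pos

lemma integral_indicator_cpow {z : ℂ} (hz : 1 < z.re) :
    ∫ s, (Set.Ici (1 : ℝ)).indicator (fun s : ℝ => (s : ℂ) ^ (-z)) s = (z - 1)⁻¹ := by
  rw [integral_indicator measurableSet_Ici, integral_Ici_eq_integral_Ioi,
    integral_Ioi_cpow_of_lt (by simpa) one_pos, Complex.ofReal_one, Complex.one_cpow,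
    ← one_div, ← neg_div_neg_eq, neg_neg]
  congr 1
  ring

/-- The integrand of the Fourier-Laplace transform of the volume of `edgeRegion`. -/
noncomputable def regionKernel {m : ℕ} (z : Fin m → ℂ) (u : Edge m → ℝ) (y : Fin m → ℝ) : ℂ :=
  (edgeRegion fun i => Real.exp (y i)).indicator (fun _ => Complex.exp (-∑ i, z i * y i)) u

lemma regionKernel_eq {m : ℕ} (z : Fin m → ℂ) {u : Edge m → ℝ} (hu : ∀ e, 1 ≤ u e)
    (y : Fin m → ℝ) : regionKernel z u y = ∏ i, (Set.Ici (Real.log (vertexProd u i))).indicator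
      (fun s : ℝ => Complex.exp (-z i * s)) (y i) := by
  by_cases h : ∀ i, Real.log (vertexProd u i) ≤ y i
  · have hmem : u ∈ edgeRegion fun i => Real.exp (y i) := ⟨hu, fun i =>
      (Real.log_le_iff_le_exp (zero_lt_one.trans_le (one_le_vertexProd hu i))).1 (h i)⟩
    rw [regionKernel, Set.indicator_of_mem hmem, ← Finset.sum_neg_distrib, Complex.exp_sum]
    refine Finset.prod_congr rfl fun i _ => ?_
    rw [Set.indicator_of_mem (show y i ∈ Set.Ici _ from h i), neg_mul]
  · have hmem : u ∉ edgeRegion fun i => Real.exp (y i) := fun hm => h fun i =>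
      (Real.log_le_iff_le_exp (zero_lt_one.trans_le (one_le_vertexProd hu i))).2 (hm.2 i)
    push Not at h
    obtain ⟨i, hi⟩ := h
    rw [regionKernel, Set.indicator_of_notMem hmem, eq_comm]
    exact Finset.prod_eq_zero (Finset.mem_univ i)
      (Set.indicator_of_notMem (show y i ∉ Set.Ici _ from hi.not_ge) _)

lemma regionKernel_eq_zero {m : ℕ} (z : Fin m → ℂ) {u : Edge m → ℝ} (hu : ¬ ∀ e, 1 ≤ u e)
    (y : Fin m → ℝ) : regionKernel z u y = 0 :=
  Set.indicator_of_notMem (fun h => hu h.1) _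

lemma integrable_regionKernel_right {m : ℕ} {z : Fin m → ℂ} (hz : ∀ i, 0 < (z i).re)
    (u : Edge m → ℝ) : Integrable (regionKernel z u) := by
  by_cases hu : ∀ e, 1 ≤ u e
  · rw [show regionKernel z u = _ from funext fun y => regionKernel_eq z hu y]
    exact Integrable.fintype_prod (μ := fun _ => volume) fun i => integrable_indicator_exp (hz i) _
  · rw [show regionKernel z u = fun _ => 0 from funext fun y => regionKernel_eq_zero z hu y]
    exact integrable_zero _ _ _

/-- For fixed u the constraints on y decouple into y_i ≥ log of the vertex product at i. Each
one-dimensional integral gives 1/z_i times that product to the power -z_i, and regrouping by edges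
leaves u_e^{-(z_i + z_j)}. -/
lemma integral_regionKernel_right {m : ℕ} {z : Fin m → ℂ} (hz : ∀ i, 0 < (z i).re)
    (u : Edge m → ℝ) : ∫ y, regionKernel z u y = (∏ i, (z i)⁻¹) *
      ∏ e : Edge m, (Set.Ici (1 : ℝ)).indicator
        (fun s : ℝ => (s : ℂ) ^ (-(z e.1.1 + z e.1.2))) (u e) := by
  by_cases hu : ∀ e, 1 ≤ u e
  · simp_rw [regionKernel_eq z hu]
    rw [integral_fintype_prod_volume_eq_prod (fun i => (Set.Ici (Real.log (vertexProd u i))).indicator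
      (fun s : ℝ => Complex.exp (-z i * s)))]
    simp_rw [fun i => integral_indicator_exp (hz i)]
    rw [Finset.prod_mul_distrib, ← Complex.exp_sum]
    congr 1
    have h0 : ∀ e, u e ≠ 0 := fun e => (zero_lt_one.trans_le (hu e)).ne'
    have h1 : ∀ i, -z i * (Real.log (vertexProd u i) : ℂ) =
        ∑ e with i ∈ Edge.verts e, -z i * (Real.log (u e) : ℂ) := by
      intro i
      rw [vertexProd, Real.log_prod fun e _ => h0 e, Complex.ofReal_sum, Finset.mul_sum]
    simp_rw [h1]
    rw [sum_vertex_sum_edge (fun e i => -z i * (Real.log (u e) : ℂ)), Complex.exp_sum]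
    refine Finset.prod_congr rfl fun e _ => ?_
    rw [Set.indicator_of_mem (show u e ∈ Set.Ici 1 from hu e),
      Complex.cpow_def_of_ne_zero (by exact_mod_cast h0 e),
      Complex.ofReal_log (zero_le_one.trans (hu e))]
    congr 1
    ring
  · simp_rw [regionKernel_eq_zero z hu, integral_zero]
    push Not at hu
    obtain ⟨e, he⟩ := hu
    rw [eq_comm, Finset.prod_eq_zero (Finset.mem_univ e)
      (Set.indicator_of_notMem (show u e ∉ Set.Ici 1 from he.not_ge) _), mul_zero]

lemma measurableSet_region_prod {m : ℕ} :
    MeasurableSet {q : (Edge m → ℝ) × (Fin m → ℝ) | q.1 ∈ edgeRegion fun i => Real.exp (q.2 i)} := by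
  have : {q : (Edge m → ℝ) × (Fin m → ℝ) | q.1 ∈ edgeRegion fun i => Real.exp (q.2 i)} =
      (⋂ e : Edge m, {q | 1 ≤ q.1 e}) ∩ ⋂ i, {q | vertexProd q.1 i ≤ Real.exp (q.2 i)} := by
    ext u
    simp [edgeRegion]
  rw [this]
  refine (MeasurableSet.iInter fun e => measurableSet_le measurable_const (by fun_prop)).inter
    (MeasurableSet.iInter fun i => measurableSet_le
      ((measurable_vertexProd i).comp measurable_fst) (by fun_prop))

lemma measurable_regionKernel {m : ℕ} (z : Fin m → ℂ) :
    Measurable (Function.uncurry (regionKernel z)) := by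
  have : Function.uncurry (regionKernel z) =
      {q : (Edge m → ℝ) × (Fin m → ℝ) | q.1 ∈ edgeRegion fun i => Real.exp (q.2 i)}.indicator
        fun q => Complex.exp (-∑ i, z i * q.2 i) := by
    funext q
    rfl
  rw [this]
  refine Measurable.indicator ?_ measurableSet_region_prod
  fun_prop

lemma norm_regionKernel {m : ℕ} (z : Fin m → ℂ) (u : Edge m → ℝ) (y : Fin m → ℝ) :
    (‖regionKernel z u y‖ : ℂ) = regionKernel (fun i => ((z i).re : ℂ)) u y := by
  rw [regionKernel, regionKernel]
  by_cases h : u ∈ edgeRegion fun i => Real.exp (y i)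
  · rw [Set.indicator_of_mem h, Set.indicator_of_mem h, Complex.norm_exp, Complex.ofReal_exp]
    congr 1
    simp
  · rw [Set.indicator_of_notMem h, Set.indicator_of_notMem h]
    simp

/-- Taking norms replaces z by its real part, so Tonelli reduces to the exact inner integral; Re z_i
> 1/2 makes every edge exponent exceed 1. -/
lemma integrable_regionKernel {m : ℕ} {z : Fin m → ℂ} (hz : ∀ i, 1 / 2 < (z i).re) :
    Integrable (Function.uncurry (regionKernel z)) := by
  have hz0 : ∀ i, 0 < (z i).re := fun i => by linarith [hz i]
  refine (integrable_prod_iff (measurable_regionKernel z).aestronglyMeasurable).2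
    ⟨Eventually.of_forall fun u => integrable_regionKernel_right hz0 u, ?_⟩
  have h1 : ∀ u : Edge m → ℝ, ∫ y, ‖regionKernel z u y‖ =
      (∫ y, regionKernel (fun i => ((z i).re : ℂ)) u y).re := by
    intro u
    simp_rw [← norm_regionKernel]
    rw [integral_complex_ofReal, Complex.ofReal_re]
  simp only [Function.uncurry_apply_pair, h1]
  simp_rw [fun u : Edge m → ℝ => integral_regionKernel_right
    (z := fun i => ((z i).re : ℂ)) (fun i => by simpa using hz0 i) u]
  refine Integrable.re (𝕜 := ℂ) (Integrable.const_mul ?_ _)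
  refine Integrable.fintype_prod (μ := fun _ => volume) fun e => integrable_indicator_cpow ?_
  simp only [Complex.add_re, Complex.ofReal_re]
  linarith [hz e.1.1, hz e.1.2]

lemma integral_regionKernel_left {m : ℕ} (z : Fin m → ℂ) (y : Fin m → ℝ) :
    ∫ u, regionKernel z u y =
      (edgeVolume fun i => Real.exp (y i) : ℂ) * Complex.exp (-∑ i, z i * y i) := by
  simp_rw [regionKernel]
  rw [integral_indicator_const _ (measurableSet_edgeRegion _), Complex.real_smul]
  rfl

lemma integrable_edgeVolume_mul_exp {m : ℕ} {z : Fin m → ℂ} (hz : ∀ i, 1 / 2 < (z i).re) :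
    Integrable fun y : Fin m → ℝ =>
      (edgeVolume fun i => Real.exp (y i) : ℂ) * Complex.exp (-∑ i, z i * y i) := by
  have := (integrable_regionKernel hz).integral_prod_right
  simpa only [Function.uncurry_apply_pair, integral_regionKernel_left] using this

lemma integral_edgeVolume_mul_exp {m : ℕ} {z : Fin m → ℂ} (hz : ∀ i, 1 / 2 < (z i).re) :
    ∫ y : Fin m → ℝ, (edgeVolume fun i => Real.exp (y i) : ℂ) * Complex.exp (-∑ i, z i * y i) =
      (∏ i, (z i)⁻¹) * ∏ e : Edge m, (z e.1.1 + z e.1.2 - 1)⁻¹ := by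
  have hz0 : ∀ i, 0 < (z i).re := fun i => by linarith [hz i]
  simp_rw [← integral_regionKernel_left]
  rw [← integral_integral_swap (integrable_regionKernel hz)]
  simp_rw [integral_regionKernel_right hz0]
  rw [integral_const_mul, integral_fintype_prod_volume_eq_prod (fun e : Edge m =>
    (Set.Ici (1 : ℝ)).indicator (fun s : ℝ => (s : ℂ) ^ (-(z e.1.1 + z e.1.2))))]
  congr 1
  refine Finset.prod_congr rfl fun e _ => integral_indicator_cpow ?_
  simp only [Complex.add_re]
  linarith [hz e.1.1, hz e.1.2]

/-! ### Fourier inversion for the volume. -/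

/-- The product of `1 / (s_i + s_j)` over the edges, on the vertical lines `Re s_j = c_j`. -/
noncomputable def edgeKernel {m : ℕ} (c t : Fin m → ℝ) : ℂ :=
  ∏ e : Edge m, (linePoint c t e.1.1 + linePoint c t e.1.2)⁻¹

lemma continuous_linePoint {m : ℕ} (c : Fin m → ℝ) (j : Fin m) :
    Continuous fun t => linePoint c t j := by
  unfold linePoint
  fun_prop

lemma measurable_edgeKernel {m : ℕ} (c : Fin m → ℝ) : Measurable (edgeKernel c) := by
  have := fun j => (continuous_linePoint c j).measurable
  unfold edgeKernel
  fun_prop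

lemma linePoint_re {m : ℕ} (c t : Fin m → ℝ) (j : Fin m) : (linePoint c t j).re = c j := by
  simp [linePoint]

lemma linePoint_im {m : ℕ} (c t : Fin m → ℝ) (j : Fin m) : (linePoint c t j).im = t j := by
  simp [linePoint]

lemma integrable_edgeKernel {m : ℕ} (hm : 4 ≤ m) {c : Fin m → ℝ} (hc : ∀ j, 0 < c j) :
    Integrable (edgeKernel c) := by
  refine ((integrable_prod_edge_bracket hm).const_mul
    (∏ e : Edge m, (min 1 (c e.1.1 + c e.1.2))⁻¹)).mono'
    (measurable_edgeKernel c).aestronglyMeasurable (Eventually.of_forall fun t => ?_)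
  rw [edgeKernel, norm_prod, ← Finset.prod_mul_distrib]
  refine Finset.prod_le_prod (fun e _ => norm_nonneg _) fun e _ => ?_
  have := norm_inv_le_bracket (add_pos (hc e.1.1) (hc e.1.2))
    (s := linePoint c t e.1.1 + linePoint c t e.1.2) (by simp [linePoint_re])
  simpa [linePoint_im] using this

/-- The integrand of the inversion formula for the volume of `edgeRegion`. -/
noncomputable def inversionKernel {m : ℕ} (c : Fin m → ℝ) (L : ℝ) (y t : Fin m → ℝ) : ℂ :=
  edgeKernel c t * (∏ i, (linePoint c t i / L + 1 / 2)⁻¹) *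
    Complex.exp (∑ i, (linePoint c t i / L + 1 / 2) * y i)

lemma norm_inv_linePoint_le {m : ℕ} {c : Fin m → ℝ} (hc : ∀ j, 0 < c j) {L : ℝ} (hL : 0 < L)
    (t : Fin m → ℝ) (i : Fin m) : ‖(linePoint c t i / L + 1 / 2)⁻¹‖ ≤ 2 := by
  rw [norm_inv]
  refine inv_le_of_inv_le₀ two_pos ?_
  refine le_trans ?_ (Complex.re_le_norm _)
  have : (linePoint c t i / L + 1 / 2).re = c i / L + 1 / 2 := by
    simp [Complex.div_ofReal_re, linePoint_re]
  rw [this]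
  have := div_pos (hc i) hL
  linarith

lemma norm_inversionKernel_le {m : ℕ} {c : Fin m → ℝ} (hc : ∀ j, 0 < c j) {L : ℝ} (hL : 0 < L)
    (y t : Fin m → ℝ) : ‖inversionKernel c L y t‖ ≤
      ‖edgeKernel c t‖ * 2 ^ m * Real.exp (∑ i, (c i / L + 1 / 2) * y i) := by
  rw [inversionKernel, norm_mul, norm_mul, Complex.norm_exp]
  have h1 : (∑ i, (linePoint c t i / L + 1 / 2) * (y i : ℂ)).re =
      ∑ i, (c i / L + 1 / 2) * y i := by
    simp [Complex.div_ofReal_re, linePoint_re]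
  rw [h1]
  gcongr
  rw [norm_prod]
  refine (Finset.prod_le_prod (fun i _ => norm_nonneg _)
    fun i _ => norm_inv_linePoint_le hc hL t i).trans_eq ?_
  simp

lemma measurable_inversionKernel {m : ℕ} (c : Fin m → ℝ) (L : ℝ) (y : Fin m → ℝ) :
    Measurable (inversionKernel c L y) := by
  have := fun j => (continuous_linePoint c j).measurable
  have := measurable_edgeKernel c
  unfold inversionKernel
  fun_prop

lemma integrable_inversionKernel {m : ℕ} (hm : 4 ≤ m) {c : Fin m → ℝ} (hc : ∀ j, 0 < c j)
    {L : ℝ} (hL : 0 < L) (y : Fin m → ℝ) : Integrable (inversionKernel c L y) := by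
  refine Integrable.mono' (((integrable_edgeKernel hm hc).norm.mul_const (2 ^ m)).mul_const
    (Real.exp (∑ i, (c i / L + 1 / 2) * y i))) (measurable_inversionKernel c L y).aestronglyMeasurable
    (Eventually.of_forall fun t => norm_inversionKernel_le hc hL y t)

lemma integral_euclideanSpace {m : ℕ} (f : (Fin m → ℝ) → ℂ) :
    ∫ v : EuclideanSpace ℝ (Fin m), f (fun i => v i) = ∫ v : Fin m → ℝ, f v :=
  (PiLp.volume_preserving_ofLp (Fin m)).integral_comp
    (MeasurableEquiv.toLp 2 (Fin m → ℝ)).symm.measurableEmbedding f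

lemma integrable_euclideanSpace {m : ℕ} {f : (Fin m → ℝ) → ℂ} (hf : Integrable f) :
    Integrable fun v : EuclideanSpace ℝ (Fin m) => f (fun i => v i) :=
  (PiLp.volume_preserving_ofLp (Fin m)).integrable_comp_of_integrable hf

/-- Fourier inversion in coordinates. -/
lemma fourier_inversion_pi {m : ℕ} {f g : (Fin m → ℝ) → ℂ} (hf : Integrable f)
    (hg : Integrable g)
    (hfg : ∀ w, ∫ v : Fin m → ℝ, Complex.exp (-(2 * Real.pi * Complex.I) * ∑ i, (w i : ℂ) * v i) *
      f v = g w) {y : Fin m → ℝ} (hy : ContinuousAt f y) :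
    f y = ∫ w : Fin m → ℝ, Complex.exp ((2 * Real.pi * Complex.I) * ∑ i, (w i : ℂ) * y i) * g w := by
  open FourierTransform in
  let F : EuclideanSpace ℝ (Fin m) → ℂ := fun v => f fun i => v i
  have hin : ∀ v w : EuclideanSpace ℝ (Fin m), (inner ℝ v w : ℝ) = ∑ i, w i * v i := fun v w => by
    simp [PiLp.inner_apply]
  have hF : 𝓕 F = fun w : EuclideanSpace ℝ (Fin m) => g fun i => w i := by
    funext w
    rw [Real.fourier_eq', ← hfg, ← integral_euclideanSpace]
    refine integral_congr_ae (Eventually.of_forall fun v => ?_)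
    simp only [smul_eq_mul, F, hin]
    congr 2
    push_cast
    ring
  have hc : ContinuousAt F (WithLp.toLp 2 y) :=
    ContinuousAt.comp (g := f) (f := fun v : EuclideanSpace ℝ (Fin m) => fun i => v i) hy
      (by fun_prop)
  have h := (integrable_euclideanSpace hf).fourierInv_fourier_eq
    (by rw [show 𝓕 _ = _ from hF]; exact integrable_euclideanSpace hg) hc
  rw [show 𝓕 _ = _ from hF, Real.fourierInv_eq'] at h
  change _ = f y at h
  rw [← h, ← integral_euclideanSpace]
  refine integral_congr_ae (Eventually.of_forall fun v => ?_)
  simp only [smul_eq_mul, hin]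
  congr 2
  push_cast
  simp only [mul_comm]
  ring

/-- The transform is evaluated at z_i = s_i/L + 1/2. The free scale L will be log x, which makes the
integrand converge as x grows. -/
lemma edgeVolume_exp_eq {m : ℕ} (hm : 4 ≤ m) {c : Fin m → ℝ} (hc : ∀ j, 0 < c j) {L : ℝ}
    (hL : 0 < L) (y : Fin m → ℝ) :
    (edgeVolume fun i => Real.exp (y i) : ℂ) =
      (L : ℂ) ^ (Fintype.card (Edge m)) / (2 * Real.pi * L) ^ m *
        ∫ t, inversionKernel c L y t := by
  have hL' : (L : ℂ) ≠ 0 := by exact_mod_cast hL.ne'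
  have hR : 0 < 2 * Real.pi * L := by positivity
  -- With t = Rw the imaginary part of z_i is 2πw_i, the phase in Fourier's normalisation; the
  -- substitution produces the factor (2πL)^{-m}.
  set R := 2 * Real.pi * L with hRdef
  have hz : ∀ (w : Fin m → ℝ) i, 1 / 2 < (linePoint c (R • w) i / L + 1 / 2).re := fun w i => by
    have : (linePoint c (R • w) i / L + 1 / 2).re = c i / L + 1 / 2 := by
      simp [Complex.div_ofReal_re, linePoint_re]
    rw [this]
    have := div_pos (hc i) hL
    linarith
  have hzw : ∀ (w : Fin m → ℝ) i, linePoint c (R • w) i / L + 1 / 2 =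
      (c i / L + 1 / 2 : ℝ) + 2 * Real.pi * Complex.I * w i := fun w i => by
    simp only [linePoint, Pi.smul_apply, smul_eq_mul, hRdef]
    push_cast
    field_simp
    ring
  let f : (Fin m → ℝ) → ℂ := fun y => (edgeVolume fun i => Real.exp (y i) : ℂ) *
    Complex.exp (-∑ i, ((c i / L + 1 / 2 : ℝ) : ℂ) * y i)
  let g : (Fin m → ℝ) → ℂ := fun w => (L : ℂ) ^ Fintype.card (Edge m) * inversionKernel c L 0 (R • w)
  have hf : Integrable f := integrable_edgeVolume_mul_exp fun i => by
    have := div_pos (hc i) hL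
    rw [Complex.ofReal_re]
    linarith
  have hg : Integrable g :=
    ((integrable_inversionKernel hm hc hL 0).comp_smul hR.ne').const_mul _
  have hfg : ∀ w, ∫ v : Fin m → ℝ, Complex.exp (-(2 * Real.pi * Complex.I) *
      ∑ i, (w i : ℂ) * v i) * f v = g w := by
    intro w
    have h1 := integral_edgeVolume_mul_exp (z := fun i => linePoint c (R • w) i / L + 1 / 2) (hz w)
    have h2 : g w = (∏ i, (linePoint c (R • w) i / L + 1 / 2)⁻¹) * ∏ e : Edge m,
        (linePoint c (R • w) e.1.1 / L + 1 / 2 + (linePoint c (R • w) e.1.2 / L + 1 / 2) - 1)⁻¹ := by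
      simp only [g, inversionKernel, edgeKernel]
      -- The shifts by 1/2 cancel the -1, leaving (s_i + s_j)/L; hence one factor L per edge.
      have : ∀ e : Edge m, (linePoint c (R • w) e.1.1 / L + 1 / 2 +
          (linePoint c (R • w) e.1.2 / L + 1 / 2) - 1)⁻¹ =
          L * (linePoint c (R • w) e.1.1 + linePoint c (R • w) e.1.2)⁻¹ := by
        intro e
        rw [← inv_inv (L : ℂ), ← mul_inv, inv_inv]
        congr 1
        field_simp
        ring
      simp_rw [this]
      rw [Finset.prod_mul_distrib, Finset.prod_const, Finset.card_univ]
      simp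
      ring
    rw [h2, ← h1]
    refine integral_congr_ae (Eventually.of_forall fun v => ?_)
    simp only [f, hzw]
    rw [mul_left_comm, ← Complex.exp_add]
    congr 2
    rw [← Finset.sum_neg_distrib, ← Finset.sum_neg_distrib, Finset.mul_sum,
      ← Finset.sum_add_distrib]
    exact Finset.sum_congr rfl fun i _ => by ring
  have hcont : ContinuousAt f y := by
    refine ContinuousAt.mul ?_ (Continuous.continuousAt (by fun_prop))
    exact Complex.continuous_ofReal.continuousAt.comp (continuousAt_edgeVolume_exp (by omega) y)
  have h := fourier_inversion_pi hf hg hfg hcont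
  have h3 : (edgeVolume fun i => Real.exp (y i) : ℂ) =
      f y * Complex.exp (∑ i, ((c i / L + 1 / 2 : ℝ) : ℂ) * y i) := by
    simp only [f]
    rw [mul_assoc, ← Complex.exp_add]
    simp
  rw [h3, h, ← integral_mul_const]
  have h4 : ∀ w : Fin m → ℝ, Complex.exp (2 * Real.pi * Complex.I * ∑ i, (w i : ℂ) * y i) * g w *
      Complex.exp (∑ i, ((c i / L + 1 / 2 : ℝ) : ℂ) * y i) =
      (L : ℂ) ^ Fintype.card (Edge m) * inversionKernel c L y (R • w) := by
    intro w
    have : inversionKernel c L y (R • w) = inversionKernel c L 0 (R • w) *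
        (Complex.exp (2 * Real.pi * Complex.I * ∑ i, (w i : ℂ) * y i) *
        Complex.exp (∑ i, ((c i / L + 1 / 2 : ℝ) : ℂ) * y i)) := by
      simp only [inversionKernel]
      rw [← Complex.exp_add]
      simp only [Pi.zero_apply, Complex.ofReal_zero, mul_zero, Finset.sum_const_zero,
        Complex.exp_zero, mul_one]
      congr 2
      rw [Finset.mul_sum, ← Finset.sum_add_distrib]
      refine Finset.sum_congr rfl fun i _ => ?_
      rw [hzw]
      ring
    rw [this]
    simp only [g]
    ring
  simp_rw [h4]
  rw [integral_const_mul, Measure.integral_comp_smul volume (inversionKernel c L y) R]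
  simp only [Module.finrank_fintype_fun_eq_card, Fintype.card_fin]
  rw [abs_of_pos (by positivity), Complex.real_smul]
  simp only [hRdef]
  push_cast
  ring

/-! ### Asymptotics and a uniform bound for the volume. -/

/-- The normalisation `x^{m/2} (log x)^{m(m-1)/2 - m}`. -/
noncomputable def mainTerm (m : ℕ) (x : ℝ) : ℝ :=
  Real.sqrt x ^ m * Real.log x ^ (Fintype.card (Edge m) - m)

lemma mainTerm_pos (m : ℕ) {x : ℝ} (hx : 1 < x) : 0 < mainTerm m x :=
  mul_pos (pow_pos (Real.sqrt_pos.2 (by linarith)) _) (pow_pos (Real.log_pos hx) _)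

/-- `G (x X) ~ C ∏ √X_i * mainTerm m x` as `x → ∞`, for every `X` with positive coordinates. -/
def HasDensity {m : ℕ} (G : (Fin m → ℝ) → ℝ) (C : ℝ) : Prop :=
  ∀ X : Fin m → ℝ, (∀ i, 0 < X i) →
    Tendsto (fun x : ℝ => G (x • X) / mainTerm m x) atTop (nhds (C * ∏ i, Real.sqrt (X i)))

lemma le_card_edge {m : ℕ} (hm : 4 ≤ m) : m ≤ Fintype.card (Edge m) := by
  rw [card_edge, Nat.choose_two_right, Nat.le_div_iff_mul_le two_pos]
  exact Nat.mul_le_mul le_rfl (by omega)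

/-- The value `(2π)^{-m} ∫ ∏ 1/(s_i+s_j) ∏ e^{s_j} dt` with `s_j = c_j + i t_j`. -/
noncomputable def edgeConst {m : ℕ} (c : Fin m → ℝ) : ℂ :=
  1 / (2 * Real.pi : ℂ) ^ m * ∫ t, edgeKernel c t * Complex.exp (∑ i, linePoint c t i)

lemma pow_card_edge_div {m : ℕ} (hm : 4 ≤ m) {L : ℝ} (hL : 0 < L) :
    (L : ℂ) ^ Fintype.card (Edge m) / (2 * Real.pi * L) ^ m =
      1 / (2 * Real.pi : ℂ) ^ m * (L : ℂ) ^ (Fintype.card (Edge m) - m) := by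
  have hL' : (L : ℂ) ≠ 0 := by exact_mod_cast hL.ne'
  rw [← Nat.sub_add_cancel (le_card_edge hm), pow_add, mul_pow _ (L : ℂ), Nat.add_sub_cancel]
  field_simp

/-- With L = log x and y_i = log x + log X_i, the shift 1/2 in z_i accounts for √x and √X_i, while
the remaining exponent s_i(1 + log X_i/log x) tends to s_i. -/
lemma tendsto_edgeVolume_complex {m : ℕ} (hm : 4 ≤ m) {c : Fin m → ℝ} (hc : ∀ j, 0 < c j)
    {X : Fin m → ℝ} (hX : ∀ i, 0 < X i) :
    Tendsto (fun x : ℝ => ((edgeVolume (x • X) / mainTerm m x : ℝ) : ℂ)) atTop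
      (nhds (2 ^ m * edgeConst c * ∏ i, (Real.sqrt (X i) : ℂ))) := by
  let K : ℝ → (Fin m → ℝ) → ℂ := fun L t => edgeKernel c t *
    (∏ i, (linePoint c t i / L + 1 / 2)⁻¹) *
      Complex.exp (∑ i, linePoint c t i * (1 + Real.log (X i) / L))
  have hK : Tendsto (fun x : ℝ => ∫ t, K (Real.log x) t) atTop
      (nhds (∫ t, edgeKernel c t * 2 ^ m * Complex.exp (∑ i, linePoint c t i))) := by
    refine tendsto_integral_filter_of_dominated_convergence
      (fun t => ‖edgeKernel c t‖ * 2 ^ m * Real.exp (∑ i, c i * (1 + |Real.log (X i)|))) ?_ ?_ ?_ ?_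
    · have := fun j => (continuous_linePoint c j).measurable
      have := measurable_edgeKernel c
      refine Eventually.of_forall fun x => Measurable.aestronglyMeasurable ?_
      fun_prop
    · filter_upwards [Real.tendsto_log_atTop.eventually_ge_atTop 1] with x hx
      refine Eventually.of_forall fun t => ?_
      have hL : 0 < Real.log x := by linarith
      simp only [K]
      rw [norm_mul, norm_mul, Complex.norm_exp]
      have h1 : (∑ i, linePoint c t i * (1 + Real.log (X i) / Real.log x : ℂ)).re =
          ∑ i, c i * (1 + Real.log (X i) / Real.log x) := by
        rw [Complex.re_sum]
        refine Finset.sum_congr rfl fun i _ => ?_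
        rw [show (1 + Real.log (X i) / Real.log x : ℂ) =
          ((1 + Real.log (X i) / Real.log x : ℝ) : ℂ) by push_cast; rfl, Complex.re_mul_ofReal,
          linePoint_re]
      rw [h1]
      gcongr with i
      · rw [norm_prod]
        refine (Finset.prod_le_prod (fun i _ => norm_nonneg _)
          fun i _ => norm_inv_linePoint_le hc hL t i).trans_eq (by simp)
      · exact (hc i).le
      · refine (div_le_div_of_nonneg_right (le_abs_self _) hL.le).trans ?_
        exact div_le_self (abs_nonneg _) hx
    · exact ((integrable_edgeKernel hm hc).norm.mul_const _).mul_const _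
    · refine Eventually.of_forall fun t => ?_
      have hinv : Tendsto (fun x : ℝ => ((Real.log x : ℝ) : ℂ)⁻¹) atTop (nhds 0) := by
        have := (Complex.continuous_ofReal.tendsto 0).comp
          (tendsto_inv_atTop_zero.comp Real.tendsto_log_atTop)
        simpa [Function.comp_def] using this
      have h1 : ∀ i, Tendsto (fun x : ℝ => (linePoint c t i / (Real.log x : ℂ) + 1 / 2)⁻¹) atTop
          (nhds 2) := by
        intro i
        have := ((hinv.const_mul (linePoint c t i)).add_const (1 / 2 : ℂ)).inv₀ (by norm_num)
        simpa [div_eq_mul_inv] using this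
      have h2 : ∀ i, Tendsto (fun x : ℝ => linePoint c t i *
          (1 + (Real.log (X i) : ℂ) / (Real.log x : ℂ))) atTop (nhds (linePoint c t i)) := by
        intro i
        have := ((hinv.const_mul (Real.log (X i) : ℂ)).const_add (1 : ℂ)).const_mul
          (linePoint c t i)
        simpa [div_eq_mul_inv] using this
      have h3 := tendsto_finsetProd (Finset.univ : Finset (Fin m)) fun i _ => h1 i
      rw [Finset.prod_const, Finset.card_univ, Fintype.card_fin] at h3
      exact (h3.const_mul _).mul (Complex.continuous_exp.continuousAt.tendsto.comp
        (tendsto_finsetSum _ fun i _ => h2 i))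
  have hK' := (hK.const_mul (1 / (2 * Real.pi : ℂ) ^ m)).mul_const (∏ i, (Real.sqrt (X i) : ℂ))
  have hlim : 1 / (2 * Real.pi : ℂ) ^ m *
      (∫ t, edgeKernel c t * 2 ^ m * Complex.exp (∑ i, linePoint c t i)) *
        ∏ i, (Real.sqrt (X i) : ℂ) = 2 ^ m * edgeConst c * ∏ i, (Real.sqrt (X i) : ℂ) := by
    have : ∀ t, edgeKernel c t * 2 ^ m * Complex.exp (∑ i, linePoint c t i) =
        2 ^ m * (edgeKernel c t * Complex.exp (∑ i, linePoint c t i)) := fun t => by ring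
    simp_rw [this]
    rw [integral_const_mul, edgeConst]
    ring
  rw [hlim] at hK'
  refine hK'.congr' ?_
  filter_upwards [eventually_gt_atTop 1] with x hx
  have hx0 : 0 < x := by linarith
  have hL : 0 < Real.log x := Real.log_pos hx
  have hL' : ((Real.log x : ℝ) : ℂ) ≠ 0 := by exact_mod_cast hL.ne'
  have hy : x • X = fun i => Real.exp (Real.log x + Real.log (X i)) := by
    funext i
    rw [Real.exp_add, Real.exp_log hx0, Real.exp_log (hX i)]
    rfl
  have hexp : ∀ t, inversionKernel c (Real.log x) (fun i => Real.log x + Real.log (X i)) t =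
      K (Real.log x) t * ((Real.sqrt x : ℂ) ^ m * ∏ i, (Real.sqrt (X i) : ℂ)) := by
    intro t
    have hs : ∀ {a : ℝ}, 0 < a → (Real.sqrt a : ℂ) = Complex.exp (Real.log a / 2 : ℝ) := by
      intro a ha
      rw [← Complex.ofReal_exp, Real.sqrt_eq_rpow, Real.rpow_def_of_pos ha]
      congr 3
      ring
    have h1 : (Real.sqrt x : ℂ) ^ m * ∏ i, (Real.sqrt (X i) : ℂ) =
        Complex.exp (∑ i, (Real.log x / 2 + Real.log (X i) / 2 : ℝ)) := by
      rw [Complex.exp_sum]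
      simp_rw [Complex.ofReal_add, Complex.exp_add]
      rw [Finset.prod_mul_distrib, Finset.prod_const, Finset.card_univ, Fintype.card_fin, hs hx0]
      simp_rw [fun i => hs (hX i)]
    rw [h1]
    simp only [K, inversionKernel]
    rw [mul_assoc _ (Complex.exp _), ← Complex.exp_add]
    congr 2
    rw [← Finset.sum_add_distrib]
    refine Finset.sum_congr rfl fun i _ => ?_
    push_cast
    field_simp
  have hsq : (Real.sqrt x : ℂ) ≠ 0 := by exact_mod_cast (Real.sqrt_pos.2 hx0).ne'
  rw [Complex.ofReal_div, hy, edgeVolume_exp_eq hm hc hL, pow_card_edge_div hm hL]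
  simp_rw [hexp]
  rw [integral_mul_const, mainTerm]
  push_cast
  rw [eq_div_iff (mul_ne_zero (pow_ne_zero _ hsq) (pow_ne_zero _ hL'))]
  ring

/-- Up to the factor 2^m the constant is a limit of real volumes. -/
lemma edgeConst_eq_ofReal {m : ℕ} (hm : 4 ≤ m) {c : Fin m → ℝ} (hc : ∀ j, 0 < c j) :
    edgeConst c = ((edgeConst c).re : ℂ) := by
  have h := tendsto_edgeVolume_complex hm hc (X := fun _ => 1) fun _ => one_pos
  have h1 : (2 ^ m * edgeConst c * ∏ _i : Fin m, (Real.sqrt 1 : ℂ)).im = 0 := by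
    have := (Complex.continuous_im.tendsto _).comp h
    refine tendsto_nhds_unique this ?_
    simp only [Function.comp_def, Complex.ofReal_im]
    exact tendsto_const_nhds
  have h2 : (2 ^ m * edgeConst c * ∏ _i : Fin m, (Real.sqrt 1 : ℂ)) =
      ((2 ^ m : ℝ) : ℂ) * edgeConst c := by simp
  rw [h2, Complex.im_ofReal_mul] at h1
  rcases mul_eq_zero.1 h1 with h3 | h3
  · exact absurd h3 (by positivity)
  · exact Complex.ext (by simp) (by simp [h3])

lemma hasDensity_edgeVolume {m : ℕ} (hm : 4 ≤ m) {c : Fin m → ℝ} (hc : ∀ j, 0 < c j) :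
    HasDensity (m := m) edgeVolume (2 ^ m * (edgeConst c).re) := by
  intro X hX
  have h := tendsto_edgeVolume_complex hm hc hX
  rw [edgeConst_eq_ofReal hm hc] at h
  have := (Complex.continuous_re.tendsto _).comp h
  refine (this.congr fun x => by simp).trans_eq ?_
  congr 1
  rw [← Complex.ofReal_re (2 ^ m * (edgeConst c).re * ∏ i, Real.sqrt (X i))]
  push_cast
  rfl

/-- Bounding the inversion integral in absolute value on the lines Re s_j = 1 gives an estimate
uniform in Y, as needed to sum over primes later. The size condition on Y keeps exp((c_i/L) log Y_i)
at most e². -/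
lemma exists_edgeVolume_le {m : ℕ} (hm : 4 ≤ m) :
    ∃ C : ℝ, 0 < C ∧ ∀ L : ℝ, 1 ≤ L → ∀ Y : Fin m → ℝ, (∀ i, 0 < Y i) →
      (∀ i, Y i ≤ Real.exp (2 * L)) →
      edgeVolume Y ≤ C * (∏ i, Real.sqrt (Y i)) * L ^ (Fintype.card (Edge m) - m) := by
  let c : Fin m → ℝ := fun _ => 1
  have hc : ∀ j, 0 < c j := fun _ => one_pos
  set A : ℝ := 1 / (2 * Real.pi) ^ m * ((∫ t, ‖edgeKernel c t‖) * 2 ^ m * Real.exp (m * 2)) with hA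
  have hA0 : 0 ≤ A := by
    have : 0 ≤ ∫ t, ‖edgeKernel c t‖ := integral_nonneg fun _ => norm_nonneg _
    positivity
  refine ⟨A + 1, by linarith, fun L hL Y hY hYL => ?_⟩
  have hL0 : 0 < L := by linarith
  have hYe : Y = fun i => Real.exp (Real.log (Y i)) := funext fun i => (Real.exp_log (hY i)).symm
  have hprod : ∏ i, Real.sqrt (Y i) = Real.exp (∑ i, Real.log (Y i) / 2) := by
    rw [Real.exp_sum]
    refine Finset.prod_congr rfl fun i _ => ?_
    rw [Real.sqrt_eq_rpow, Real.rpow_def_of_pos (hY i)]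
    congr 1
    ring
  have hexp : ∑ i, (c i / L + 1 / 2) * Real.log (Y i) ≤ m * 2 + ∑ i, Real.log (Y i) / 2 := by
    have : (m * 2 : ℝ) = ∑ _i : Fin m, (2 : ℝ) := by simp
    rw [this, ← Finset.sum_add_distrib]
    refine Finset.sum_le_sum fun i _ => ?_
    have h1 : Real.log (Y i) ≤ 2 * L := (Real.log_le_iff_le_exp (hY i)).2 (hYL i)
    have h2 : c i / L * Real.log (Y i) ≤ 2 := by
      rw [div_mul_eq_mul_div, div_le_iff₀ hL0]
      simpa [c] using h1
    linarith
  have hint : ‖∫ t, inversionKernel c L (fun i => Real.log (Y i)) t‖ ≤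
      (∫ t, ‖edgeKernel c t‖) * 2 ^ m * (Real.exp (m * 2) * ∏ i, Real.sqrt (Y i)) := by
    rw [hprod, ← Real.exp_add, ← integral_mul_const, ← integral_mul_const]
    refine norm_integral_le_of_norm_le
      (((integrable_edgeKernel hm hc).norm.mul_const _).mul_const _)
      (Eventually.of_forall fun t => (norm_inversionKernel_le hc hL0 _ t).trans ?_)
    gcongr
  have h := edgeVolume_exp_eq hm hc hL0 fun i => Real.log (Y i)
  rw [← hYe, pow_card_edge_div hm hL0] at h
  have h' := congrArg norm h
  rw [Complex.norm_real, norm_mul, norm_mul, norm_pow, norm_div, norm_pow, norm_mul,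
    Complex.norm_real, Complex.norm_real] at h'
  simp only [norm_one, Complex.norm_ofNat, Real.norm_eq_abs, abs_of_pos Real.pi_pos,
    abs_of_pos hL0] at h'
  refine (le_abs_self _).trans (h'.le.trans ?_)
  calc _ ≤ 1 / (2 * Real.pi) ^ m * L ^ (Fintype.card (Edge m) - m) *
        ((∫ t, ‖edgeKernel c t‖) * 2 ^ m * (Real.exp (m * 2) * ∏ i, Real.sqrt (Y i))) := by
        gcongr
    _ = A * (∏ i, Real.sqrt (Y i)) * L ^ (Fintype.card (Edge m) - m) := by rw [hA]; ring
    _ ≤ _ := by gcongr; linarith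

/-! ### Counting integral labellings by volumes. -/

lemma prod_vertexProd {m : ℕ} {R : Type*} [CommMonoid R] (u : Edge m → R) :
    ∏ i, vertexProd u i = (∏ e, u e) ^ 2 := by
  unfold vertexProd
  rw [prod_vertex_prod_edge (fun e _ => u e), ← Finset.prod_pow]
  exact Finset.prod_congr rfl fun e _ => (sq _).symm

lemma prod_sqrt_vertexProd {m : ℕ} {u : Edge m → ℝ} (hu : ∀ e, 0 ≤ u e) :
    ∏ i, Real.sqrt (vertexProd u i) = ∏ e, u e := by
  rw [← Real.sqrt_prod (x := vertexProd u) _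
    (fun i _ => Finset.prod_nonneg fun e _ => hu e), prod_vertexProd,
    Real.sqrt_sq (Finset.prod_nonneg fun e _ => hu e)]

lemma cast_vertexProd {m : ℕ} (d : Edge m → ℕ) (i : Fin m) :
    ((vertexProd d i : ℕ) : ℝ) = vertexProd (fun e => (d e : ℝ)) i := by
  simp [vertexProd]

/-- The natural edge labellings in `S` whose vertex products are bounded by `Y`. -/
def boundedLabels {m : ℕ} (S : Set (Edge m → ℕ)) (Y : Fin m → ℝ) : Set (Edge m → ℕ) :=
  {d | d ∈ S ∧ ∀ i, ((vertexProd d i : ℕ) : ℝ) ≤ Y i}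

/-- The number of labellings in `boundedLabels S Y`. -/
noncomputable def labelCount {m : ℕ} (S : Set (Edge m → ℕ)) (Y : Fin m → ℝ) : ℝ :=
  (boundedLabels S Y).ncard

/-- The labellings by positive integers. -/
def posLabels (m : ℕ) : Set (Edge m → ℕ) := {d | ∀ e, 0 < d e}

lemma le_vertexProd_nat {m : ℕ} {d : Edge m → ℕ} (hd : d ∈ posLabels m) {e : Edge m} {i : Fin m}
    (hi : i ∈ e.verts) : d e ≤ vertexProd d i :=
  Nat.le_of_dvd (Finset.prod_pos fun e _ => hd e)
    (Finset.dvd_prod_of_mem d (by simpa using hi))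

lemma finite_boundedLabels {m : ℕ} {S : Set (Edge m → ℕ)} (hS : S ⊆ posLabels m)
    (Y : Fin m → ℝ) : (boundedLabels S Y).Finite := by
  refine (Set.Finite.pi' fun e : Edge m => Set.finite_Iic ⌊Y e.1.1⌋₊).subset fun d hd e => ?_
  exact (le_vertexProd_nat (hS hd.1) (Edge.mem_verts.2 (Or.inl rfl))).trans
    (Nat.le_floor (hd.2 e.1.1))

lemma labelCount_nonneg {m : ℕ} (S : Set (Edge m → ℕ)) (Y : Fin m → ℝ) : 0 ≤ labelCount S Y :=
  Nat.cast_nonneg _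

lemma labelCount_mono {m : ℕ} {S T : Set (Edge m → ℕ)} (hST : S ⊆ T) (hT : T ⊆ posLabels m)
    (Y : Fin m → ℝ) : labelCount S Y ≤ labelCount T Y :=
  Nat.cast_le.2 (Set.ncard_le_ncard (fun _ hd => ⟨hST hd.1, hd.2⟩) (finite_boundedLabels hT Y))

lemma volume_pi_Ico_add_one {m : ℕ} (a : Edge m → ℝ) :
    volume (Set.univ.pi fun e => Set.Ico (a e) (a e + 1)) = 1 := by
  simp [volume_pi_pi]

/-- Rounding every coordinate down covers the region by unit cubes indexed by the bounded
labellings. -/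
lemma edgeVolume_le_labelCount {m : ℕ} (Y : Fin m → ℝ) :
    edgeVolume Y ≤ labelCount (posLabels m) Y := by
  have hfin := finite_boundedLabels (le_refl (posLabels m)) Y
  have hsub : edgeRegion Y ⊆ ⋃ d ∈ hfin.toFinset,
      Set.univ.pi fun e => Set.Ico (d e : ℝ) (d e + 1) := by
    intro u hu
    have h0 : ∀ e, 0 ≤ u e := fun e => zero_le_one.trans (hu.1 e)
    simp only [Set.mem_iUnion]
    refine ⟨fun e => ⌊u e⌋₊, ?_, fun e _ => ⟨Nat.floor_le (h0 e), Nat.lt_floor_add_one _⟩⟩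
    rw [Set.Finite.mem_toFinset]
    refine ⟨fun e => Nat.floor_pos.2 (hu.1 e), fun i => ?_⟩
    rw [cast_vertexProd]
    exact (vertexProd_mono (fun e => Nat.cast_nonneg _) (fun e => Nat.floor_le (h0 e)) i).trans
      (hu.2 i)
  have h := (measure_mono (μ := volume) hsub).trans (measure_biUnion_finset_le _ _)
  simp_rw [volume_pi_Ico_add_one] at h
  rw [edgeVolume, Measure.real, labelCount, Set.ncard_eq_toFinset_card _ hfin]
  refine ENNReal.toReal_le_of_le_ofReal (Nat.cast_nonneg _) (h.trans_eq ?_)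
  simp

lemma ncard_le_volume {m : ℕ} {S : Set (Edge m → ℕ)} (hS : S.Finite) {R : Set (Edge m → ℝ)}
    (hR : volume R < ⊤) (b : (Edge m → ℕ) → Edge m → ℕ) (hb : Set.InjOn b S)
    (h : ∀ d ∈ S, ∀ u : Edge m → ℝ, (∀ e, (b d e : ℝ) ≤ u e ∧ u e < b d e + 1) → u ∈ R) :
    (S.ncard : ℝ) ≤ volume.real R := by
  have hdisj : Set.PairwiseDisjoint (hS.toFinset : Set (Edge m → ℕ))
      fun d => Set.univ.pi fun e => Set.Ico (b d e : ℝ) (b d e + 1) := by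
    intro d hd d' hd' hdd
    refine Set.disjoint_left.2 fun u hu hu' => hdd (hb (hS.mem_toFinset.1 hd)
      (hS.mem_toFinset.1 hd') (funext fun e => ?_))
    have h1 := hu e trivial
    have h2 := hu' e trivial
    have h3 : (b d e : ℝ) < b d' e + 1 := h1.1.trans_lt h2.2
    have h4 : (b d' e : ℝ) < b d e + 1 := h2.1.trans_lt h1.2
    norm_cast at h3 h4
    omega
  have hm := measure_biUnion_finset (μ := volume) hdisj fun d _ =>
    MeasurableSet.univ_pi fun e => measurableSet_Ico
  simp_rw [volume_pi_Ico_add_one] at hm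
  have hle : volume (⋃ d ∈ hS.toFinset, Set.univ.pi fun e => Set.Ico (b d e : ℝ) (b d e + 1)) ≤
      volume R := measure_mono fun u hu => by
    simp only [Set.mem_iUnion] at hu
    obtain ⟨d, hd, hu⟩ := hu
    exact h d (hS.mem_toFinset.1 hd) u fun e => hu e trivial
  rw [hm] at hle
  rw [Measure.real, Set.ncard_eq_toFinset_card _ hS]
  have := ENNReal.toReal_mono hR.ne hle
  simpa using this

/-- The vertex products of the constant labelling `2`. -/
def twoScale (m : ℕ) : Fin m → ℝ := vertexProd fun _ => 2

lemma twoScale_pos {m : ℕ} (i : Fin m) : 0 < twoScale m i := Finset.prod_pos fun _ _ => two_pos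

/-- The unit cube with lower corner 2d - 1 stays in u ≥ 1 even where d_e = 1, at the price of
enlarging each vertex bound by its number of edges in powers of 2. -/
lemma mem_edgeRegion_of_double {m : ℕ} {Y : Fin m → ℝ} {d : Edge m → ℕ}
    (hd : d ∈ boundedLabels (posLabels m) Y) {u : Edge m → ℝ}
    (hu : ∀ e, ((2 * d e - 1 : ℕ) : ℝ) ≤ u e ∧ u e < (2 * d e - 1 : ℕ) + 1) :
    u ∈ edgeRegion (twoScale m * Y) ∧ ∀ e, d e = 1 → u e < 2 := by
  have hcast : ∀ e, ((2 * d e - 1 : ℕ) : ℝ) = 2 * d e - 1 := fun e => by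
    have := hd.1 e
    rw [Nat.cast_sub (by omega)]
    push_cast
    ring
  simp only [hcast] at hu
  have h1 : ∀ e, (1 : ℝ) ≤ d e := fun e => by exact_mod_cast hd.1 e
  have hu1 : ∀ e, 1 ≤ u e := fun e => by linarith [h1 e, (hu e).1]
  refine ⟨⟨hu1, fun i => ?_⟩, fun e he => ?_⟩
  · refine (vertexProd_mono (v := (fun _ => 2) * fun e => (d e : ℝ))
      (fun e => zero_le_one.trans (hu1 e)) (fun e => ?_) i).trans ?_
    · simp only [Pi.mul_apply]
      linarith [(hu e).2]
    · rw [vertexProd_mul, ← cast_vertexProd]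
      exact mul_le_mul_of_nonneg_left (hd.2 i) (twoScale_pos i).le
  · have := (hu e).2
    rw [he] at this
    norm_num at this
    linarith

lemma injOn_double {m : ℕ} : Set.InjOn (fun (d : Edge m → ℕ) e => 2 * d e - 1) (posLabels m) := by
  intro d _ d' _ h
  funext e
  have h1 := congrFun h e
  simp only at h1
  omega

lemma labelCount_le_edgeVolume {m : ℕ} (Y : Fin m → ℝ) :
    labelCount (posLabels m) Y ≤ edgeVolume (twoScale m * Y) :=
  ncard_le_volume (finite_boundedLabels le_rfl Y) (volume_edgeRegion_lt_top _) _
    (injOn_double.mono fun _ hd => hd.1) fun _ hd _ hu => (mem_edgeRegion_of_double hd hu).1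

lemma labelCount_eq_one_le {m : ℕ} (Y : Fin m → ℝ) (e : Edge m) :
    labelCount {d | d ∈ posLabels m ∧ d e = 1} Y ≤
      volume.real (edgeRegion (twoScale m * Y) ∩ {u | u e < 2}) :=
  ncard_le_volume (finite_boundedLabels (fun _ hd => hd.1) Y)
    ((measure_mono Set.inter_subset_left).trans_lt (volume_edgeRegion_lt_top _)) _
    (injOn_double.mono fun _ hd => hd.1.1) fun _ hd _ hu =>
      ⟨(mem_edgeRegion_of_double ⟨hd.1.1, hd.2⟩ hu).1,
        (mem_edgeRegion_of_double ⟨hd.1.1, hd.2⟩ hu).2 e hd.1.2⟩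

/-- When no label is 1, the cubes may be shifted down by one without leaving u ≥ 1, and the
comparison loses no constant. -/
lemma labelCount_two_le {m : ℕ} (Y : Fin m → ℝ) :
    labelCount {d | ∀ e : Edge m, 2 ≤ d e} Y ≤ edgeVolume Y := by
  refine ncard_le_volume (finite_boundedLabels (fun d (hd : ∀ e, 2 ≤ d e) e => zero_lt_two.trans_le (hd e)) Y)
    (volume_edgeRegion_lt_top _) (fun d e => d e - 1) ?_ ?_
  · intro d hd d' hd' h
    funext e
    have h1 := congrFun h e
    have h2 := hd.1 e
    have h3 := hd'.1 e
    simp only at h1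
    omega
  · intro d hd u hu
    have hcast : ∀ e, ((d e - 1 : ℕ) : ℝ) = d e - 1 := fun e => by
      have := hd.1 e
      rw [Nat.cast_sub (by omega), Nat.cast_one]
    simp only [hcast] at hu
    have h1 : ∀ e, (2 : ℝ) ≤ d e := fun e => by exact_mod_cast hd.1 e
    have hu1 : ∀ e, 1 ≤ u e := fun e => by linarith [h1 e, (hu e).1]
    refine ⟨hu1, fun i => le_trans ?_ (hd.2 i)⟩
    rw [cast_vertexProd]
    exact vertexProd_mono (fun e => zero_le_one.trans (hu1 e)) (fun e => by linarith [(hu e).2]) i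

lemma labelCount_le_add_sum {m : ℕ} (Y : Fin m → ℝ) :
    labelCount (posLabels m) Y ≤ labelCount {d | ∀ e : Edge m, 2 ≤ d e} Y +
      ∑ e : Edge m, labelCount {d | d ∈ posLabels m ∧ d e = 1} Y := by
  have hsub : boundedLabels (posLabels m) Y ⊆ boundedLabels {d | ∀ e : Edge m, 2 ≤ d e} Y ∪
      ⋃ e ∈ (Finset.univ : Finset (Edge m)), boundedLabels {d | d ∈ posLabels m ∧ d e = 1} Y := by
    intro d hd
    by_cases h : ∀ e, 2 ≤ d e
    · exact Or.inl ⟨h, hd.2⟩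
    · push Not at h
      obtain ⟨e, he⟩ := h
      refine Or.inr ?_
      simp only [Set.mem_iUnion]
      exact ⟨e, Finset.mem_univ e, ⟨hd.1, le_antisymm (Nat.lt_succ_iff.1 he) (hd.1 e)⟩, hd.2⟩
  have hf1 := finite_boundedLabels (S := {d | ∀ e : Edge m, 2 ≤ d e})
    (fun d hd e => zero_lt_two.trans_le (hd e)) Y
  have hf2 : (⋃ e ∈ (Finset.univ : Finset (Edge m)),
      boundedLabels {d | d ∈ posLabels m ∧ d e = 1} Y).Finite :=
    Set.Finite.biUnion (Finset.finite_toSet _) fun e _ => finite_boundedLabels (fun _ hd => hd.1) Y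
  have h := (Set.ncard_le_ncard hsub (hf1.union hf2)).trans (Set.ncard_union_le _ _)
  have h2 := h.trans (Nat.add_le_add_left (Finset.set_ncard_biUnion_le Finset.univ _) _)
  unfold labelCount
  exact_mod_cast h2

lemma volume_preimage_mul {m : ℕ} {D : Edge m → ℝ} (hD : ∀ e, 0 < D e) {A : Set (Edge m → ℝ)}
    (hA : MeasurableSet A) : volume.real A = (∏ e, D e) * volume.real {u | D * u ∈ A} := by
  have hdet : (Matrix.diagonal D).det = ∏ e, D e := Matrix.det_diagonal
  have hpos : 0 < ∏ e, D e := Finset.prod_pos fun e _ => hD e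
  have h := Real.smul_map_diagonal_volume_pi (D := D) (by rw [hdet]; exact hpos.ne')
  have hT : Measurable (Matrix.toLin' (Matrix.diagonal D)) :=
    (LinearMap.continuous_of_finiteDimensional _).measurable
  have h2 := congrArg (fun μ : Measure (Edge m → ℝ) => μ A) h
  simp only [Measure.smul_apply, smul_eq_mul] at h2
  rw [Measure.map_apply hT hA, hdet, abs_of_pos hpos] at h2
  have h3 : (Matrix.toLin' (Matrix.diagonal D)) ⁻¹' A = {u | D * u ∈ A} := by
    ext u
    simp only [Set.mem_preimage, Matrix.toLin'_apply, Set.mem_ofPred_eq]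
    rw [show Matrix.mulVec (Matrix.diagonal D) u = D * u from
      funext fun e => Matrix.mulVec_diagonal D u e]
  rw [h3] at h2
  rw [Measure.real, ← h2, ENNReal.toReal_mul, ENNReal.toReal_ofReal hpos.le]
  rfl

/-- The complementary part u_e ≥ 2 is the image of a smaller region under doubling of the coordinate
e. -/
lemma volume_edgeRegion_inter_lt {m : ℕ} (Y : Fin m → ℝ) (e : Edge m) :
    volume.real (edgeRegion Y ∩ {u | u e < 2}) =
      edgeVolume Y - 2 * edgeVolume (Y / vertexProd (Pi.mulSingle e 2)) := by
  have hms : MeasurableSet {u : Edge m → ℝ | u e < 2} :=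
    measurableSet_lt (measurable_pi_apply e) measurable_const
  have h1 := measureReal_inter_add_sdiff (μ := volume) (s := edgeRegion Y) hms
    (volume_edgeRegion_lt_top Y).ne
  have hD : ∀ e', (0 : ℝ) < (Pi.mulSingle e 2 : Edge m → ℝ) e' := fun e' => by
    rw [Pi.mulSingle_apply]
    split_ifs <;> norm_num
  have h2 := volume_preimage_mul hD ((measurableSet_edgeRegion Y).diff hms)
  have h3 : {u | (Pi.mulSingle e 2 : Edge m → ℝ) * u ∈ edgeRegion Y \ {u | u e < 2}} =
      edgeRegion (Y / vertexProd (Pi.mulSingle e 2)) := by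
    ext u
    have hv : ∀ i, (vertexProd ((Pi.mulSingle e 2 : Edge m → ℝ) * u) i ≤ Y i ↔
        vertexProd u i ≤ (Y / vertexProd (Pi.mulSingle e 2) : Fin m → ℝ) i) := fun i => by
      rw [vertexProd_mul, Pi.div_apply, le_div_iff₀ (show 0 < vertexProd _ i from Finset.prod_pos fun e _ => hD e), mul_comm]
    simp only [edgeRegion, Set.mem_sdiff, Set.mem_ofPred_eq, hv, Pi.mul_apply]
    constructor
    · rintro ⟨⟨h1, h2⟩, h3⟩
      refine ⟨fun e' => ?_, h2⟩
      by_cases he : e' = e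
      · subst he
        rw [Pi.mulSingle_eq_same] at h3
        linarith
      · simpa [Pi.mulSingle_eq_of_ne he] using h1 e'
    · rintro ⟨h1, h2⟩
      refine ⟨⟨fun e' => ?_, h2⟩, ?_⟩
      · refine (h1 e').trans (le_mul_of_one_le_left (zero_le_one.trans (h1 e')) ?_)
        rw [Pi.mulSingle_apply]
        split_ifs <;> norm_num
      · rw [Pi.mulSingle_eq_same]
        linarith [h1 e]
  rw [h3, Finset.prod_pi_mulSingle', if_pos (Finset.mem_univ e)] at h2
  rw [edgeVolume, edgeVolume, ← h1, h2]
  ring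

lemma HasDensity.comp_mul {m : ℕ} {G : (Fin m → ℝ) → ℝ} {C : ℝ} (hG : HasDensity G C)
    {w : Fin m → ℝ} (hw : ∀ i, 0 < w i) :
    HasDensity (fun Y => G (w * Y)) (C * ∏ i, Real.sqrt (w i)) := by
  intro X hX
  have := hG (w * X) fun i => mul_pos (hw i) (hX i)
  refine (this.congr fun x => by simp only [mul_smul_comm]).trans_eq ?_
  rw [mul_assoc, ← Finset.prod_mul_distrib]
  simp only [Pi.mul_apply, Real.sqrt_mul (hw _).le]

lemma HasDensity.comp_div {m : ℕ} {G : (Fin m → ℝ) → ℝ} {C : ℝ} (hG : HasDensity G C)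
    {w : Fin m → ℝ} (hw : ∀ i, 0 < w i) :
    HasDensity (fun Y => G (Y / w)) (C / ∏ i, Real.sqrt (w i)) := by
  have := hG.comp_mul (w := w⁻¹) fun i => inv_pos.2 (hw i)
  simp only [Pi.inv_apply, Real.sqrt_inv, Finset.prod_inv_distrib] at this
  simpa only [div_eq_mul_inv, mul_comm] using this

/-- The two volume bounds differ by the slabs u_e < 2. These have density zero: dividing the bounds
by the vertex products of a single label 2 halves the density, which the Jacobian 2 compensates
exactly. -/
lemma hasDensity_labelCount {m : ℕ} {D : ℝ} (hD : HasDensity (m := m) edgeVolume D) :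
    HasDensity (labelCount (posLabels m)) D := by
  intro X hX
  have hlow := hD X hX
  have he : ∀ e : Edge m, Tendsto (fun x : ℝ =>
      (edgeVolume (twoScale m * (x • X)) -
        2 * edgeVolume (twoScale m * (x • X) / vertexProd (Pi.mulSingle e 2))) / mainTerm m x)
      atTop (nhds 0) := by
    intro e
    have hpos : ∀ i, (0 : ℝ) < vertexProd (Pi.mulSingle e 2 : Edge m → ℝ) i := fun i =>
      Finset.prod_pos fun e' _ => by
        rw [Pi.mulSingle_apply]
        split_ifs <;> norm_num
    have h1 := hD.comp_mul (w := twoScale m) twoScale_pos X hX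
    have h2 := (hD.comp_div hpos).comp_mul (w := twoScale m) twoScale_pos X hX
    rw [prod_sqrt_vertexProd (fun e' => by
        rw [Pi.mulSingle_apply]
        split_ifs <;> norm_num), Finset.prod_pi_mulSingle', if_pos (Finset.mem_univ e)] at h2
    refine ((h1.sub (h2.const_mul 2)).congr fun x => by ring).trans_eq ?_
    congr 1
    ring
  have hsum := hlow.add (tendsto_finsetSum (Finset.univ : Finset (Edge m)) fun e _ => he e)
  rw [Finset.sum_const_zero, add_zero] at hsum
  refine tendsto_of_tendsto_of_tendsto_of_le_of_le' hlow hsum ?_ ?_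
  · filter_upwards [eventually_gt_atTop 1] with x hx
    exact div_le_div_of_nonneg_right (edgeVolume_le_labelCount _) (mainTerm_pos m hx).le
  · filter_upwards [eventually_gt_atTop 1] with x hx
    rw [← Finset.sum_div, ← add_div]
    refine div_le_div_of_nonneg_right ?_ (mainTerm_pos m hx).le
    refine (labelCount_le_add_sum _).trans (add_le_add (labelCount_two_le _) ?_)
    refine Finset.sum_le_sum fun e _ => (labelCount_eq_one_le _ e).trans_eq ?_
    rw [volume_edgeRegion_inter_lt]

lemma exists_labelCount_le {m : ℕ} (hm : 4 ≤ m) :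
    ∃ C : ℝ, 0 < C ∧ ∀ X : Fin m → ℝ, (∀ i, 0 < X i) → ∀ᶠ x : ℝ in atTop,
      ∀ W : Fin m → ℝ, (∀ i, 1 ≤ W i) →
        labelCount (posLabels m) (x • X / W) / mainTerm m x ≤
          C * (∏ i, Real.sqrt (X i)) / ∏ i, Real.sqrt (W i) := by
  obtain ⟨C, hC, h⟩ := exists_edgeVolume_le hm
  refine ⟨C * ∏ i, Real.sqrt (twoScale m i), mul_pos hC (Finset.prod_pos fun i _ =>
    Real.sqrt_pos.2 (twoScale_pos i)), fun X hX => ?_⟩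
  -- Then the enlarged bounds are at most x² = exp(2 log x), the range in which the volume bound is
  -- uniform.
  have hev : ∀ᶠ x : ℝ in atTop, ∀ i, twoScale m i * X i ≤ x :=
    eventually_all.2 fun i => eventually_ge_atTop _
  filter_upwards [hev, eventually_ge_atTop (Real.exp 1)] with x hx hxe W hW
  have hx1 : 1 < x := (Real.one_lt_exp_iff.2 one_pos).trans_le hxe
  have hx0 : 0 < x := by linarith
  have hL : 1 ≤ Real.log x := (Real.le_log_iff_exp_le hx0).2 hxe
  have hW0 : ∀ i, 0 < W i := fun i => zero_lt_one.trans_le (hW i)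
  rw [div_le_iff₀ (mainTerm_pos m hx1)]
  refine (labelCount_le_edgeVolume _).trans ((h (Real.log x) hL _ (fun i => ?_)
    fun i => ?_).trans_eq ?_)
  · exact mul_pos (twoScale_pos i) (div_pos (mul_pos hx0 (hX i)) (hW0 i))
  · rw [two_mul, Real.exp_add, Real.exp_log hx0]
    simp only [Pi.mul_apply, Pi.div_apply, Pi.smul_apply, smul_eq_mul]
    calc twoScale m i * (x * X i / W i) ≤ twoScale m i * (x * X i) :=
          mul_le_mul_of_nonneg_left (div_le_self (mul_pos hx0 (hX i)).le (hW i))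
            (twoScale_pos i).le
      _ = x * (twoScale m i * X i) := by ring
      _ ≤ x * x := mul_le_mul_of_nonneg_left (hx i) hx0.le
  · simp only [Pi.mul_apply, Pi.div_apply, Pi.smul_apply, smul_eq_mul,
      Real.sqrt_mul (twoScale_pos _).le, Real.sqrt_div (mul_pos hx0 (hX _)).le,
      Real.sqrt_mul hx0.le, Finset.prod_mul_distrib, Finset.prod_div_distrib, Finset.prod_const,
      Finset.card_univ, Fintype.card_fin, mainTerm]
    ring

/-! ### Positivity of the leading constant. -/

lemma card_edges_at {m : ℕ} (i : Fin m) :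
    (Finset.univ.filter fun e : Edge m => i ∈ e.verts).card = m - 1 := by
  have h1 : (Finset.univ.filter fun e : Edge m => i ∈ e.verts).card =
      (∑ e : Edge m, if i = e.1.1 then 1 else 0) + ∑ e : Edge m, if i = e.1.2 then 1 else 0 := by
    rw [Finset.card_filter, ← Finset.sum_add_distrib]
    refine Finset.sum_congr rfl fun e _ => ?_
    have := e.ne
    simp only [Edge.mem_verts]
    split_ifs <;> simp_all
  have h2 : (∑ e : Edge m, if i = e.1.1 then 1 else 0) = (Finset.Ioi i).card := by
    refine (prod_edge_eq (R := Multiplicative ℕ) fun a _ =>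
      Multiplicative.ofAdd (if i = a then 1 else 0)).trans ?_
    change (∑ a, ∑ _b ∈ Finset.Ioi a, if i = a then 1 else 0) = _
    simp
  have h3 : (∑ e : Edge m, if i = e.1.2 then 1 else 0) = (Finset.Iio i).card := by
    refine (prod_edge_eq' (R := Multiplicative ℕ) fun _ b =>
      Multiplicative.ofAdd (if i = b then 1 else 0)).trans ?_
    change (∑ b, ∑ _a ∈ Finset.Iio b, if i = b then 1 else 0) = _
    simp
  rw [h1, h2, h3, Fin.card_Ioi, Fin.card_Iio]
  omega

/-- Many edge weightings with all vertex sums equal, by the pigeonhole principle. -/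
lemma exists_many_regular_weights {m : ℕ} (q : ℕ) :
    ∃ F : Finset (Edge m → ℕ), (∀ v ∈ F, ∀ i, ∑ e with i ∈ Edge.verts e, v e = (m - 1) * q) ∧
      ((q + 1 : ℝ) ^ Fintype.card (Edge m)) / ((m - 1 : ℕ) * q + 1 : ℝ) ^ m ≤ F.card := by
  let s : Finset (Edge m → ℕ) := Fintype.piFinset fun _ => Finset.range (q + 1)
  let t : Finset (Fin m → ℕ) := Fintype.piFinset fun _ => Finset.range ((m - 1) * q + 1)
  let f : (Edge m → ℕ) → Fin m → ℕ := fun v i => ∑ e with i ∈ Edge.verts e, v e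
  have hs : (s.card : ℝ) = (q + 1 : ℝ) ^ Fintype.card (Edge m) := by
    simp [s, Fintype.card_piFinset]
  have ht : (t.card : ℝ) = ((m - 1 : ℕ) * q + 1 : ℝ) ^ m := by
    simp [t, Fintype.card_piFinset]
  have htpos : (0 : ℝ) < t.card := by rw [ht]; positivity
  have hf : ∀ v ∈ s, f v ∈ t := by
    intro v hv
    refine Fintype.mem_piFinset.2 fun i => Finset.mem_range.2 (Nat.lt_succ_of_le ?_)
    refine (Finset.sum_le_card_nsmul _ _ q fun e _ => ?_).trans ?_
    · exact Nat.lt_succ_iff.1 (Finset.mem_range.1 (Fintype.mem_piFinset.1 hv e))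
    · rw [card_edges_at, smul_eq_mul]
  obtain ⟨y, -, hy⟩ := Finset.exists_le_card_fiber_of_nsmul_le_card_of_maps_to hf
    (Finset.card_pos.1 (by exact_mod_cast htpos)) (b := (s.card : ℝ) / t.card)
    (by rw [nsmul_eq_mul, mul_div_cancel₀ _ htpos.ne'])
  have hpos : 0 < (s.filter fun v => f v = y).card := by
    have : (0 : ℝ) < (s.card : ℝ) / t.card := by
      rw [hs]
      positivity
    exact_mod_cast this.trans_le hy
  obtain ⟨v₀, hv₀⟩ := Finset.card_pos.1 hpos
  rw [Finset.mem_filter] at hv₀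
  have hle : ∀ e, v₀ e ≤ q := fun e =>
    Nat.lt_succ_iff.1 (Finset.mem_range.1 (Fintype.mem_piFinset.1 hv₀.1 e))
  -- Adding the complement q - v₀ of one member of a popular fibre turns the common vertex sums into
  -- (m - 1)q, because each vertex has m - 1 edges.
  refine ⟨(s.filter fun v => f v = y).image fun v e => v e + (q - v₀ e), ?_, ?_⟩
  · intro w hw i
    obtain ⟨v, hv, rfl⟩ := Finset.mem_image.1 hw
    have h1 : f v i = f v₀ i := congrFun ((Finset.mem_filter.1 hv).2.trans hv₀.2.symm) i
    have h2 : (∑ e with i ∈ Edge.verts e, (q - v₀ e)) + f v₀ i = (m - 1) * q := by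
      simp only [f]
      rw [← Finset.sum_add_distrib, Finset.sum_congr rfl fun e _ => Nat.sub_add_cancel (hle e),
        Finset.sum_const, card_edges_at, smul_eq_mul]
    rw [Finset.sum_add_distrib]
    change f v i + _ = _
    omega
  · rw [Finset.card_image_of_injective _ fun v w h => funext fun e => by
      have h1 : v e + (q - v₀ e) = w e + (q - v₀ e) := congrFun h e
      omega]
    rw [← hs, ← ht]
    exact hy

lemma vertexProd_two_pow {m : ℕ} (v : Edge m → ℕ) (i : Fin m) :
    vertexProd (fun e => (2 : ℝ) ^ v e) i = 2 ^ ∑ e with i ∈ Edge.verts e, v e := by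
  rw [vertexProd, Finset.prod_pow_eq_pow_sum]

/-- Each weighting v gives a dyadic box 2^{v_e} ≤ d_e < 2^{v_e + 1}. The boxes are disjoint, and
each has 2^{∑ v_e} points, where 2 ∑ v_e = mq by summing over vertices. -/
lemma card_mul_le_labelCount {m : ℕ} {q : ℕ} {F : Finset (Edge m → ℕ)}
    (hF : ∀ v ∈ F, ∀ i, ∑ e with i ∈ Edge.verts e, v e = q) :
    (F.card : ℝ) * Real.sqrt (2 ^ q) ^ m ≤
      labelCount (posLabels m) ((2 : ℝ) ^ q • twoScale m) := by
  let B : (Edge m → ℕ) → Finset (Edge m → ℕ) := fun v =>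
    Fintype.piFinset fun e => Finset.Ico (2 ^ v e) (2 ^ (v e + 1))
  have hcard : ∀ v ∈ F, ((B v).card : ℝ) = Real.sqrt (2 ^ q) ^ m := by
    intro v hv
    have h1 := prod_sqrt_vertexProd (u := fun e => (2 : ℝ) ^ v e) fun e => by positivity
    simp only [vertexProd_two_pow, hF v hv, Finset.prod_const, Finset.card_univ,
      Fintype.card_fin] at h1
    rw [h1]
    simp [B, Fintype.card_piFinset, pow_succ, mul_two]
  have hmem : ∀ {v d}, d ∈ B v → ∀ e, 2 ^ v e ≤ d e ∧ d e < 2 ^ (v e + 1) := fun h e =>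
    Finset.mem_Ico.1 (Fintype.mem_piFinset.1 h e)
  have hdisj : (F : Set (Edge m → ℕ)).PairwiseDisjoint B := by
    intro v _ w _ hvw
    refine Finset.disjoint_left.2 fun d hd hd' => hvw (funext fun e => ?_)
    rw [← Nat.log_eq_of_pow_le_of_lt_pow (hmem hd e).1 (hmem hd e).2,
      Nat.log_eq_of_pow_le_of_lt_pow (hmem hd' e).1 (hmem hd' e).2]
  have hsub : ((F.biUnion B : Finset (Edge m → ℕ)) : Set (Edge m → ℕ)) ⊆
      boundedLabels (posLabels m) ((2 : ℝ) ^ q • twoScale m) := by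
    intro d hd
    obtain ⟨v, hv, hdv⟩ := Finset.mem_biUnion.1 (Finset.mem_coe.1 hd)
    refine ⟨fun e => (pow_pos two_pos _).trans_le (hmem hdv e).1, fun i => ?_⟩
    rw [cast_vertexProd]
    refine (vertexProd_mono (v := (fun e => (2 : ℝ) ^ v e) * fun _ => 2)
      (fun e => Nat.cast_nonneg _) (fun e => ?_) i).trans_eq ?_
    · have := (hmem hdv e).2.le
      rw [pow_succ] at this
      rw [Pi.mul_apply]
      exact_mod_cast this
    · rw [vertexProd_mul, vertexProd_two_pow, hF v hv]
      rfl
  have h := Set.ncard_le_ncard hsub (finite_boundedLabels le_rfl _)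
  rw [Set.ncard_coe_finset, Finset.card_biUnion hdisj] at h
  calc (F.card : ℝ) * Real.sqrt (2 ^ q) ^ m = ∑ v ∈ F, ((B v).card : ℝ) := by
        rw [Finset.sum_congr rfl hcard, Finset.sum_const, nsmul_eq_mul]
    _ ≤ _ := by
        rw [labelCount]
        exact_mod_cast h

/-- Along x = 2^{(m-1)q}, pigeonholing yields about q^{card E - m} dyadic boxes with card E the
number of edges, which matches the power of log x in the main term. -/
lemma HasDensity.labelCount_pos {m : ℕ} (hm : 4 ≤ m) {D : ℝ}
    (hD : HasDensity (labelCount (posLabels m)) D) : 0 < D := by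
  have hx : Tendsto (fun q : ℕ => (2 : ℝ) ^ ((m - 1) * q)) atTop atTop :=
    (tendsto_pow_atTop_atTop_of_one_lt one_lt_two).comp
      (tendsto_id.const_mul_atTop' (by omega))
  have hlim := (hD (twoScale m) twoScale_pos).comp hx
  have hlow : ((m : ℝ) ^ Fintype.card (Edge m))⁻¹ ≤ D * ∏ i, Real.sqrt (twoScale m i) := by
    refine ge_of_tendsto hlim ?_
    filter_upwards [eventually_ge_atTop 1] with q hq
    obtain ⟨F, hF, hcard⟩ := exists_many_regular_weights (m := m) q
    have h := card_mul_le_labelCount hF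
    have hq' : (1 : ℝ) ≤ q := by exact_mod_cast hq
    have hm' : (1 : ℝ) ≤ m := by exact_mod_cast (show 1 ≤ m by omega)
    have hm1 : ((m - 1 : ℕ) : ℝ) = m - 1 := by rw [Nat.cast_sub (by omega)]; simp
    have hlog : Real.log (2 ^ ((m - 1) * q)) = ((m : ℝ) - 1) * q * Real.log 2 := by
      rw [Real.log_pow]
      push_cast [hm1]
      ring
    have hlog2 : Real.log 2 ≤ 1 := by linarith [Real.log_two_lt_d9]
    have hx1 : (1 : ℝ) < 2 ^ ((m - 1) * q) :=
      one_lt_pow₀ one_lt_two (Nat.mul_ne_zero (by omega) (by omega))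
    have hs : 0 < Real.sqrt (2 ^ ((m - 1) * q)) ^ m := pow_pos (Real.sqrt_pos.2 (by positivity)) _
    have hlp : 0 < Real.log (2 ^ ((m - 1) * q)) := Real.log_pos hx1
    simp only [Function.comp_apply]
    rw [le_div_iff₀ (mainTerm_pos m hx1)]
    refine le_trans ?_ ((mul_le_mul_of_nonneg_right hcard hs.le).trans h)
    rw [mainTerm, mul_left_comm, mul_comm (_ / _)]
    refine mul_le_mul_of_nonneg_left ?_ hs.le
    rw [inv_mul_le_iff₀ (by positivity), mul_div_assoc', le_div_iff₀ (by rw [hm1]; positivity)]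
    -- Both log x and the base of the pigeonhole denominator are at most m(q + 1). Their exponents
    -- add up to the number of edges, which leaves the constant m^{-card E}.
    have e1 : Real.log (2 ^ ((m - 1) * q)) ≤ m * (q + 1) := by
      rw [hlog]
      calc ((m : ℝ) - 1) * q * Real.log 2 ≤ ((m : ℝ) - 1) * q * 1 :=
            mul_le_mul_of_nonneg_left hlog2 (by nlinarith)
        _ ≤ m * (q + 1) := by nlinarith
    have e2 : (((m - 1 : ℕ) : ℝ) * q + 1) ≤ m * (q + 1) := by
      rw [hm1]
      nlinarith
    calc _ ≤ (m * (q + 1) : ℝ) ^ (Fintype.card (Edge m) - m) * (m * (q + 1) : ℝ) ^ m := by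
          gcongr
      _ = _ := by
          rw [← pow_add, Nat.sub_add_cancel (le_card_edge hm), mul_pow]
  have hp : 0 < ∏ i, Real.sqrt (twoScale m i) :=
    Finset.prod_pos fun i _ => Real.sqrt_pos.2 (twoScale_pos i)
  have : 0 < D * ∏ i, Real.sqrt (twoScale m i) := lt_of_lt_of_le (by positivity) hlow
  exact pos_of_mul_pos_left this hp.le

/-! ### Sieving the labels by finitely many primes. -/

lemma vertexProd_mulSingle {m : ℕ} {R : Type*} [CommMonoid R] (e : Edge m) (a : R) (i : Fin m) :
    vertexProd (Pi.mulSingle e a) i = if i ∈ e.verts then a else 1 := by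
  rw [vertexProd, Finset.prod_pi_mulSingle']
  simp

lemma boundedLabels_image_mul {m : ℕ} (S : Set (Edge m → ℕ)) {g : Edge m → ℕ} (hg : ∀ e, 0 < g e)
    (Y : Fin m → ℝ) : boundedLabels ((g * ·) '' S) Y =
      (g * ·) '' boundedLabels S (Y / fun i => ((vertexProd g i : ℕ) : ℝ)) := by
  have hpos : ∀ i, (0 : ℝ) < (vertexProd g i : ℕ) := fun i => by
    exact_mod_cast Finset.prod_pos fun e _ => hg e
  have key : ∀ d i, ((vertexProd (g * d) i : ℕ) : ℝ) ≤ Y i ↔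
      ((vertexProd d i : ℕ) : ℝ) ≤ (Y / fun i => ((vertexProd g i : ℕ) : ℝ) : Fin m → ℝ) i := by
    intro d i
    rw [vertexProd_mul, Nat.cast_mul, Pi.div_apply, le_div_iff₀ (hpos i), mul_comm]
  ext d
  constructor
  · rintro ⟨⟨d', hd', rfl⟩, h⟩
    exact ⟨d', ⟨hd', fun i => (key d' i).1 (h i)⟩, rfl⟩
  · rintro ⟨d', hd', rfl⟩
    exact ⟨⟨d', hd'.1, rfl⟩, fun i => (key d' i).2 (hd'.2 i)⟩

lemma mul_left_injective_labels {m : ℕ} {g : Edge m → ℕ} (hg : ∀ e, 0 < g e) :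
    Function.Injective (g * · : (Edge m → ℕ) → Edge m → ℕ) := fun _ _ h =>
  funext fun e => Nat.eq_of_mul_eq_mul_left (hg e) (congrFun h e)

lemma labelCount_image_mul {m : ℕ} (S : Set (Edge m → ℕ)) {g : Edge m → ℕ} (hg : ∀ e, 0 < g e)
    (Y : Fin m → ℝ) : labelCount ((g * ·) '' S) Y =
      labelCount S (Y / fun i => ((vertexProd g i : ℕ) : ℝ)) := by
  rw [labelCount, boundedLabels_image_mul S hg,
    Set.ncard_image_of_injective _ (mul_left_injective_labels hg), labelCount]

lemma mulSingle_prime_pos {m : ℕ} (e : Edge m) (p : Nat.Primes) (e' : Edge m) :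
    0 < (Pi.mulSingle e (p : ℕ) : Edge m → ℕ) e' := by
  rw [Pi.mulSingle_apply]
  split_ifs
  exacts [p.2.pos, one_pos]

/-- The positive labellings for which `p` does not divide the label of `e` for `(p, e) ∈ Z`. -/
def awayLabels {m : ℕ} (Z : Finset (Nat.Primes × Edge m)) : Set (Edge m → ℕ) :=
  {d | d ∈ posLabels m ∧ ∀ z ∈ Z, ¬ (z.1 : ℕ) ∣ d z.2}

lemma exists_mulSingle_mul {m : ℕ} {d : Edge m → ℕ} {e : Edge m} {a : ℕ} (h : a ∣ d e) :
    ∃ d' : Edge m → ℕ, d = Pi.mulSingle e a * d' := by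
  obtain ⟨b, hb⟩ := h
  refine ⟨Function.update d e b, funext fun e' => ?_⟩
  by_cases he : e' = e
  · subst he
    simp [hb]
  · simp [Pi.mulSingle_eq_of_ne he, Function.update_of_ne he]

lemma posLabels_of_mul {m : ℕ} {g d : Edge m → ℕ} (h : g * d ∈ posLabels m) : d ∈ posLabels m :=
  fun e => Nat.pos_of_mul_pos_left (h e)

/-- Multiplying the label of e by p affects none of the other conditions: they concern another edge,
or another prime at e. So the sieve can impose one pair (prime, edge) at a time. -/
lemma awayLabels_image {m : ℕ} {Z : Finset (Nat.Primes × Edge m)} {p : Nat.Primes} {e : Edge m}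
    (hz : (p, e) ∉ Z) : {d | d ∈ awayLabels Z ∧ (p : ℕ) ∣ d e} =
      (Pi.mulSingle e (p : ℕ) * ·) '' awayLabels Z := by
  have key : ∀ (d : Edge m → ℕ), ∀ z ∈ Z, ((z.1 : ℕ) ∣ (Pi.mulSingle e (p : ℕ) * d : Edge m → ℕ) z.2 ↔
      (z.1 : ℕ) ∣ d z.2) := by
    intro d z hzZ
    rw [Pi.mul_apply]
    by_cases he : z.2 = e
    · have hne : z.1 ≠ p := fun h => hz (by rwa [← h, ← he])
      rw [he, Pi.mulSingle_eq_same]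
      exact ((Nat.coprime_primes z.1.2 p.2).2 fun h => hne (Subtype.ext h)).dvd_mul_left
    · rw [Pi.mulSingle_eq_of_ne he, one_mul]
  ext d
  constructor
  · rintro ⟨⟨hd, hdZ⟩, hp⟩
    obtain ⟨d', rfl⟩ := exists_mulSingle_mul hp
    exact ⟨d', ⟨posLabels_of_mul hd, fun z hzZ => (key d' z hzZ).not.1 (hdZ z hzZ)⟩, rfl⟩
  · rintro ⟨d', ⟨hd, hdZ⟩, rfl⟩
    refine ⟨⟨fun e' => Nat.mul_pos (mulSingle_prime_pos e p e') (hd e'),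
      fun z hzZ => (key d' z hzZ).not.2 (hdZ z hzZ)⟩, ?_⟩
    simp

lemma labelCount_awayLabels_insert {m : ℕ} {Z : Finset (Nat.Primes × Edge m)} {p : Nat.Primes}
    {e : Edge m} (hz : (p, e) ∉ Z) (Y : Fin m → ℝ) :
    labelCount (awayLabels (insert (p, e) Z)) Y = labelCount (awayLabels Z) Y -
      labelCount (awayLabels Z) (Y / vertexProd (Pi.mulSingle e ((p : ℕ) : ℝ))) := by
  have h1 := labelCount_image_mul (awayLabels Z) (mulSingle_prime_pos e p) Y
  rw [← awayLabels_image hz] at h1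
  have h2 : (fun i => ((vertexProd (Pi.mulSingle e (p : ℕ)) i : ℕ) : ℝ)) =
      vertexProd (Pi.mulSingle e ((p : ℕ) : ℝ)) := by
    funext i
    rw [vertexProd_mulSingle, vertexProd_mulSingle]
    split_ifs <;> simp
  rw [h2] at h1
  rw [← h1, eq_sub_iff_add_eq]
  unfold labelCount
  rw [← Nat.cast_add, ← Set.ncard_union_eq _
    (finite_boundedLabels (fun _ hd => hd.1) Y) (finite_boundedLabels (fun _ hd => hd.1.1) Y)]
  · congr 2
    ext d
    simp only [boundedLabels, awayLabels, Finset.forall_mem_insert, Set.mem_union,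
      Set.mem_ofPred_eq]
    tauto
  · refine Set.disjoint_left.2 fun d hd hd' => ?_
    exact hd.1.2 (p, e) (Finset.mem_insert_self _ _) hd'.1.2

lemma HasDensity.sub {m : ℕ} {G H : (Fin m → ℝ) → ℝ} {C C' : ℝ} (hG : HasDensity G C)
    (hH : HasDensity H C') : HasDensity (fun Y => G Y - H Y) (C - C') := by
  intro X hX
  refine (((hG X hX).sub (hH X hX)).congr fun x => by ring).trans_eq ?_
  rw [sub_mul]

/-- Scaling one label by p multiplies two vertex products by p, hence divides the density by √p · √p
= p; each condition thus costs a factor 1 - 1/p. -/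
lemma hasDensity_awayLabels {m : ℕ} {D : ℝ} (hD : HasDensity (labelCount (posLabels m)) D)
    (Z : Finset (Nat.Primes × Edge m)) :
    HasDensity (labelCount (awayLabels Z)) (D * ∏ z ∈ Z, (1 - 1 / ((z.1 : ℕ) : ℝ))) := by
  induction Z using Finset.induction_on with
  | empty => simpa [awayLabels] using hD
  | insert z Z hz ih =>
    obtain ⟨p, e⟩ := z
    have hpos : ∀ e', 0 ≤ (Pi.mulSingle e ((p : ℕ) : ℝ) : Edge m → ℝ) e' := fun e' => by
      rw [Pi.mulSingle_apply]
      split_ifs <;> positivity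
    have hp : (0 : ℝ) < (p : ℕ) := by exact_mod_cast p.2.pos
    have h := ih.sub (ih.comp_div (w := vertexProd (Pi.mulSingle e ((p : ℕ) : ℝ))) fun i => by
      rw [vertexProd_mulSingle]
      split_ifs <;> positivity)
    rw [prod_sqrt_vertexProd hpos, Finset.prod_pi_mulSingle', if_pos (Finset.mem_univ e)] at h
    rw [show labelCount (awayLabels (insert (p, e) Z)) = _ from
      funext fun Y => labelCount_awayLabels_insert hz Y, Finset.prod_insert hz]
    convert h using 1
    ring

/-- The positive labellings which are coprime to all primes in `Q`. -/
def coprimeLabels {m : ℕ} (Q : Finset Nat.Primes) : Set (Edge m → ℕ) :=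
  {d | d ∈ posLabels m ∧ ∀ p ∈ Q, ∀ e, ¬ (p : ℕ) ∣ d e}

lemma hasDensity_coprimeLabels {m : ℕ} {D : ℝ} (hD : HasDensity (labelCount (posLabels m)) D)
    (Q : Finset Nat.Primes) :
    HasDensity (m := m) (labelCount (coprimeLabels Q))
      (D * ∏ p ∈ Q, (1 - 1 / ((p : ℕ) : ℝ)) ^ Fintype.card (Edge m)) := by
  have h := hasDensity_awayLabels hD (Q ×ˢ Finset.univ)
  rw [Finset.prod_product] at h
  simp only [Finset.prod_const, Finset.card_univ] at h
  have h2 : (awayLabels (Q ×ˢ Finset.univ) : Set (Edge m → ℕ)) = coprimeLabels Q := by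
    ext d
    simp only [awayLabels, coprimeLabels, Finset.mem_product, Finset.mem_univ, and_true,
      Set.mem_ofPred_eq, Prod.forall]
    exact and_congr_right fun _ => ⟨fun h p hp e => h p e hp, fun h p e hp => h p hp e⟩
  rwa [h2] at h

/-! ### From labellings to squarefree tuples with square product. -/

/-- The tuples of squarefree numbers, coprime to the primes in `Q`, whose product is a square. -/
def squareTuples (m : ℕ) (Q : Finset Nat.Primes) : Set (Fin m → ℕ) :=
  {n | (∀ i, Squarefree (n i)) ∧ IsSquare (∏ i, n i) ∧ ∀ p ∈ Q, ∀ i, ¬ (p : ℕ) ∣ n i}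

/-- The elements of `squareTuples m Q` bounded by `Y`. -/
def boundedTuples {m : ℕ} (Q : Finset Nat.Primes) (Y : Fin m → ℝ) : Set (Fin m → ℕ) :=
  {n | n ∈ squareTuples m Q ∧ ∀ i, (n i : ℝ) ≤ Y i}

/-- The number of elements of `boundedTuples Q Y`. -/
noncomputable def tupleCount {m : ℕ} (Q : Finset Nat.Primes) (Y : Fin m → ℝ) : ℝ :=
  (boundedTuples Q Y).ncard

lemma finite_boundedTuples {m : ℕ} (Q : Finset Nat.Primes) (Y : Fin m → ℝ) :
    (boundedTuples Q Y).Finite :=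
  (Set.Finite.pi' fun i : Fin m => Set.finite_Iic ⌊Y i⌋₊).subset fun _ hn i => Nat.le_floor (hn.2 i)

lemma isSquare_of_mul_sq {p P : ℕ} (hp : p.Prime) (h : IsSquare (p ^ 2 * P)) : IsSquare P := by
  obtain ⟨s, hs⟩ := h
  have h1 : p ∣ s := by
    have : p ∣ s * s := hs ▸ Dvd.dvd.mul_right (dvd_pow_self p two_ne_zero) P
    exact (hp.dvd_mul.1 this).elim id id
  obtain ⟨t, rfl⟩ := h1
  refine ⟨t, Nat.eq_of_mul_eq_mul_left (pow_pos hp.pos 2) ?_⟩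
  rw [hs]
  ring

lemma exists_edge_of_ne {m : ℕ} {i j : Fin m} (h : i ≠ j) :
    ∃ e : Edge m, ∀ k, k ∈ e.verts ↔ k = i ∨ k = j := by
  rcases lt_or_gt_of_ne h with h | h
  · exact ⟨⟨(i, j), h⟩, fun k => Edge.mem_verts⟩
  · exact ⟨⟨(j, i), h⟩, fun k => Edge.mem_verts.trans or_comm⟩

lemma prod_pos_of_squarefree {m : ℕ} {n : Fin m → ℕ} (hn : ∀ i, Squarefree (n i)) :
    0 < ∏ i, n i :=
  Finset.prod_pos fun i _ => Nat.pos_of_ne_zero (hn i).ne_zero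

/-- A tuple of squarefree numbers whose product is a square comes from an edge labelling. -/
lemma exists_vertexProd_eq {m : ℕ} (N : ℕ) : ∀ n : Fin m → ℕ, ∏ i, n i = N →
    (∀ i, Squarefree (n i)) → IsSquare (∏ i, n i) →
    ∃ d ∈ posLabels m, ∀ i, vertexProd d i = n i := by
  induction N using Nat.strong_induction_on with
  | _ N ih =>
    intro n hN hsf hsq
    by_cases h1 : ∀ i, n i = 1
    · exact ⟨fun _ => 1, fun _ => one_pos, fun i => by simp [vertexProd, h1]⟩
    push Not at h1
    obtain ⟨i, hi⟩ := h1
    obtain ⟨p, hp, hpi⟩ := Nat.exists_prime_and_dvd hi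
    -- If p divided no other coordinate, the square product would force p² to divide n i, against
    -- squarefreeness. The prime can then be moved to the edge ij and the induction hypothesis
    -- applied to the quotients.
    have hj : ∃ j, j ≠ i ∧ p ∣ n j := by
      by_contra! hcon
      obtain ⟨s, hs⟩ := hsq
      have hdvd : p ∣ ∏ i, n i := hpi.trans (Finset.dvd_prod_of_mem n (Finset.mem_univ i))
      have hps : p ∣ s := by
        rw [hs] at hdvd
        exact (hp.dvd_mul.1 hdvd).elim id id
      have h2 : p * p ∣ n i * ∏ j ∈ Finset.univ.erase i, n j := by
        rw [Finset.mul_prod_erase _ _ (Finset.mem_univ i), hs]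
        exact mul_dvd_mul hps hps
      have hcop : Nat.Coprime (p * p) (∏ j ∈ Finset.univ.erase i, n j) := by
        refine Nat.Coprime.prod_right fun j hj => ?_
        have := (hp.coprime_iff_not_dvd).2 (hcon j (Finset.ne_of_mem_erase hj))
        exact Nat.Coprime.mul_left this this
      exact hp.one_lt.ne' (Nat.isUnit_iff.1 (hsf i p (hcop.dvd_of_dvd_mul_right h2)))
    obtain ⟨j, hji, hpj⟩ := hj
    obtain ⟨e, he⟩ := exists_edge_of_ne hji.symm
    have hw : ∀ k, vertexProd (Pi.mulSingle e p) k ∣ n k := fun k => by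
      rw [vertexProd_mulSingle]
      split_ifs with hk
      · rcases (he k).1 hk with rfl | rfl
        exacts [hpi, hpj]
      · exact one_dvd _
    choose n' hn' using hw
    have hprod : ∏ k, n k = p ^ 2 * ∏ k, n' k := by
      rw [Finset.prod_congr rfl fun k _ => hn' k, Finset.prod_mul_distrib, prod_vertexProd,
        Finset.prod_pi_mulSingle', if_pos (Finset.mem_univ e)]
    have hsf' : ∀ k, Squarefree (n' k) := fun k =>
      (hsf k).squarefree_of_dvd (hn' k ▸ dvd_mul_left _ _)
    have hpos := prod_pos_of_squarefree hsf'
    obtain ⟨d, hd, hdn⟩ := ih (∏ k, n' k) (by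
      rw [← hN, hprod]
      exact lt_mul_of_one_lt_left hpos (Nat.one_lt_pow two_ne_zero hp.one_lt)) n' rfl hsf'
      (isSquare_of_mul_sq hp (hprod ▸ hsq))
    refine ⟨Pi.mulSingle e p * d, fun e' => Nat.mul_pos
      (mulSingle_prime_pos e ⟨p, hp⟩ e') (hd e'), fun k => ?_⟩
    rw [vertexProd_mul, hdn, ← hn']

lemma dvd_vertexProd {m : ℕ} {d : Edge m → ℕ} {e : Edge m} {i : Fin m} (hi : i ∈ e.verts) :
    d e ∣ vertexProd d i :=
  Finset.dvd_prod_of_mem d (by simpa using hi)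

lemma tupleCount_le_labelCount {m : ℕ} (Q : Finset Nat.Primes) (Y : Fin m → ℝ) :
    tupleCount Q Y ≤ labelCount (coprimeLabels Q) Y := by
  have hfin := finite_boundedLabels (S := coprimeLabels (m := m) Q) (fun _ hd => hd.1) Y
  have hsub : boundedTuples Q Y ⊆ (fun d => vertexProd d) '' boundedLabels (coprimeLabels Q) Y := by
    intro n hn
    obtain ⟨d, hd, hdn⟩ := exists_vertexProd_eq _ n rfl hn.1.1 hn.1.2.1
    refine ⟨d, ⟨⟨hd, fun p hp e he => ?_⟩, fun i => by rw [hdn]; exact hn.2 i⟩, funext hdn⟩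
    refine hn.1.2.2 p hp e.1.1 (he.trans ?_)
    rw [← hdn]
    exact dvd_vertexProd (Edge.mem_verts.2 (Or.inl rfl))
  rw [tupleCount, labelCount]
  exact_mod_cast (Set.ncard_le_ncard hsub (hfin.image _)).trans (Set.ncard_image_le hfin)

/-- The labels are pairwise coprime, and e is the only edge containing both of its endpoints, so no
other label contributes to the gcd. -/
lemma gcd_vertexProd {m : ℕ} {d : Edge m → ℕ} (hd : Squarefree (∏ e, d e)) (e : Edge m) :
    Nat.gcd (vertexProd d e.1.1) (vertexProd d e.1.2) = d e := by
  have hcop : ∀ a b : Edge m, a ≠ b → Nat.Coprime (d a) (d b) := by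
    intro a b hab
    refine Nat.coprime_of_squarefree_mul (hd.squarefree_of_dvd ?_)
    rw [← Finset.prod_pair hab]
    exact Finset.prod_dvd_prod_of_subset _ _ _ (Finset.subset_univ _)
  have hmem : ∀ i, i ∈ e.verts → e ∈ Finset.univ.filter fun e : Edge m => i ∈ e.verts :=
    fun i hi => by simpa using hi
  rw [vertexProd, vertexProd,
    ← Finset.mul_prod_erase _ _ (hmem _ (Edge.mem_verts.2 (Or.inl rfl))),
    ← Finset.mul_prod_erase _ _ (hmem _ (Edge.mem_verts.2 (Or.inr rfl))), Nat.gcd_mul_left]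
  have : Nat.Coprime (∏ a ∈ (Finset.univ.filter fun a : Edge m => e.1.1 ∈ a.verts).erase e, d a)
      (∏ a ∈ (Finset.univ.filter fun a : Edge m => e.1.2 ∈ a.verts).erase e, d a) := by
    refine Nat.Coprime.prod_left fun a ha => Nat.Coprime.prod_right fun b hb => hcop a b ?_
    rintro rfl
    simp only [Finset.mem_erase, Finset.mem_filter, Finset.mem_univ, true_and,
      Edge.mem_verts] at ha hb
    refine ha.1 (Subtype.ext (Prod.ext ?_ ?_))
    all_goals
      have h1 := a.2
      have h2 := e.2
      rcases ha.2 with h | h <;> rcases hb.2 with h' | h' <;> rw [Fin.lt_def] at h1 h2 <;>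
        rw [Fin.ext_iff] at h h' ⊢ <;> omega
  rw [Nat.coprime_iff_gcd_eq_one.1 this, mul_one]

lemma vertexProd_mem_squareTuples {m : ℕ} {Q : Finset Nat.Primes} {d : Edge m → ℕ}
    (hd : d ∈ coprimeLabels Q) (hsf : Squarefree (∏ e, d e)) :
    vertexProd d ∈ squareTuples m Q := by
  refine ⟨fun i => hsf.squarefree_of_dvd
    (Finset.prod_dvd_prod_of_subset _ _ _ (Finset.subset_univ _)), ?_, fun p hp i hpi => ?_⟩
  · rw [prod_vertexProd]
    exact ⟨_, sq _⟩
  · obtain ⟨e, -, he⟩ := (p.2.prime.dvd_finsetProd_iff _).1 hpi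
    exact hd.2 p hp e he

lemma labelCount_squarefree_le {m : ℕ} (Q : Finset Nat.Primes) (Y : Fin m → ℝ) :
    labelCount {d | d ∈ coprimeLabels Q ∧ Squarefree (∏ e, d e)} Y ≤ tupleCount Q Y := by
  rw [tupleCount, labelCount]
  refine Nat.cast_le.2 (Set.ncard_le_ncard_of_injOn vertexProd (fun d hd =>
    ⟨vertexProd_mem_squareTuples hd.1.1 hd.1.2, hd.2⟩) (fun d hd d' hd' h => ?_)
    (finite_boundedTuples Q Y))
  funext e
  rw [← gcd_vertexProd hd.1.2 e, h, gcd_vertexProd hd'.1.2 e]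

/-- The edge labelling which multiplies the labels of `e` and `e'` by `a`. -/
def pairLabel {m : ℕ} (a : ℕ) (e e' : Edge m) : Edge m → ℕ :=
  Pi.mulSingle e a * Pi.mulSingle e' a

lemma exists_pairLabel_of_not_squarefree {m : ℕ} {d : Edge m → ℕ}
    (h : ¬ Squarefree (∏ e, d e)) : ∃ p : Nat.Primes, ∃ e e' : Edge m, ∃ d',
      d = pairLabel p e e' * d' := by
  rw [Nat.squarefree_iff_prime_squarefree] at h
  push Not at h
  obtain ⟨p, hp, hpd⟩ := h
  obtain ⟨e, -, he⟩ := (hp.prime.dvd_finsetProd_iff _).1 (dvd_of_mul_left_dvd hpd)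
  obtain ⟨d₁, rfl⟩ := exists_mulSingle_mul he
  have h2 : ∏ e', (Pi.mulSingle e p * d₁ : Edge m → ℕ) e' = p * ∏ e', d₁ e' := by
    simp only [Pi.mul_apply]
    rw [Finset.prod_mul_distrib, Finset.prod_pi_mulSingle', if_pos (Finset.mem_univ e)]
  rw [h2] at hpd
  obtain ⟨e', -, he'⟩ :=
    (hp.prime.dvd_finsetProd_iff _).1 ((Nat.mul_dvd_mul_iff_left hp.pos).1 hpd)
  obtain ⟨d₂, rfl⟩ := exists_mulSingle_mul he'
  exact ⟨⟨p, hp⟩, e, e', d₂, by rw [pairLabel, mul_assoc]⟩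

/-- A labelling whose total product is not squarefree has a prime p occurring in two labels, or
twice in one, and p ∉ Q by coprimality. Removing both occurrences leaves a labelling coprime to Q
with smaller bounds. Only finitely many primes can occur below Y. -/
lemma labelCount_le_tupleCount_add {m : ℕ} (Q : Finset Nat.Primes) (Y : Fin m → ℝ) :
    ∃ P : Finset Nat.Primes, labelCount (coprimeLabels Q) Y ≤ tupleCount Q Y +
      ∑ p ∈ P, ∑ q : Edge m × Edge m, if p ∈ Q then 0 else labelCount (coprimeLabels Q)
        (Y / fun i => ((vertexProd (pairLabel p q.1 q.2) i : ℕ) : ℝ)) := by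
  classical
  have hfin := finite_boundedLabels (S := coprimeLabels (m := m) Q) (fun _ hd => hd.1) Y
  have hPfin : {p : Nat.Primes | ∃ d ∈ boundedLabels (coprimeLabels Q) Y, ∃ e : Edge m,
      (p : ℕ) ∣ d e}.Finite := by
    have : ∀ d ∈ boundedLabels (coprimeLabels Q) Y, {p : Nat.Primes | ∃ e : Edge m,
        (p : ℕ) ∣ d e}.Finite := by
      intro d hd
      refine Set.Finite.subset (Set.finite_iUnion fun e : Edge m =>
        (Set.finite_Iic (d e)).preimage (Nat.Primes.coe_nat_injective.injOn)) fun p hp => ?_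
      obtain ⟨e, he⟩ := hp
      exact Set.mem_iUnion.2 ⟨e, Nat.le_of_dvd (hd.1.1 e) he⟩
    refine (hfin.biUnion this).subset fun p hp => ?_
    obtain ⟨d, hd, h⟩ := hp
    exact Set.mem_biUnion hd h
  refine ⟨hPfin.toFinset, ?_⟩
  set P := hPfin.toFinset
  let I : Finset (Nat.Primes × (Edge m × Edge m)) := (P.filter (· ∉ Q)) ×ˢ Finset.univ
  have hpp : ∀ (p : Nat.Primes) (q : Edge m × Edge m) e, 0 < pairLabel (p : ℕ) q.1 q.2 e :=
    fun p q e => Nat.mul_pos (mulSingle_prime_pos _ _ _) (mulSingle_prime_pos _ _ _)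
  have hsub : boundedLabels (coprimeLabels Q) Y ⊆
      boundedLabels {d | d ∈ coprimeLabels Q ∧ Squarefree (∏ e, d e)} Y ∪
      ⋃ z ∈ I, boundedLabels ((pairLabel (z.1 : ℕ) z.2.1 z.2.2 * ·) '' coprimeLabels Q) Y := by
    intro d hd
    by_cases hsf : Squarefree (∏ e, d e)
    · exact Or.inl ⟨⟨hd.1, hsf⟩, hd.2⟩
    obtain ⟨p, e, e', d', rfl⟩ := exists_pairLabel_of_not_squarefree hsf
    refine Or.inr ?_
    have hpe : (p : ℕ) ∣ (pairLabel (p : ℕ) e e' * d' : Edge m → ℕ) e := by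
      simp only [pairLabel, Pi.mul_apply, Pi.mulSingle_eq_same, mul_assoc]
      exact dvd_mul_right _ _
    have hpQ : p ∉ Q := fun hp => hd.1.2 p hp e hpe
    simp only [Set.mem_iUnion]
    refine ⟨(p, e, e'), ?_, ⟨d', ⟨posLabels_of_mul hd.1.1, fun p' hp' e'' he'' =>
      hd.1.2 p' hp' e'' (Dvd.dvd.mul_left he'' _)⟩, rfl⟩, hd.2⟩
    simp only [I, Finset.mem_product, Finset.mem_filter, Finset.mem_univ, and_true]
    exact ⟨hPfin.mem_toFinset.2 ⟨_, hd, e, hpe⟩, hpQ⟩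
  have himg : ∀ z : Nat.Primes × (Edge m × Edge m),
      ((pairLabel (z.1 : ℕ) z.2.1 z.2.2 * ·) '' coprimeLabels Q) ⊆ posLabels m := by
    rintro z _ ⟨d, hd, rfl⟩ e
    exact Nat.mul_pos (hpp z.1 z.2 e) (hd.1 e)
  have hf1 := finite_boundedLabels (S := {d : Edge m → ℕ | d ∈ coprimeLabels Q ∧
    Squarefree (∏ e, d e)}) (fun _ hd => hd.1.1) Y
  have hf2 := Set.Finite.biUnion (Finset.finite_toSet I) fun z _ =>
    finite_boundedLabels (himg z) Y
  have h := (Set.ncard_le_ncard hsub (hf1.union hf2)).trans (Set.ncard_union_le _ _)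
  have h2 := h.trans (Nat.add_le_add_left (Finset.set_ncard_biUnion_le I _) _)
  have h3 : labelCount (coprimeLabels Q) Y ≤
      labelCount {d | d ∈ coprimeLabels Q ∧ Squarefree (∏ e, d e)} Y +
      ∑ z ∈ I, labelCount ((pairLabel (z.1 : ℕ) z.2.1 z.2.2 * ·) '' coprimeLabels Q) Y := by
    unfold labelCount
    exact_mod_cast h2
  refine h3.trans (add_le_add (labelCount_squarefree_le Q Y) (le_of_eq ?_))
  rw [Finset.sum_product, Finset.sum_filter]
  refine Finset.sum_congr rfl fun p _ => ?_
  by_cases hp : p ∈ Q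
  · simp [hp]
  · simp only [hp, not_false_eq_true, if_true, if_false]
    exact Finset.sum_congr rfl fun q _ => labelCount_image_mul _ (hpp p q) Y

/-! ### Restoring the primes of Q, and the limit in Q. -/

/-- The tuple which is `a` on `S` and `1` elsewhere. -/
def onSet {m : ℕ} {R : Type*} [One R] (a : R) (S : Finset (Fin m)) (i : Fin m) : R :=
  if i ∈ S then a else 1

lemma prod_onSet {m : ℕ} {R : Type*} [CommMonoid R] (a : R) (S : Finset (Fin m)) :
    ∏ i, onSet a S i = a ^ S.card := by
  simp [onSet]

lemma isSquare_pow_mul {p : ℕ} (hp : p.Prime) {a P : ℕ} (hP : ¬ p ∣ P)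
    (h : IsSquare (p ^ a * P)) : Even a ∧ IsSquare P := by
  induction a using Nat.strong_induction_on with
  | _ a ih =>
    match a, ih, h with
    | 0, _, h => exact ⟨Even.zero, by simpa using h⟩
    | 1, _, h =>
      obtain ⟨s, hs⟩ := h
      have hps : p ∣ s := by
        have : p ∣ s * s := hs ▸ Dvd.dvd.mul_right (dvd_pow_self p one_ne_zero) P
        exact (hp.dvd_mul.1 this).elim id id
      refine absurd ?_ hP
      rw [← Nat.mul_dvd_mul_iff_left hp.pos, ← pow_one p, hs, pow_one]
      exact mul_dvd_mul hps hps
    | a + 2, ih, h =>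
      have h2 := ih a (by omega) (isSquare_of_mul_sq hp (by
        rwa [← mul_assoc, ← pow_add, add_comm]))
      exact ⟨h2.1.add even_two, h2.2⟩

lemma squarefree_prime_mul {p a : ℕ} (hp : p.Prime) (hpa : ¬ p ∣ a) (ha : Squarefree a) :
    Squarefree (p * a) :=
  (Nat.squarefree_mul ((hp.coprime_iff_not_dvd).2 hpa)).2 ⟨hp.prime.squarefree, ha⟩

/-- Squarefreeness puts p exactly once into the coordinates of S, so the exponent of p in the
product is |S|, which must be even; dividing p out leaves a tuple prime to p. -/
lemma boundedTuples_fiber {m : ℕ} {Q : Finset Nat.Primes} {p : Nat.Primes} (hp : p ∉ Q)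
    (S : Finset (Fin m)) (Y : Fin m → ℝ) :
    {n | n ∈ boundedTuples Q Y ∧ (Finset.univ.filter fun i => (p : ℕ) ∣ n i) = S} =
      if Even S.card then (onSet (p : ℕ) S * ·) '' boundedTuples (insert p Q)
        (Y / onSet ((p : ℕ) : ℝ) S) else ∅ := by
  have hp0 : (0 : ℝ) < (p : ℕ) := by exact_mod_cast p.2.pos
  have hpos : ∀ i, (0 : ℝ) < onSet ((p : ℕ) : ℝ) S i := fun i => by
    unfold onSet
    split_ifs <;> positivity
  have hcast : ∀ i, ((onSet (p : ℕ) S i : ℕ) : ℝ) = onSet ((p : ℕ) : ℝ) S i := fun i => by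
    unfold onSet
    split_ifs <;> simp
  have hle : ∀ (n : Fin m → ℕ) i, (((onSet (p : ℕ) S * n) i : ℕ) : ℝ) ≤ Y i ↔
      (n i : ℝ) ≤ (Y / onSet ((p : ℕ) : ℝ) S : Fin m → ℝ) i := fun n i => by
    rw [Pi.mul_apply, Nat.cast_mul, hcast, Pi.div_apply, le_div_iff₀ (hpos i), mul_comm]
  have hforward : ∀ n, n ∈ boundedTuples Q Y →
      (Finset.univ.filter fun i => (p : ℕ) ∣ n i) = S → Even S.card ∧
      n ∈ (onSet (p : ℕ) S * ·) '' boundedTuples (insert p Q) (Y / onSet ((p : ℕ) : ℝ) S) := by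
    rintro n ⟨⟨hsf, hsq, hQ⟩, hY⟩ hS
    have hmem : ∀ i, i ∈ S ↔ (p : ℕ) ∣ n i := fun i => by rw [← hS]; simp
    have hdvd : ∀ i, onSet (p : ℕ) S i ∣ n i := fun i => by
      unfold onSet
      split_ifs with hi
      exacts [(hmem i).1 hi, one_dvd _]
    choose n' hn' using hdvd
    have hnn : n = onSet (p : ℕ) S * n' := funext hn'
    have hpn' : ∀ i, ¬ (p : ℕ) ∣ n' i := by
      intro i hi
      by_cases hiS : i ∈ S
      · have h1 : (p : ℕ) * p ∣ n i := by
          rw [hn' i, onSet, if_pos hiS]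
          exact mul_dvd_mul_left _ hi
        exact p.2.one_lt.ne' (Nat.isUnit_iff.1 (hsf i p h1))
      · exact hiS ((hmem i).2 (hn' i ▸ Dvd.dvd.mul_left hi _))
    have hprod : ∏ i, n i = (p : ℕ) ^ S.card * ∏ i, n' i := by
      rw [Finset.prod_congr rfl fun i _ => hn' i, Finset.prod_mul_distrib, prod_onSet]
    have hnd : ¬ (p : ℕ) ∣ ∏ i, n' i := fun h => by
      obtain ⟨i, -, hi⟩ := (p.2.prime.dvd_finsetProd_iff _).1 h
      exact hpn' i hi
    obtain ⟨he, hsq'⟩ := isSquare_pow_mul p.2 hnd (hprod ▸ hsq)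
    refine ⟨he, n', ⟨⟨fun i => (hsf i).squarefree_of_dvd (hn' i ▸ dvd_mul_left _ _), hsq',
      fun q hq i hqi => ?_⟩, fun i => (hle n' i).1 (hnn ▸ hY i)⟩, hnn.symm⟩
    rcases Finset.mem_insert.1 hq with rfl | hq
    · exact hpn' i hqi
    · exact hQ q hq i (hn' i ▸ Dvd.dvd.mul_left hqi _)
  ext n
  split_ifs with hev
  · refine ⟨fun h => (hforward n h.1 h.2).2, ?_⟩
    rintro ⟨n', ⟨⟨hsf, hsq, hQ⟩, hY⟩, rfl⟩
    have hpn' : ∀ i, ¬ (p : ℕ) ∣ n' i := fun i => hQ p (Finset.mem_insert_self _ _) i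
    refine ⟨⟨⟨fun i => ?_, ?_, fun q hq i hqi => ?_⟩, fun i => (hle n' i).2 (hY i)⟩, ?_⟩
    · simp only [Pi.mul_apply, onSet]
      split_ifs
      · exact squarefree_prime_mul p.2 (hpn' i) (hsf i)
      · simpa using hsf i
    · simp only [Pi.mul_apply]
      rw [Finset.prod_mul_distrib, prod_onSet]
      exact (hev.isSquare_pow _).mul hsq
    · refine hQ q (Finset.mem_insert_of_mem hq) i ?_
      refine Nat.Coprime.dvd_of_dvd_mul_left (m := onSet (p : ℕ) S i) ?_ hqi
      unfold onSet
      split_ifs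
      · exact (Nat.coprime_primes q.2 p.2).2 fun h => hp (Subtype.ext h ▸ hq)
      · exact Nat.coprime_one_right _
    · ext i
      rw [Finset.mem_filter_univ]
      simp only [Pi.mul_apply, onSet]
      split_ifs with hi
      · simp [hi]
      · simp [hi, hpn' i]
  · refine ⟨fun h => absurd (hforward n h.1 h.2).1 hev, fun h => absurd h (Set.notMem_empty n)⟩

lemma tupleCount_eq_sum {m : ℕ} {Q : Finset Nat.Primes} {p : Nat.Primes} (hp : p ∉ Q)
    (Y : Fin m → ℝ) : tupleCount Q Y = ∑ S : Finset (Fin m) with Even S.card,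
      tupleCount (insert p Q) (Y / onSet ((p : ℕ) : ℝ) S) := by
  classical
  have hfin := finite_boundedTuples Q Y
  have h1 := Finset.card_eq_sum_card_fiberwise (s := hfin.toFinset)
    (t := (Finset.univ : Finset (Finset (Fin m))))
    (f := fun n => Finset.univ.filter fun i => (p : ℕ) ∣ n i) fun _ _ => Finset.mem_coe.2 (Finset.mem_univ _)
  have h2 : ∀ S : Finset (Fin m), (((hfin.toFinset.filter fun n =>
      (Finset.univ.filter fun i => (p : ℕ) ∣ n i) = S).card : ℕ) : ℝ) =
      if Even S.card then tupleCount (insert p Q) (Y / onSet ((p : ℕ) : ℝ) S) else 0 := by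
    intro S
    rw [← Set.ncard_coe_finset]
    have : ((hfin.toFinset.filter fun n => (Finset.univ.filter fun i => (p : ℕ) ∣ n i) = S :
        Finset (Fin m → ℕ)) : Set (Fin m → ℕ)) =
        {n | n ∈ boundedTuples Q Y ∧ (Finset.univ.filter fun i => (p : ℕ) ∣ n i) = S} := by
      ext n
      simp
    rw [this, boundedTuples_fiber hp]
    split_ifs
    · rw [Set.ncard_image_of_injective, tupleCount]
      intro a b hab
      funext i
      refine Nat.eq_of_mul_eq_mul_left ?_ (congrFun hab i)
      unfold onSet
      split_ifs
      exacts [p.2.pos, one_pos]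
    · simp
  rw [tupleCount, Set.ncard_eq_toFinset_card _ hfin, h1, Nat.cast_sum, Finset.sum_filter]
  exact Finset.sum_congr rfl fun S _ => h2 S

/-- `G (x X)` is eventually at most `(C ∏ √X_i + ε) * mainTerm m x`. -/
def HasUpperDensity {m : ℕ} (G : (Fin m → ℝ) → ℝ) (C : ℝ) : Prop :=
  ∀ X : Fin m → ℝ, (∀ i, 0 < X i) → ∀ ε > 0, ∀ᶠ x : ℝ in atTop,
    G (x • X) / mainTerm m x ≤ C * ∏ i, Real.sqrt (X i) + ε

lemma HasUpperDensity.comp_div {m : ℕ} {G : (Fin m → ℝ) → ℝ} {C : ℝ} (hG : HasUpperDensity G C)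
    {w : Fin m → ℝ} (hw : ∀ i, 0 < w i) :
    HasUpperDensity (fun Y => G (Y / w)) (C / ∏ i, Real.sqrt (w i)) := by
  intro X hX ε hε
  filter_upwards [hG (X / w) (fun i => div_pos (hX i) (hw i)) ε hε] with x hx
  have h1 : x • (X / w) = x • X / w := by
    funext i
    simp [mul_div_assoc]
  rw [h1] at hx
  refine hx.trans_eq ?_
  simp only [Pi.div_apply, Real.sqrt_div (hX _).le, Finset.prod_div_distrib]
  ring

lemma HasUpperDensity.sum {m : ℕ} {ι : Type*} (s : Finset ι) {G : ι → (Fin m → ℝ) → ℝ}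
    {C : ι → ℝ} (hG : ∀ a ∈ s, HasUpperDensity (G a) (C a)) :
    HasUpperDensity (fun Y => ∑ a ∈ s, G a Y) (∑ a ∈ s, C a) := by
  intro X hX ε hε
  -- The added 1 keeps the denominator positive when s is empty.
  have h := (Finset.eventually_all s).2 fun a ha =>
    hG a ha X hX (ε / (s.card + 1)) (by positivity)
  filter_upwards [h] with x hx
  rw [Finset.sum_div, Finset.sum_mul]
  refine (Finset.sum_le_sum hx).trans ?_
  rw [Finset.sum_add_distrib, Finset.sum_const, nsmul_eq_mul]
  gcongr
  rw [mul_div_assoc', div_le_iff₀ (by positivity)]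
  nlinarith

/-- The sum of `p ^ (-|S|/2)` over the subsets `S` of `Fin m` of even cardinality. -/
noncomputable def evenSum (m : ℕ) (p : Nat.Primes) : ℝ :=
  ∑ S : Finset (Fin m) with Even S.card, 1 / Real.sqrt (p : ℕ) ^ S.card

lemma prod_sqrt_onSet {m : ℕ} (a : ℝ) (S : Finset (Fin m)) :
    ∏ i, Real.sqrt (onSet a S i) = Real.sqrt a ^ S.card := by
  rw [← prod_onSet]
  refine Finset.prod_congr rfl fun i _ => ?_
  unfold onSet
  split_ifs <;> simp

/-- The sign σ = ±1 lets a single one-sided statement serve for upper and lower bounds alike. -/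
lemma HasUpperDensity.tupleCount_empty {m : ℕ} (σ : ℝ) (Q : Finset Nat.Primes) :
    ∀ C : ℝ, HasUpperDensity (m := m) (fun Y => σ * tupleCount Q Y) C →
      HasUpperDensity (m := m) (fun Y => σ * tupleCount ∅ Y) (C * ∏ p ∈ Q, evenSum m p) := by
  induction Q using Finset.induction_on with
  | empty => intro C h; simpa using h
  | insert p Q hp ih =>
    intro C h
    have h1 : HasUpperDensity (m := m) (fun Y => σ * tupleCount Q Y) (C * evenSum m p) := by
      have hp0 : (0 : ℝ) < (p : ℕ) := by exact_mod_cast p.2.pos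
      have := HasUpperDensity.sum (Finset.univ.filter fun S : Finset (Fin m) => Even S.card)
        fun S _ => h.comp_div (w := onSet ((p : ℕ) : ℝ) S) fun i => by
          unfold onSet
          split_ifs <;> positivity
      simp only [prod_sqrt_onSet, ← Finset.mul_sum] at this
      simp_rw [← tupleCount_eq_sum hp] at this
      convert this using 1
      rw [evenSum, Finset.mul_sum]
      exact Finset.sum_congr rfl fun S _ => by ring
    have h2 := ih _ h1
    rw [Finset.prod_insert hp]
    convert h2 using 1
    ring

lemma summable_one_div_prime_sq : Summable fun p : Nat.Primes => 1 / ((p : ℕ) : ℝ) ^ 2 :=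
  (Real.summable_one_div_nat_pow.2 one_lt_two).comp_injective Nat.Primes.coe_nat_injective

lemma HasDensity.hasUpperDensity {m : ℕ} {G : (Fin m → ℝ) → ℝ} {C : ℝ} (hG : HasDensity G C) :
    HasUpperDensity G C := fun X hX _ hε =>
  ((hG X hX).eventually_lt_const (lt_add_of_pos_right _ hε)).mono fun _ h => h.le

lemma prod_pairLabel {m : ℕ} (a : ℕ) (e e' : Edge m) : ∏ f, pairLabel a e e' f = a ^ 2 := by
  simp only [pairLabel, Pi.mul_apply]
  rw [Finset.prod_mul_distrib, Finset.prod_pi_mulSingle', Finset.prod_pi_mulSingle',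
    if_pos (Finset.mem_univ e), if_pos (Finset.mem_univ e'), sq]

/-- The sum of `1 / p ^ 2` over the primes outside `Q`. -/
noncomputable def primeTail (Q : Finset Nat.Primes) : ℝ :=
  ∑' p : Nat.Primes, if p ∈ Q then 0 else 1 / ((p : ℕ) : ℝ) ^ 2

lemma hasUpperDensity_tupleCount {m : ℕ} {Q : Finset Nat.Primes} {C : ℝ}
    (hC : HasDensity (m := m) (labelCount (coprimeLabels Q)) C) :
    HasUpperDensity (m := m) (tupleCount Q) C := by
  intro X hX ε hε
  filter_upwards [hC.hasUpperDensity X hX ε hε, eventually_gt_atTop 1] with x hx hx1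
  exact (div_le_div_of_nonneg_right (tupleCount_le_labelCount _ _) (mainTerm_pos m hx1).le).trans hx

/-- The overcount is summed over primes by dominated convergence: the uniform bound for `labelCount`
only supplies the majorant B/p², while the limit of each term is C/p². So the loss is proportional
to C itself, which is essential because C tends to 0 as Q grows. -/
lemma hasUpperDensity_neg_tupleCount {m : ℕ} (hm : 4 ≤ m) {Q : Finset Nat.Primes} {C : ℝ}
    (hC : HasDensity (m := m) (labelCount (coprimeLabels Q)) C) :
    HasUpperDensity (m := m) (fun Y => -tupleCount Q Y)
      (-(C * (1 - Fintype.card (Edge m × Edge m) * primeTail Q))) := by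
  intro X hX ε hε
  obtain ⟨B, -, hB⟩ := exists_labelCount_le hm
  let W : Nat.Primes → Edge m × Edge m → Fin m → ℝ := fun p q i =>
    ((vertexProd (pairLabel p q.1 q.2) i : ℕ) : ℝ)
  have hpp : ∀ (p : Nat.Primes) (q : Edge m × Edge m) e, 0 < pairLabel (p : ℕ) q.1 q.2 e :=
    fun p q e => Nat.mul_pos (mulSingle_prime_pos _ _ _) (mulSingle_prime_pos _ _ _)
  have hW1 : ∀ p q i, 1 ≤ W p q i := fun p q i => by
    have : 0 < vertexProd (pairLabel (p : ℕ) q.1 q.2) i := Finset.prod_pos fun e _ => hpp p q e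
    exact Nat.one_le_cast.2 this
  have hWp : ∀ p q, ∏ i, Real.sqrt (W p q i) = ((p : ℕ) : ℝ) ^ 2 := fun p q => by
    simp only [W, cast_vertexProd]
    rw [prod_sqrt_vertexProd fun e => Nat.cast_nonneg _]
    exact_mod_cast prod_pairLabel (p : ℕ) q.1 q.2
  let f : ℝ → Nat.Primes → ℝ := fun x p => ∑ q : Edge m × Edge m,
    if p ∈ Q then 0 else labelCount (coprimeLabels Q) (x • X / W p q) / mainTerm m x
  have hbound : ∀ᶠ x : ℝ in atTop, ∀ p, ‖f x p‖ ≤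
      (Fintype.card (Edge m × Edge m) * (B * ∏ i, Real.sqrt (X i))) * (1 / ((p : ℕ) : ℝ) ^ 2) := by
    filter_upwards [hB X hX, eventually_gt_atTop 1] with x hx hx1 p
    have hm0 := mainTerm_pos m hx1
    rw [← Finset.card_univ, mul_assoc, ← nsmul_eq_mul]
    refine norm_sum_le_of_le _ (fun q _ => ?_) |>.trans_eq (Finset.sum_const _)
    have h1 := hx (W p q) (hW1 p q)
    rw [hWp] at h1
    have h2 : 0 ≤ labelCount (posLabels m) (x • X / W p q) / mainTerm m x :=
      div_nonneg (labelCount_nonneg _ _) hm0.le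
    split_ifs
    · rw [norm_zero, mul_one_div]
      exact h2.trans h1
    · rw [Real.norm_of_nonneg (div_nonneg (labelCount_nonneg _ _) hm0.le), mul_one_div]
      exact (div_le_div_of_nonneg_right (labelCount_mono (fun _ hd => hd.1) le_rfl _)
        hm0.le).trans h1
  have hlim : ∀ p, Tendsto (fun x => f x p) atTop (nhds (∑ _q : Edge m × Edge m,
      if p ∈ Q then 0 else C / ((p : ℕ) : ℝ) ^ 2 * ∏ i, Real.sqrt (X i))) := by
    intro p
    refine tendsto_finsetSum _ fun q _ => ?_
    by_cases hp : p ∈ Q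
    · simp [hp]
    · simp only [hp, if_false]
      have := hC.comp_div (w := W p q) (fun i => zero_lt_one.trans_le (hW1 p q i)) X hX
      rwa [hWp] at this
  have hsum := (summable_one_div_prime_sq.mul_left
    (Fintype.card (Edge m × Edge m) * (B * ∏ i, Real.sqrt (X i))))
  have htan := tendsto_tsum_of_dominated_convergence hsum hlim hbound
  have hval : ∑' p : Nat.Primes, ∑ _q : Edge m × Edge m,
      (if p ∈ Q then 0 else C / ((p : ℕ) : ℝ) ^ 2 * ∏ i, Real.sqrt (X i)) =
      Fintype.card (Edge m × Edge m) * C * (∏ i, Real.sqrt (X i)) * primeTail Q := by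
    rw [primeTail, ← tsum_mul_left]
    refine tsum_congr fun p => ?_
    rw [Finset.sum_const, Finset.card_univ, nsmul_eq_mul]
    split_ifs <;> ring
  rw [hval] at htan
  have hfin := htan.sub (hC X hX)
  have hlt : ∀ᶠ x : ℝ in atTop, ∑' p, f x p -
      labelCount (coprimeLabels Q) (x • X) / mainTerm m x ≤
      -(C * (1 - Fintype.card (Edge m × Edge m) * primeTail Q)) * ∏ i, Real.sqrt (X i) + ε := by
    refine (hfin.eventually_lt_const (u := -(C * (1 - Fintype.card (Edge m × Edge m) *
      primeTail Q)) * ∏ i, Real.sqrt (X i) + ε) ?_).mono fun _ h => h.le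
    nlinarith
  filter_upwards [hlt, hbound, eventually_gt_atTop 1] with x hx hbx hx1
  have hm0 := mainTerm_pos m hx1
  refine le_trans ?_ hx
  obtain ⟨P, hP⟩ := labelCount_le_tupleCount_add Q (x • X)
  -- The finite set P depends on x, so its sum is replaced by the full series before x tends to
  -- infinity.
  have hfx : ∑ p ∈ P, f x p ≤ ∑' p, f x p := by
    refine Summable.sum_le_tsum P (fun p _ => Finset.sum_nonneg fun q _ => ?_)
      (Summable.of_norm_bounded hsum hbx)
    split_ifs
    exacts [le_rfl, div_nonneg (labelCount_nonneg _ _) hm0.le]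
  have hPf : (∑ p ∈ P, ∑ q : Edge m × Edge m, if p ∈ Q then 0 else labelCount (coprimeLabels Q)
        (x • X / W p q)) / mainTerm m x = ∑ p ∈ P, f x p := by
    simp only [f, Finset.sum_div]
    refine Finset.sum_congr rfl fun p _ => Finset.sum_congr rfl fun q _ => ?_
    split_ifs
    exacts [zero_div _, rfl]
  have h1 := div_le_div_of_nonneg_right hP hm0.le
  rw [add_div] at h1
  have h2 : -tupleCount Q (x • X) / mainTerm m x = -(tupleCount Q (x • X) / mainTerm m x) :=
    neg_div _ _
  rw [h2]
  have h3 : labelCount (coprimeLabels Q) (x • X) / mainTerm m x ≤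
      tupleCount Q (x • X) / mainTerm m x + ∑ p ∈ P, f x p := by
    rw [← hPf]
    exact h1
  linarith

lemma tendsto_primeTail : Tendsto primeTail atTop (nhds 0) := by
  have hs := summable_one_div_prime_sq
  have h : ∀ Q : Finset Nat.Primes, primeTail Q =
      (∑' p : Nat.Primes, 1 / ((p : ℕ) : ℝ) ^ 2) - ∑ p ∈ Q, 1 / ((p : ℕ) : ℝ) ^ 2 := by
    intro Q
    have h1 : ∀ p : Nat.Primes, (if p ∈ Q then 0 else 1 / ((p : ℕ) : ℝ) ^ 2) =
        1 / ((p : ℕ) : ℝ) ^ 2 - (if p ∈ Q then 1 / ((p : ℕ) : ℝ) ^ 2 else 0) := fun p => by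
      split_ifs <;> ring
    rw [primeTail, tsum_congr h1, Summable.tsum_sub hs
      (summable_of_ne_finset_zero (s := Q) fun p hp => if_neg hp),
      tsum_eq_sum (s := Q) fun p hp => if_neg hp]
    congr 1
    exact Finset.sum_congr rfl fun p hp => if_pos hp
  simp_rw [show primeTail = _ from funext h]
  have := hs.hasSum.const_sub (∑' p : Nat.Primes, 1 / ((p : ℕ) : ℝ) ^ 2)
  rwa [sub_self] at this

/-- For fixed Q the quotient is asymptotically between D E(Q)(1 - O(tail of Q)) and D E(Q), where
E(Q) is the partial Euler product; x tends to infinity first and Q is chosen afterwards. -/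
lemma tendsto_tupleCount {m : ℕ} (hm : 4 ≤ m) {D : ℝ}
    (hD : HasDensity (labelCount (posLabels m)) D) {b : ℝ}
    (hb : HasProd (fun p : Nat.Primes =>
      (1 - 1 / ((p : ℕ) : ℝ)) ^ Fintype.card (Edge m) * evenSum m p) b) :
    Tendsto (fun x : ℝ => tupleCount ∅ (fun _ : Fin m => x) / mainTerm m x) atTop
      (nhds (D * b)) := by
  let E : Finset Nat.Primes → ℝ := fun Q => ∏ p ∈ Q,
      ((1 - 1 / ((p : ℕ) : ℝ)) ^ Fintype.card (Edge m) * evenSum m p)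
  have hE : Tendsto E atTop (nhds b) := hb
  have hx1 : ∀ x : ℝ, x • (fun _ : Fin m => (1 : ℝ)) = fun _ => x := fun x => by
    funext i
    simp
  have hup : ∀ Q, ∀ ε > 0, ∀ᶠ x : ℝ in atTop,
      tupleCount ∅ (fun _ : Fin m => x) / mainTerm m x ≤ D * E Q + ε := by
    intro Q ε hε
    have h := HasUpperDensity.tupleCount_empty (m := m) 1 Q _ (by
      simp only [one_mul]
      exact hasUpperDensity_tupleCount (hasDensity_coprimeLabels hD Q)) (fun _ => 1)
      (fun _ => one_pos) ε hε
    simpa only [hx1, one_mul, Real.sqrt_one, Finset.prod_const_one, mul_one, mul_assoc,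
      ← Finset.prod_mul_distrib] using h
  have hlo : ∀ Q, ∀ ε > 0, ∀ᶠ x : ℝ in atTop, D * E Q *
      (1 - Fintype.card (Edge m × Edge m) * primeTail Q) - ε ≤
      tupleCount ∅ (fun _ : Fin m => x) / mainTerm m x := by
    intro Q ε hε
    have h := HasUpperDensity.tupleCount_empty (m := m) (-1) Q _ (by
      simp only [neg_one_mul]
      exact hasUpperDensity_neg_tupleCount hm (hasDensity_coprimeLabels hD Q)) (fun _ => 1)
      (fun _ => one_pos) ε hε
    filter_upwards [h] with x hx
    simp only [hx1, neg_mul, one_mul, Real.sqrt_one, Finset.prod_const_one, mul_one,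
      neg_div] at hx
    have hEQ : E Q = (∏ p ∈ Q, (1 - 1 / ((p : ℕ) : ℝ)) ^ Fintype.card (Edge m)) *
        ∏ p ∈ Q, evenSum m p := Finset.prod_mul_distrib
    rw [hEQ]
    linarith
  have hlim1 : Tendsto (fun Q => D * E Q) atTop (nhds (D * b)) := hE.const_mul D
  have hlim2 : Tendsto (fun Q => D * E Q * (1 - Fintype.card (Edge m × Edge m) * primeTail Q))
      atTop (nhds (D * b)) := by
    have := hlim1.mul ((tendsto_primeTail.const_mul
      (Fintype.card (Edge m × Edge m) : ℝ)).const_sub 1)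
    simpa using this
  refine tendsto_order.2 ⟨fun a ha => ?_, fun a ha => ?_⟩
  · obtain ⟨Q, hQ⟩ := (hlim2.eventually_const_lt (show (a + D * b) / 2 < D * b by linarith)).exists
    filter_upwards [hlo Q ((D * b - a) / 2) (by linarith)] with x hx
    linarith
  · obtain ⟨Q, hQ⟩ := (hlim1.eventually_lt_const (show D * b < (a + D * b) / 2 by linarith)).exists
    filter_upwards [hup Q ((a - D * b) / 2) (by linarith)] with x hx
    linarith

/-! ### Convergence and positivity of the Euler product. -/

lemma sum_range_even (g : ℕ → ℝ) (k : ℕ) :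
    ∑ j ∈ Finset.range (2 * k + 1), (if Even j then g j else 0) =
      ∑ i ∈ Finset.range (k + 1), g (2 * i) := by
  induction k with
  | zero => simp
  | succ k ih =>
    rw [show 2 * (k + 1) + 1 = 2 * k + 1 + 1 + 1 by ring, Finset.sum_range_succ,
      Finset.sum_range_succ, ih, Finset.sum_range_succ _ (k + 1)]
    have h1 : ¬ Even (2 * k + 1) := by simp
    have h2 : Even (2 * k + 1 + 1) := ⟨k + 1, by ring⟩
    rw [if_neg h1, if_pos h2, add_zero]
    rfl

lemma evenSum_eq (k : ℕ) (p : Nat.Primes) : evenSum (2 * k) p =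
    ∑ i ∈ Finset.range (k + 1), ((2 * k).choose (2 * i) : ℝ) / (p : ℝ) ^ i := by
  have hp : (0 : ℝ) ≤ (p : ℕ) := Nat.cast_nonneg _
  have h := Finset.sum_powerset_apply_card
    (fun j => if Even j then 1 / Real.sqrt (p : ℕ) ^ j else 0)
    (x := (Finset.univ : Finset (Fin (2 * k))))
  rw [Finset.powerset_univ] at h
  rw [evenSum, Finset.sum_filter, h, Finset.card_univ, Fintype.card_fin]
  simp only [nsmul_eq_mul, mul_ite, mul_zero]
  rw [sum_range_even fun j => ((2 * k).choose j : ℝ) * (1 / Real.sqrt (p : ℕ) ^ j)]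
  refine Finset.sum_congr rfl fun i _ => ?_
  rw [pow_mul, Real.sq_sqrt hp, mul_one_div]

lemma card_edge_two_mul (k : ℕ) : Fintype.card (Edge (2 * k)) = k * (2 * k - 1) := by
  rw [card_edge, Nat.choose_two_right, mul_assoc, Nat.mul_div_cancel_left _ two_pos]

lemma eulerFactor_eq (k : ℕ) (p : Nat.Primes) : eulerFactor k p =
    (1 - 1 / ((p : ℕ) : ℝ)) ^ Fintype.card (Edge (2 * k)) * evenSum (2 * k) p := by
  rw [evenSum_eq, card_edge_two_mul]
  rfl

lemma eulerFactor_pos (k : ℕ) (p : Nat.Primes) : 0 < eulerFactor k p := by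
  have h2 : (2 : ℝ) ≤ (p : ℕ) := by exact_mod_cast p.2.two_le
  have h0 : (0 : ℝ) < (p : ℕ) := by linarith
  refine mul_pos (pow_pos ?_ _) ?_
  · rw [sub_pos, div_lt_one h0]
    linarith
  · refine Finset.sum_pos' (fun i _ => by positivity) ⟨0, by simp, by simp⟩

open Polynomial in
/-- The polynomial whose value at `1 / p` is the Euler factor at `p`. -/
noncomputable def eulerPoly (k : ℕ) : ℝ[X] :=
  (1 - X) ^ (k * (2 * k - 1)) *
    ∑ i ∈ Finset.range (k + 1), C ((2 * k).choose (2 * i) : ℝ) * X ^ i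

open Polynomial in
lemma eulerFactor_eq_eval (k : ℕ) (p : Nat.Primes) :
    eulerFactor k p = (eulerPoly k).eval (1 / ((p : ℕ) : ℝ)) := by
  rw [eulerFactor, eulerPoly, eval_mul, eval_pow, eval_sub, eval_one, eval_X, eval_finsetSum]
  congr 1
  refine Finset.sum_congr rfl fun i _ => ?_
  rw [eval_mul, eval_C, eval_pow, eval_X, one_div_pow, mul_one_div]

-- The linear coefficient is -k(2k - 1) + C(2k, 2) = 0, so the Euler factors are 1 + O(1/p²).
open Polynomial in
lemma X_sq_dvd_eulerPoly_sub_one {k : ℕ} (hk : 1 ≤ k) : X ^ 2 ∣ eulerPoly k - 1 := by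
  have e0 : (eulerPoly k).eval 0 = 1 := by
    rw [eulerPoly, eval_mul, eval_pow, eval_sub, eval_one, eval_X, eval_finsetSum,
      Finset.sum_eq_single 0]
    · simp
    · intro i _ hi
      simp [hi]
    · simp
  have e1 : (derivative (eulerPoly k)).eval 0 = 0 := by
    rw [eulerPoly, derivative_mul, derivative_pow, derivative_sum]
    simp only [eval_add, eval_mul, eval_pow, eval_sub, eval_one, eval_X, eval_finsetSum,
      derivative_sub, derivative_one, derivative_X, derivative_mul, derivative_C, eval_C,
      derivative_X_pow, eval_zero]
    rw [Finset.sum_eq_single 0, Finset.sum_eq_single 1]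
    · have hch : (2 * k).choose 2 = k * (2 * k - 1) := by
        rw [← card_edge, card_edge_two_mul]
      simp [hch]
    · intro i _ hi
      rcases Nat.eq_zero_or_pos i with rfl | h
      · simp
      · simp [show i - 1 ≠ 0 by omega]
    · intro h
      simp at h
      omega
    · intro i _ hi
      simp [hi]
    · simp
  rw [X_pow_dvd_iff]
  intro d hd
  interval_cases d
  · rw [coeff_zero_eq_eval_zero, eval_sub, e0, eval_one, sub_self]
  · rw [← zero_add 1, ← sub_zero (coeff _ _)]
    have := coeff_derivative (eulerPoly k - 1) 0
    rw [coeff_zero_eq_eval_zero, derivative_sub, derivative_one, sub_zero, e1] at this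
    simpa using this.symm

open Polynomial in
lemma summable_eulerFactor_sub_one {k : ℕ} (hk : 1 ≤ k) :
    Summable fun p : Nat.Primes => eulerFactor k p - 1 := by
  obtain ⟨r, hr⟩ := X_sq_dvd_eulerPoly_sub_one hk
  obtain ⟨C, hC⟩ := isCompact_Icc.exists_bound_of_continuousOn (s := Set.Icc (0 : ℝ) 1)
    r.continuous.continuousOn
  refine Summable.of_norm_bounded (summable_one_div_prime_sq.mul_left C) fun p => ?_
  have h2 : (1 : ℝ) ≤ (p : ℕ) := by exact_mod_cast p.2.one_le
  have hp : (1 / ((p : ℕ) : ℝ)) ∈ Set.Icc (0 : ℝ) 1 :=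
    ⟨by positivity, by rw [div_le_one (by linarith)]; exact h2⟩
  have h := congrArg (eval (1 / ((p : ℕ) : ℝ))) hr
  rw [eval_sub, eval_one, eval_mul, eval_pow, eval_X, ← eulerFactor_eq_eval] at h
  rw [h, norm_mul, norm_pow, Real.norm_of_nonneg hp.1, one_div_pow, mul_comm]
  exact mul_le_mul_of_nonneg_right (hC _ hp) (by positivity)

lemma multipliable_eulerFactor {k : ℕ} (hk : 1 ≤ k) : Multipliable (eulerFactor k) := by
  have := Real.multipliable_one_add_of_summable (summable_eulerFactor_sub_one hk)
  simpa using this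

/-- Convergence with positive factors alone would not exclude the limit 0; the summability of the
logarithms does. -/
lemma bConst_pos {k : ℕ} (hk : 1 ≤ k) : 0 < bConst k := by
  have h : Summable fun p : Nat.Primes => Real.log (eulerFactor k p) := by
    have := Real.summable_log_one_add_of_summable (summable_eulerFactor_sub_one hk)
    simpa using this
  rw [bConst, ← Real.rexp_tsum_eq_tprod (eulerFactor_pos k) h]
  exact Real.exp_pos _

/-! ### Rademacher moments and the counting of square tuples. -/

/-- The primes up to `N`. -/
def primesUpTo (N : ℕ) : Finset Nat.Primes := (Finset.Icc 1 N).subtype Nat.Prime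

lemma mem_primesUpTo {N : ℕ} {p : Nat.Primes} : p ∈ primesUpTo N ↔ (p : ℕ) ≤ N := by
  have h : p ∈ primesUpTo N ↔ (p : ℕ) ∈ Finset.Icc 1 N := Finset.mem_subtype
  rw [h, Finset.mem_Icc]
  exact and_iff_right p.2.one_le

lemma prod_primeFactors_attach {R : Type*} [CommMonoid R] {N n : ℕ} (hn : n ∈ Finset.Icc 1 N)
    (g : Nat.Primes → R) :
    ∏ p ∈ n.primeFactors.attach, g ⟨p.1, Nat.prime_of_mem_primeFactors p.2⟩ =
      ∏ p ∈ primesUpTo N, if (p : ℕ) ∣ n then g p else 1 := by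
  obtain ⟨h1, hN⟩ := Finset.mem_Icc.1 hn
  rw [← Finset.prod_filter]
  refine Finset.prod_bij (fun p _ => ⟨p.1, Nat.prime_of_mem_primeFactors p.2⟩) ?_ ?_ ?_ ?_
  · intro p _
    have hd := Nat.dvd_of_mem_primeFactors p.2
    exact Finset.mem_filter.2 ⟨mem_primesUpTo.2 ((Nat.le_of_dvd h1 hd).trans hN), hd⟩
  · intro p _ q _ h
    exact Subtype.ext (congrArg (fun r : Nat.Primes => (r : ℕ)) h)
  · intro p hp
    have hd := (Finset.mem_filter.1 hp).2
    exact ⟨⟨p, Nat.mem_primeFactors.2 ⟨p.2, hd, by omega⟩⟩, Finset.mem_attach _ _, rfl⟩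
  · intro p _
    rfl

lemma prod_prod_ite_dvd {R : Type*} [CommMonoid R] {m : ℕ} (s : Finset Nat.Primes)
    (n : Fin m → ℕ) (g : Nat.Primes → R) :
    ∏ i, ∏ p ∈ s, (if (p : ℕ) ∣ n i then g p else 1) =
      ∏ p ∈ s, g p ^ (Finset.univ.filter fun i => (p : ℕ) ∣ n i).card := by
  rw [Finset.prod_comm]
  refine Finset.prod_congr rfl fun p _ => ?_
  rw [← Finset.prod_filter, Finset.prod_const]

lemma mem_squareTuples_iff {m N : ℕ} {n : Fin m → ℕ} (hn : ∀ i, n i ∈ Finset.Icc 1 N) :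
    n ∈ squareTuples m ∅ ↔ (∀ i, Squarefree (n i)) ∧
      ∀ p ∈ primesUpTo N, Even (Finset.univ.filter fun i => (p : ℕ) ∣ n i).card := by
  constructor
  · refine fun h => ⟨h.1, fun p _ => ?_⟩
    -- With n as its own bound, n lies in its own fibre at p; fibres over sets of odd cardinality
    -- are empty.
    have hb : n ∈ {n' | n' ∈ boundedTuples ∅ (fun i => (n i : ℝ)) ∧
        (Finset.univ.filter fun i => (p : ℕ) ∣ n' i) =
          Finset.univ.filter fun i => (p : ℕ) ∣ n i} := ⟨⟨h, fun i => le_rfl⟩, rfl⟩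
    rw [boundedTuples_fiber (Finset.notMem_empty p)] at hb
    by_contra hodd
    rw [if_neg hodd] at hb
    exact hb
  · rintro ⟨hsf, hev⟩
    refine ⟨hsf, ?_, fun p hp => absurd hp (Finset.notMem_empty p)⟩
    have h1 : ∀ i, n i = ∏ p ∈ primesUpTo N, if (p : ℕ) ∣ n i then (p : ℕ) else 1 := fun i => by
      rw [← prod_primeFactors_attach (hn i) fun p => (p : ℕ)]
      rw [Finset.prod_attach (n i).primeFactors fun p => p]
      exact (Nat.prod_primeFactors_of_squarefree (hsf i)).symm
    rw [Finset.prod_congr rfl fun i _ => h1 i, prod_prod_ite_dvd]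
    exact Finset.prod_induction _ IsSquare (fun _ _ => IsSquare.mul) IsSquare.one
      fun p hp => (hev p hp).isSquare_pow _

lemma IsRademacherVariable.ae_eq {Ω : Type*} [MeasurableSpace Ω] {P : Measure Ω}
    [IsProbabilityMeasure P] {X : Ω → ℝ} (h : IsRademacherVariable P X) :
    ∀ᵐ ω ∂P, X ω = 1 ∨ X ω = -1 := by
  obtain ⟨hm, h1, h2⟩ := h
  have hs1 : MeasurableSet {ω | X ω = 1} := hm (measurableSet_singleton 1)
  have hs2 : MeasurableSet {ω | X ω = -1} := hm (measurableSet_singleton (-1))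
  have hdisj : Disjoint {ω | X ω = 1} {ω | X ω = -1} := Set.disjoint_left.2 fun ω h h' => by
    have h : X ω = 1 := h
    have h' : X ω = -1 := h'
    rw [h] at h'
    norm_num at h'
  have hu : P ({ω | X ω = 1} ∪ {ω | X ω = -1}) = 1 := by
    rw [measure_union hdisj hs2, h1, h2, ENNReal.add_halves]
  exact (prob_compl_eq_zero_iff (hs1.union hs2)).2 hu

lemma IsRademacherVariable.integral_pow {Ω : Type*} [MeasurableSpace Ω] {P : Measure Ω}
    [IsProbabilityMeasure P] {X : Ω → ℝ} (h : IsRademacherVariable P X) (c : ℕ) :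
    ∫ ω, X ω ^ c ∂P = if Even c then 1 else 0 := by
  have hs1 : MeasurableSet {ω | X ω = 1} := h.1 (measurableSet_singleton 1)
  have hs2 : MeasurableSet {ω | X ω = -1} := h.1 (measurableSet_singleton (-1))
  split_ifs with hc
  · rw [integral_congr_ae (g := fun _ => (1 : ℝ))]
    · simp
    · filter_upwards [h.ae_eq] with ω hω
      rcases hω with hω | hω <;> rw [hω]
      exacts [one_pow c, hc.neg_one_pow]
  · rw [integral_congr_ae (g := fun ω => Set.indicator {ω | X ω = 1} (fun _ => (1 : ℝ)) ω -
      Set.indicator {ω | X ω = -1} (fun _ => (1 : ℝ)) ω)]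
    · rw [integral_sub ((integrable_const _).indicator hs1) ((integrable_const _).indicator hs2),
        integral_indicator_const _ hs1, integral_indicator_const _ hs2, Measure.real,
        Measure.real, h.2.1, h.2.2, sub_self]
    · filter_upwards [h.ae_eq] with ω hω
      rcases hω with hω | hω
      · rw [Set.indicator_of_mem (show ω ∈ {ω | X ω = 1} from hω),
          Set.indicator_of_notMem (show ω ∉ {ω | X ω = -1} from fun h' : X ω = -1 => by
            rw [hω] at h'; norm_num at h'), hω, one_pow, sub_zero]
      · rw [Set.indicator_of_mem (show ω ∈ {ω | X ω = -1} from hω),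
          Set.indicator_of_notMem (show ω ∉ {ω | X ω = 1} from fun h' : X ω = 1 => by
            rw [hω] at h'; norm_num at h'), hω, (Nat.not_even_iff_odd.1 hc).neg_one_pow, zero_sub]

lemma integral_prod_pow {Ω : Type*} [MeasurableSpace Ω] {P : Measure Ω} [IsProbabilityMeasure P]
    {Y : Nat.Primes → Ω → ℝ} (hlaw : ∀ p, IsRademacherVariable P (Y p)) (hindep : iIndepFun Y P)
    (s : Finset Nat.Primes) (c : Nat.Primes → ℕ) :
    ∫ ω, ∏ p ∈ s, Y p ω ^ c p ∂P = if ∀ p ∈ s, Even (c p) then 1 else 0 := by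
  have h := (hindep.precomp (g := ((↑) : s → Nat.Primes)) Subtype.coe_injective)
  have h2 := iIndepFun.integral_fun_prod_comp (𝕜 := ℝ) (ι := s) (X := fun p : s => Y p)
    (f := fun p x => x ^ c p) h (fun p => (hlaw p).1.aemeasurable) fun p => by fun_prop
  simp_rw [fun p : s => (hlaw p).integral_pow (c p)] at h2
  have h3 : ∀ ω, ∏ p ∈ s, Y p ω ^ c p = ∏ p : s, Y p ω ^ c p := fun ω =>
    (Finset.prod_coe_sort s fun p => Y p ω ^ c p).symm
  simp_rw [h3]
  refine h2.trans ?_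
  rw [Finset.prod_coe_sort s fun p => if Even (c p) then (1 : ℝ) else 0]
  split_ifs with hall
  · exact Finset.prod_eq_one fun p hp => if_pos (hall p hp)
  · push Not at hall
    obtain ⟨p, hp, hpc⟩ := hall
    exact Finset.prod_eq_zero hp (if_neg (Nat.not_even_iff_odd.2 (by simpa using hpc)))

lemma prod_rademacherExtension {Ω : Type*} (Y : Nat.Primes → Ω → ℝ) {m N : ℕ} {n : Fin m → ℕ}
    (hn : ∀ i, n i ∈ Finset.Icc 1 N) (ω : Ω) :
    ∏ i, rademacherExtension Y (n i) ω = (if ∀ i, Squarefree (n i) then 1 else 0) *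
      ∏ p ∈ primesUpTo N, Y p ω ^ (Finset.univ.filter fun i => (p : ℕ) ∣ n i).card := by
  simp only [rademacherExtension]
  rw [Finset.prod_mul_distrib, Finset.prod_congr rfl fun i _ =>
    prod_primeFactors_attach (hn i) fun p => Y p ω, prod_prod_ite_dvd]
  congr 1
  have h : ∀ i, |(ArithmeticFunction.moebius (n i) : ℝ)| = if Squarefree (n i) then 1 else 0 := by
    intro i
    have := congrArg (fun z : ℤ => (z : ℝ)) (ArithmeticFunction.abs_moebius (n := n i))
    simpa using this
  simp_rw [h]
  split_ifs with hall
  · exact Finset.prod_eq_one fun i _ => if_pos (hall i)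
  · push Not at hall
    obtain ⟨i, hi⟩ := hall
    exact Finset.prod_eq_zero (Finset.mem_univ i) (if_neg hi)

lemma integrable_prod_pow {Ω : Type*} [MeasurableSpace Ω] {P : Measure Ω} [IsProbabilityMeasure P]
    {Y : Nat.Primes → Ω → ℝ} (hlaw : ∀ p, IsRademacherVariable P (Y p))
    (s : Finset Nat.Primes) (c : Nat.Primes → ℕ) :
    Integrable (fun ω => ∏ p ∈ s, Y p ω ^ c p) P := by
  have hY := fun p => (hlaw p).1
  refine Integrable.of_bound (Measurable.aestronglyMeasurable (by fun_prop)) 1 ?_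
  have : ∀ᵐ ω ∂P, ∀ p, Y p ω = 1 ∨ Y p ω = -1 := ae_all_iff.2 fun p => (hlaw p).ae_eq
  filter_upwards [this] with ω hω
  rw [norm_prod]
  refine Finset.prod_le_one (fun _ _ => norm_nonneg _) fun p _ => ?_
  rcases hω p with h | h <;> simp [h]

/-- This is orthogonality: after expansion a tuple contributes 1 if all its entries are squarefree
and every prime divides an even number of them, and 0 otherwise. -/
lemma integral_abs_sum_pow {Ω : Type*} [MeasurableSpace Ω] {P : Measure Ω}
    [IsProbabilityMeasure P] {Y : Nat.Primes → Ω → ℝ} (hlaw : ∀ p, IsRademacherVariable P (Y p))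
    (hindep : iIndepFun Y P) (k : ℕ) {x : ℝ} (hx : 0 ≤ x) :
    ∫ ω, |∑ n ∈ Finset.Icc 1 ⌊x⌋₊, rademacherExtension Y n ω| ^ (2 * k) ∂P =
      tupleCount ∅ fun _ : Fin (2 * k) => x := by
  classical
  set N := ⌊x⌋₊
  let T : Finset (Fin (2 * k) → ℕ) := Fintype.piFinset fun _ => Finset.Icc 1 N
  have hT : ∀ {n}, n ∈ T → ∀ i, n i ∈ Finset.Icc 1 N := fun h => Fintype.mem_piFinset.1 h
  have hpow : ∀ ω, |∑ n ∈ Finset.Icc 1 N, rademacherExtension Y n ω| ^ (2 * k) =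
      ∑ n ∈ T, (if ∀ i, Squarefree (n i) then 1 else 0) *
      ∏ p ∈ primesUpTo N, Y p ω ^ (Finset.univ.filter fun i => (p : ℕ) ∣ n i).card := by
    intro ω
    have h : (∑ n ∈ Finset.Icc 1 N, rademacherExtension Y n ω) ^ (2 * k) =
        ∏ _i : Fin (2 * k), ∑ n ∈ Finset.Icc 1 N, rademacherExtension Y n ω := by simp
    rw [(even_two_mul k).pow_abs, h, Finset.prod_univ_sum]
    exact Finset.sum_congr rfl fun n hn => prod_rademacherExtension Y (hT hn) ω
  simp_rw [hpow]
  rw [integral_finsetSum _ fun n _ => (integrable_prod_pow hlaw _ _).const_mul _]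
  simp_rw [integral_const_mul, integral_prod_pow hlaw hindep]
  have hset : boundedTuples ∅ (fun _ : Fin (2 * k) => x) =
      ((T.filter fun n => (∀ i, Squarefree (n i)) ∧ ∀ p ∈ primesUpTo N,
        Even (Finset.univ.filter fun i => (p : ℕ) ∣ n i).card : Finset (Fin (2 * k) → ℕ)) :
        Set (Fin (2 * k) → ℕ)) := by
    ext n
    rw [Finset.mem_coe, Finset.mem_filter]
    constructor
    · intro h
      have hnT : n ∈ T := Fintype.mem_piFinset.2 fun i =>
        Finset.mem_Icc.2 ⟨Nat.pos_of_ne_zero (h.1.1 i).ne_zero, Nat.le_floor (h.2 i)⟩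
      exact ⟨hnT, (mem_squareTuples_iff (hT hnT)).1 h.1⟩
    · rintro ⟨hnT, h⟩
      exact ⟨(mem_squareTuples_iff (hT hnT)).2 h, fun i =>
        (Nat.le_floor_iff hx).1 (Finset.mem_Icc.1 (hT hnT i)).2⟩
  rw [tupleCount, hset, Set.ncard_coe_finset, Finset.card_filter, Nat.cast_sum]
  refine Finset.sum_congr rfl fun n _ => ?_
  rw [ite_and]
  split_ifs <;> simp

/-! ### Identification of γ(k) and conclusion. -/

lemma gammaIntegrand_eq (k : ℕ) (c t : Fin (2 * k) → ℝ) :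
    gammaIntegrand k c t =
      Complex.I ^ (2 * k) * (edgeKernel c t * Complex.exp (∑ i, linePoint c t i)) := by
  rw [gammaIntegrand, edgeKernel, prod_edge_eq fun i j => (linePoint c t i + linePoint c t j)⁻¹,
    Finset.prod_mul_distrib, Finset.prod_const, Finset.card_univ, Fintype.card_fin,
    Complex.exp_sum]
  simp only [one_div]
  ring

/-- The factors i from ds_j = i dt_j cancel those in (2πi)^{2k}. -/
lemma gammaConst_eq (k : ℕ) (c : Fin (2 * k) → ℝ) : gammaConst k c = edgeConst c := by
  rw [gammaConst, edgeConst]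
  simp_rw [gammaIntegrand_eq]
  rw [integral_const_mul, mul_pow]
  field_simp

lemma integrable_gammaIntegrand {k : ℕ} (hk : 2 ≤ k) {c : Fin (2 * k) → ℝ} (hc : ∀ j, 0 < c j) :
    Integrable (gammaIntegrand k c) := by
  have hm : 4 ≤ 2 * k := by omega
  have hmeas : Measurable (gammaIntegrand k c) := by
    have := fun j => (continuous_linePoint c j).measurable
    have := measurable_edgeKernel c
    rw [show gammaIntegrand k c = _ from funext fun t => gammaIntegrand_eq k c t]
    fun_prop
  refine ((integrable_edgeKernel hm hc).norm.mul_const (Real.exp (∑ i, c i))).mono'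
    hmeas.aestronglyMeasurable (Eventually.of_forall fun t => ?_)
  rw [gammaIntegrand_eq, norm_mul, norm_mul, norm_pow, Complex.norm_I, one_pow, one_mul,
    Complex.norm_exp]
  simp [linePoint_re]

theorem mainTheorem5 {Ω : Type*} [MeasurableSpace Ω] (P : Measure Ω) [IsProbabilityMeasure P]
    (Y : Nat.Primes → Ω → ℝ) (hlaw : ∀ p, IsRademacherVariable P (Y p)) (hindep : iIndepFun Y P)
    (k : ℕ) (hk : 2 ≤ k) (c : Fin (2 * k) → ℝ) (hc : ∀ j, 0 < c j) :
    Multipliable (eulerFactor k) ∧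
    Integrable (gammaIntegrand k c) ∧
    (fun x : ℝ =>
        ((∫ ω, |∑ n ∈ Finset.Icc 1 ⌊x⌋₊, rademacherExtension Y n ω| ^ (2 * k) ∂P : ℝ) : ℂ))
      ~[atTop]
    (fun x : ℝ =>
        gammaConst k c * (bConst k : ℂ) * 2 ^ (2 * k) * (x : ℂ) ^ k *
          (Real.log x : ℂ) ^ (2 * k ^ 2 - 3 * k)) := by
  have hm : 4 ≤ 2 * k := by omega
  have hmult := multipliable_eulerFactor (k := k) (by omega)
  refine ⟨hmult, integrable_gammaIntegrand hk hc, ?_⟩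
  have hD := hasDensity_labelCount (hasDensity_edgeVolume hm hc)
  have hDpos := hD.labelCount_pos hm
  set g := (edgeConst c).re with hg
  have hprod : HasProd (fun p : Nat.Primes => (1 - 1 / ((p : ℕ) : ℝ)) ^
      Fintype.card (Edge (2 * k)) * evenSum (2 * k) p) (bConst k) := by
    simp_rw [← eulerFactor_eq]
    exact hmult.hasProd
  have hlim := tendsto_tupleCount hm hD hprod
  have hb := bConst_pos (k := k) (by omega)
  have hne : 2 ^ (2 * k) * g * bConst k ≠ 0 := (mul_pos hDpos hb).ne'
  -- The exponent of the logarithm is the number of edges minus the number of vertices.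
  have hr : Fintype.card (Edge (2 * k)) - 2 * k = 2 * k ^ 2 - 3 * k := by
    rw [card_edge_two_mul, Nat.mul_sub, mul_one, Nat.sub_sub]
    congr 1 <;> ring
  have hmain : ∀ x : ℝ, 1 < x → mainTerm (2 * k) x = x ^ k * Real.log x ^ (2 * k ^ 2 - 3 * k) :=
    fun x hx => by rw [mainTerm, hr, pow_mul, Real.sq_sqrt (by linarith)]
  have hreal : (fun x : ℝ => tupleCount ∅ fun _ : Fin (2 * k) => x) ~[atTop]
      fun x => 2 ^ (2 * k) * g * bConst k * mainTerm (2 * k) x := by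
    refine (isEquivalent_iff_tendsto_one ?_).2 ?_
    · filter_upwards [eventually_gt_atTop 1] with x hx
      exact mul_ne_zero hne (mainTerm_pos _ hx).ne'
    · have := hlim.div_const (2 ^ (2 * k) * g * bConst k)
      rw [div_self hne] at this
      refine this.congr fun x => ?_
      rw [Pi.div_apply, div_div, mul_comm (mainTerm _ _)]
  have hcast : (fun x : ℝ => ((tupleCount ∅ (fun _ : Fin (2 * k) => x) : ℝ) : ℂ)) ~[atTop]
      fun x => ((2 ^ (2 * k) * g * bConst k * mainTerm (2 * k) x : ℝ) : ℂ) := by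
    -- Asymptotic equivalence passes from ℝ to ℂ because the embedding preserves differences and
    -- norms.
    rw [IsEquivalent, ← isLittleO_norm_norm] at hreal ⊢
    refine hreal.congr (fun x => ?_) fun x => ?_
    · simp only [Pi.sub_apply]
      rw [← Complex.ofReal_sub, Complex.norm_real]
    · rw [Complex.norm_real]
  refine (hcast.congr_left ?_).congr_right ?_
  · filter_upwards [eventually_ge_atTop 0] with x hx
    rw [integral_abs_sum_pow hlaw hindep k hx]
  · filter_upwards [eventually_gt_atTop 1] with x hx
    rw [hmain x hx, gammaConst_eq, edgeConst_eq_ofReal hm hc]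
    push_cast
    ring
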